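/- **Setting.** Let $m,\ell\ge 1$, $N=m+\ell\ge 3$, $\gamma\ge 0$; write $z=(x,y)\in\mathbb{R}^m\times\mathbb{R}^\ell=\mathbb{R}^N$, $N_\gamma=m+(1+\gamma)\ell$, $2^*_\gamma=\frac{2N_\gamma}{N_\gamma-2}$, $\nabla_\gamma u=(\nabla_x u,|x|^\gamma\nabla_y u)$ and $\Delta_\gamma=\Delta_x+|x|^{2\gamma}\Delta_y$. Let $D_\gamma(\mathbb{R}^N)$ be the space of all $u\in L^{2^*_\gamma}(\mathbb{R}^N)$ whose weak Grushin gradient $\nabla_\gamma u$ (taken with respect to the vector fields $\partial_{x_i}$ and $|x|^\gamma\partial_{y_j}$) belongs to $L^2$, with the norm $\|u\|_\gamma=\left(\int_{\mathbb{R}^N}|\nabla_\gamma u|^2\,dz\right)^{1/2}$. Let $g\in L^1(\mathbb{R}^N)\cap L^\infty(\mathbb{R}^N)$ with $g>0$ a.e., and let $f:[0,\infty)\to\mathbb{R}$ be continuous with $f(0)=0$ such that - $\lim_{t\to0^+}f(t)/t=0$, and for some $\alpha\in(2,2^*_\gamma)$ the limit $\lim_{t\to\infty}f(t)/t^{\alpha-1}$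 exists and is finite; - there are $\theta>2$ and $t_0>0$ with $0<\theta F(t)\le t f(t)$ for all $t>t_0$, where $F(t)=\int_0^t f(s)\,ds$. For $a>0$ set $f_a(t)=f(t)-a$ for $t\ge0$, $f_a(t)=-a(t+1)$ for $-1<t<0$, $f_a(t)=0$ for $t\le-1$; let $F_a(t)=\int_0^t f_a(s)\,ds$ and $$I_a(u)=\tfrac12\|u\|_\gamma^2-\int_{\mathbb{R}^N}g(z)F_a(u(z))\,dz,\qquad u\in D_\gamma(\mathbb{R}^N).$$ A weak solution of $$-\Delta_\gamma u=g(z)f_a(u)\ \text{ in }\mathbb{R}^N\tag{SP}$$ is a $u\in D_\gamma(\mathbb{R}^N)$ such that, for all $\varphi\in D_\gamma(\mathbb{R}^N)$, $g f_a(u)\varphi$ is integrable and $\int\nabla_\gamma u\cdot\nabla_\gamma\varphi\,dz=\int g f_a(u)\varphi\,dz$. Say that $(\rho,\delta,a_1,v)$, with $\rho,\delta,a_1>0$ and $v\in D_\gamma(\mathbb{R}^N)$, is a *mountain pass geometry* if for all $a\in(0,a_1)$ one has $I_a(u)\ge\delta$ whenever $\|u\|_\gamma=\rho$, and moreover $\|v\|_\gamma>\rho$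 and $I_a(v)<0$ for all $a\in(0,a_1)$. **Theorem.** The integrand $gF_a(u)$ is integrable for all $a>0$ and $u\in D_\gamma(\mathbb{R}^N)$. There is $r>0$ such that for every $\rho\in(0,r)$ there are $\delta>0$, $a_1>0$ and $v\in D_\gamma(\mathbb{R}^N)$ for which $(\rho,\delta,a_1,v)$ is a mountain pass geometry. For every mountain pass geometry $(\rho,\delta,a_1,v)$ there is a constant $C>0$ such that for each $a\in(0,a_1)$ problem (SP) has a nontrivial weak solution $u_a\in D_\gamma(\mathbb{R}^N)$ that is a critical point of $I_a$ (the Fréchet derivative of $I_a$ at $u_a$ exists and is $0$) at the mountain pass level, $$I_a(u_a)=\inf_{p}\max_{t\in[0,1]}I_a(p(t))\ge\delta,$$ where $p$ ranges over the continuous paths $p:[0,1]\to D_\gamma(\mathbb{R}^N)$ with $p(0)=0$ and $p(1)=v$, and $\|u_a\|_\gamma\le C$. -/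

import Mathlib

open MeasureTheory Set Filter Topology
open scoped ContDiff ENNReal

noncomputable section

namespace Grushin

/-- A direction in which the distributional derivative of an `L^p` function (`1 < p < ∞`)
vanishes forces the function to vanish. Only used to see that `‖·‖_γ` is a norm. -/
lemma ae_eq_zero_of_weak_dirDeriv {E : Type*} [NormedAddCommGroup E] [NormedSpace ℝ E]
    [FiniteDimensional ℝ E] [MeasurableSpace E] [BorelSpace E] {μ : Measure E}
    [μ.IsAddHaarMeasure] {p : ℝ} (hp : 1 < p) {u : E → ℝ} (hu : MemLp u (ENNReal.ofReal p) μ)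
    {e : E} (he : e ≠ 0)
    (h : ∀ φ : E → ℝ, ContDiff ℝ ∞ φ → HasCompactSupport φ →
      ∫ z, u z * fderiv ℝ φ z e ∂μ = 0) : u =ᵐ[μ] 0 := by
  have hloc : LocallyIntegrable u μ := hu.locallyIntegrable (by
    rw [← ENNReal.ofReal_one]; exact ENNReal.ofReal_le_ofReal hp.le)
  -- translates of a reflected test function
  have hsupp : ∀ (ψ : E → ℝ) (x : E), HasCompactSupport ψ →
      HasCompactSupport (fun z => ψ (x - z)) := fun ψ x hψ =>
    hψ.comp_homeomorph (Homeomorph.subLeft x)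
  have hcd : ∀ (ψ : E → ℝ) (x : E), ContDiff ℝ ∞ ψ → ContDiff ℝ ∞ (fun z => ψ (x - z)) :=
    fun ψ x hψ => hψ.comp (contDiff_const.sub contDiff_id)
  have hconst : ∀ ψ : E → ℝ, ContDiff ℝ ∞ ψ → HasCompactSupport ψ → ∀ t : ℝ,
      ∫ z, u z * ψ (t • e - z) ∂μ = ∫ z, u z * ψ (0 - z) ∂μ := by
    intro ψ hψ hψc t
    set c : E → ℝ := convolution u ψ (ContinuousLinearMap.mul ℝ ℝ) μ with hc
    have hd : ∀ s : ℝ, HasDerivAt (fun s : ℝ => c (s • e)) 0 s := by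
      intro s
      have h1 := hψc.hasFDerivAt_convolution_right (ContinuousLinearMap.mul ℝ ℝ) hloc
        (hψ.of_le (by exact_mod_cast le_top)) (s • e)
      have h2 : HasDerivAt (fun s : ℝ => s • e) e s := by
        simpa using (hasDerivAt_id s).smul_const e
      have h3 := h1.comp_hasDerivAt s h2
      refine h3.congr_deriv ?_
      have hint : Integrable (fun z => ((ContinuousLinearMap.mul ℝ ℝ).precompR E (u z))
          (fderiv ℝ ψ (s • e - z))) μ :=
        (hψc.fderiv ℝ).convolutionExists_right _ hloc
          (hψ.continuous_fderiv (by simp)) (s • e)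
      rw [convolution_def, ContinuousLinearMap.integral_apply hint]
      have h4 := h (fun z => ψ (s • e - z)) (hcd ψ _ hψ) (hsupp ψ _ hψc)
      rw [← neg_eq_zero, ← integral_neg] at h4
      refine Eq.trans ?_ h4
      congr 1
      ext z
      have h5 : HasFDerivAt (fun z => ψ (s • e - z))
          ((fderiv ℝ ψ (s • e - z)).comp (-ContinuousLinearMap.id ℝ E)) z := by
        have := ((hψ.differentiable (by simp)) (s • e - z)).hasFDerivAt
        exact this.comp z ((hasFDerivAt_id z).const_sub (s • e))
      rw [h5.fderiv]
      simp [ContinuousLinearMap.precompR_apply]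
    have := is_const_of_deriv_eq_zero (fun s => (hd s).differentiableAt)
      (fun s => (hd s).deriv) t 0
    simpa [hc, convolution_def] using this
  have hzero : ∀ ψ : E → ℝ, ContDiff ℝ ∞ ψ → HasCompactSupport ψ →
      ∫ z, u z * ψ (0 - z) ∂μ = 0 := by
    intro ψ hψ hψc
    obtain ⟨q, hpq⟩ : ∃ q, p.HolderConjugate q := ⟨_, Real.HolderConjugate.conjExponent hp⟩
    set A : ℝ := (∫ z, ‖ψ z‖ ^ q ∂μ) ^ (1 / q) with hA
    have hA0 : 0 ≤ A := by positivity
    have key : ∀ ε : ℝ, 0 < ε → ‖∫ z, u z * ψ (0 - z) ∂μ‖ ≤ ε * A := by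
      intro ε hε
      obtain ⟨w, hwc, hwε, hwcont, hwmem⟩ :=
        hu.exists_hasCompactSupport_integral_rpow_sub_le (by linarith : 0 < p)
          (Real.rpow_pos_of_pos hε p)
      -- far translates do not see `w`
      obtain ⟨t, ht⟩ : ∃ t : ℝ, ∀ z, w z * ψ (t • e - z) = 0 := by
        obtain ⟨R, hR⟩ := hwc.isCompact.isBounded.exists_norm_le
        obtain ⟨S, hS⟩ := hψc.isCompact.isBounded.exists_norm_le
        have hen : 0 < ‖e‖ := norm_pos_iff.2 he
        refine ⟨(|R| + |S| + 1) / ‖e‖, fun z => ?_⟩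
        by_contra hne
        have hz1 : ‖z‖ ≤ R := hR z (subset_tsupport _ (left_ne_zero_of_mul hne))
        have hz2 := hS _ (subset_tsupport _ (right_ne_zero_of_mul hne))
        have h6 : ‖((|R| + |S| + 1) / ‖e‖) • e‖ = |R| + |S| + 1 := by
          rw [norm_smul, Real.norm_of_nonneg (by positivity)]
          field_simp
        have h7 := norm_sub_norm_le (((|R| + |S| + 1) / ‖e‖) • e) z
        rw [h6] at h7
        linarith [le_abs_self R, le_abs_self S]
      rw [← hconst ψ hψ hψc t]
      set χ : E → ℝ := fun z => ψ (t • e - z) with hχ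
      have hχc : HasCompactSupport χ := hsupp ψ _ hψc
      have hχcont : Continuous χ := (hcd ψ _ hψ).continuous
      have hχmem : MemLp χ (ENNReal.ofReal q) μ := hχcont.memLp_of_hasCompactSupport hχc
      have hH := integral_mul_norm_le_Lp_mul_Lq hpq (hu.sub hwmem) hχmem
      have h8 : (∫ z, ‖χ z‖ ^ q ∂μ) = ∫ z, ‖ψ z‖ ^ q ∂μ :=
        integral_sub_left_eq_self (fun z => ‖ψ z‖ ^ q) μ (t • e)
      rw [h8, ← hA] at hH
      have h9 : (∫ z, ‖(u - w) z‖ ^ p ∂μ) ^ (1 / p) ≤ ε := by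
        have : (∫ z, ‖(u - w) z‖ ^ p ∂μ) ^ (1 / p) ≤ (ε ^ p) ^ (1 / p) :=
          Real.rpow_le_rpow (integral_nonneg fun z => by positivity) hwε
            (by have := hpq.pos; positivity)
        rwa [← Real.rpow_mul hε.le, mul_one_div_cancel hpq.ne_zero, Real.rpow_one] at this
      calc ‖∫ z, u z * χ z ∂μ‖ = ‖∫ z, (u - w) z * χ z ∂μ‖ := by
            congr 2; ext z
            have := ht z
            simp only [Pi.sub_apply, sub_mul]
            rw [show w z * χ z = 0 from ht z, sub_zero]
        _ ≤ ∫ z, ‖(u - w) z * χ z‖ ∂μ := norm_integral_le_integral_norm _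
        _ = ∫ z, ‖(u - w) z‖ * ‖χ z‖ ∂μ := by simp only [norm_mul]
        _ ≤ _ := hH
        _ ≤ ε * A := mul_le_mul_of_nonneg_right h9 hA0
    by_contra hne
    have hpos : 0 < ‖∫ z, u z * ψ (0 - z) ∂μ‖ := norm_pos_iff.2 hne
    have h10 := key (‖∫ z, u z * ψ (0 - z) ∂μ‖ / (2 * (A + 1))) (by positivity)
    rw [div_mul_eq_mul_div, le_div_iff₀ (by positivity)] at h10
    nlinarith
  refine ae_eq_zero_of_integral_contDiff_smul_eq_zero hloc fun g hg hgc => ?_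
  have := hzero (fun z => g (0 - z)) (hcd g 0 hg) (hsupp g 0 hgc)
  simpa [mul_comm] using this

/-- The data of a Baouendi–Grushin structure: `ℝ^N = ℝ^m × ℝ^ℓ` with `m, ℓ ≥ 1`,
`N = m + ℓ ≥ 3`, and a real exponent `γ ≥ 0`. -/
structure Params where
  m : ℕ
  l : ℕ
  γ : ℝ
  one_le_m : 1 ≤ m
  one_le_l : 1 ≤ l
  three_le : 3 ≤ m + l
  γ_nonneg : 0 ≤ γ

namespace Params

variable (P : Params)

/-- The points `z = (x, y)` of `ℝ^N = ℝ^m × ℝ^ℓ` (with Lebesgue measure `volume`). -/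
abbrev Pt : Type := EuclideanSpace ℝ (Fin P.m) × EuclideanSpace ℝ (Fin P.l)

/-- Values of Grushin gradients: `ℝ^N` with its Euclidean inner product. -/
abbrev Vec : Type := EuclideanSpace ℝ (Fin P.m ⊕ Fin P.l)

/-- The homogeneous dimension `N_γ = m + (1 + γ) ℓ`. -/
def homDim : ℝ := P.m + (1 + P.γ) * P.l

/-- The critical exponent `2*_γ = 2 N_γ / (N_γ - 2)`. -/
def critExp : ℝ := 2 * P.homDim / (P.homDim - 2)

lemma two_lt_homDim : 2 < P.homDim := by
  have h1 : (3 : ℝ) ≤ P.m + P.l := by exact_mod_cast P.three_le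
  have h2 : 0 ≤ P.γ * P.l := mul_nonneg P.γ_nonneg (Nat.cast_nonneg _)
  unfold homDim
  nlinarith

lemma two_lt_critExp : 2 < P.critExp := by
  have h := P.two_lt_homDim
  unfold critExp
  rw [lt_div_iff₀ (by linarith)]
  linarith

instance : Fact ((1 : ℝ≥0∞) ≤ ENNReal.ofReal P.critExp) :=
  ⟨by rw [← ENNReal.ofReal_one]
      exact ENNReal.ofReal_le_ofReal (by linarith [P.two_lt_critExp])⟩

/-- The Grushin gradient `∇_γ φ = (∇_x φ, |x|^γ ∇_y φ)` of a differentiable function. -/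
def gradSmooth (φ : P.Pt → ℝ) (z : P.Pt) : P.Vec :=
  WithLp.toLp 2 (Sum.elim
    (fun i => fderiv ℝ φ z (EuclideanSpace.single i 1, 0))
    (fun j => ‖z.1‖ ^ P.γ * fderiv ℝ φ z (0, EuclideanSpace.single j 1)))

/-- `v` is the weak Grushin gradient of `u`: for each of the vector fields
`X_i = ∂_{x_i}` and `X_{m+j} = |x|^γ ∂_{y_j}` (which are formally skew-adjoint),
`∫ u X_i φ = - ∫ v_i φ` for all test functions `φ`. -/
def IsWeakGrad (u : P.Pt → ℝ) (v : P.Pt → P.Vec) : Prop :=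
  ∀ φ : P.Pt → ℝ, ContDiff ℝ ∞ φ → HasCompactSupport φ → ∀ i : Fin P.m ⊕ Fin P.l,
    ∫ z, u z * P.gradSmooth φ z i = - ∫ z, v z i * φ z

/-- `L^{2*_γ}(ℝ^N)`. -/
abbrev LCrit : Type := Lp ℝ (ENNReal.ofReal P.critExp) (volume : Measure P.Pt)

/-- `L²(ℝ^N; ℝ^N)`. -/
abbrev LGrad : Type := Lp P.Vec 2 (volume : Measure P.Pt)

lemma gradSmooth_apply_continuous {φ : P.Pt → ℝ} (hφ : ContDiff ℝ ∞ φ) (i : Fin P.m ⊕ Fin P.l) :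
    Continuous fun z => P.gradSmooth φ z i := by
  have h := hφ.continuous_fderiv (by simp)
  rcases i with i | j
  · simp only [gradSmooth, Sum.elim_inl]
    exact h.clm_apply continuous_const
  · simp only [gradSmooth, Sum.elim_inr]
    exact (continuous_fst.norm.rpow_const fun _ => Or.inr P.γ_nonneg).mul
      (h.clm_apply continuous_const)

lemma gradSmooth_apply_hasCompactSupport {φ : P.Pt → ℝ} (hφ : HasCompactSupport φ)
    (i : Fin P.m ⊕ Fin P.l) : HasCompactSupport fun z => P.gradSmooth φ z i := by
  refine (hφ.fderiv ℝ).mono fun z hz => ?_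
  contrapose! hz
  have hz' : fderiv ℝ φ z = 0 := by simpa using hz
  rcases i with i | j <;> simp [gradSmooth, hz']

lemma integrable_mul_gradSmooth (u : P.LCrit) {φ : P.Pt → ℝ} (hφ : ContDiff ℝ ∞ φ)
    (hφc : HasCompactSupport φ) (i : Fin P.m ⊕ Fin P.l) :
    Integrable fun z => u z * P.gradSmooth φ z i :=
  ((Lp.memLp u).locallyIntegrable Fact.out).integrable_smul_right_of_hasCompactSupport
    (P.gradSmooth_apply_continuous hφ i) (P.gradSmooth_apply_hasCompactSupport hφc i)

lemma integrable_comp_mul (v : P.LGrad) {φ : P.Pt → ℝ} (hφ : ContDiff ℝ ∞ φ)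
    (hφc : HasCompactSupport φ) (i : Fin P.m ⊕ Fin P.l) :
    Integrable fun z => v z i * φ z := by
  have h := (((Lp.memLp v).locallyIntegrable
    (by norm_num)).integrable_smul_left_of_hasCompactSupport hφ.continuous hφc)
  have h2 := (EuclideanSpace.proj (𝕜 := ℝ) i : P.Vec →L[ℝ] ℝ).integrable_comp h
  simpa [mul_comm] using h2

/-- The pairs `(u, v)`, `u ∈ L^{2*_γ}`, `v ∈ L²`, for which `v` is the weak Grushin gradient
of `u`. -/
def graph : Submodule ℝ (P.LCrit × P.LGrad) where
  carrier := {w | P.IsWeakGrad w.1 w.2}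
  zero_mem' := by
    intro φ hφ hφc i
    have h1 : ∫ z, (0 : P.LCrit) z * P.gradSmooth φ z i = 0 :=
      integral_eq_zero_of_ae (by
        filter_upwards [Lp.coeFn_zero ℝ (ENNReal.ofReal P.critExp) (volume : Measure P.Pt)]
          with z hz
        rw [hz]; simp)
    have h2 : ∫ z, (0 : P.LGrad) z i * φ z = 0 :=
      integral_eq_zero_of_ae (by
        filter_upwards [Lp.coeFn_zero P.Vec 2 (volume : Measure P.Pt)] with z hz
        rw [hz]; simp)
    simp only [Prod.fst_zero, Prod.snd_zero, h1, h2, neg_zero]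
  add_mem' := by
    intro w₁ w₂ h₁ h₂ φ hφ hφc i
    have e₁ : ∫ z, (w₁ + w₂).1 z * P.gradSmooth φ z i =
        ∫ z, (w₁.1 z * P.gradSmooth φ z i + w₂.1 z * P.gradSmooth φ z i) :=
      integral_congr_ae (by
        filter_upwards [Lp.coeFn_add w₁.1 w₂.1] with z hz
        simp only [Prod.fst_add, hz, Pi.add_apply, add_mul])
    have e₂ : ∫ z, (w₁ + w₂).2 z i * φ z = ∫ z, (w₁.2 z i * φ z + w₂.2 z i * φ z) :=
      integral_congr_ae (by
        filter_upwards [Lp.coeFn_add w₁.2 w₂.2] with z hz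
        simp only [Prod.snd_add, hz, Pi.add_apply, PiLp.add_apply, add_mul])
    rw [e₁, e₂, integral_add (P.integrable_mul_gradSmooth _ hφ hφc i)
      (P.integrable_mul_gradSmooth _ hφ hφc i), integral_add (P.integrable_comp_mul _ hφ hφc i)
      (P.integrable_comp_mul _ hφ hφc i), h₁ φ hφ hφc i, h₂ φ hφ hφc i, neg_add]
  smul_mem' := by
    intro c w h φ hφ hφc i
    have e₁ : ∫ z, (c • w).1 z * P.gradSmooth φ z i =
        ∫ z, c * (w.1 z * P.gradSmooth φ z i) :=
      integral_congr_ae (by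
        filter_upwards [Lp.coeFn_smul c w.1] with z hz
        simp only [Prod.smul_fst, hz, Pi.smul_apply, smul_eq_mul, mul_assoc])
    have e₂ : ∫ z, (c • w).2 z i * φ z = ∫ z, c * (w.2 z i * φ z) :=
      integral_congr_ae (by
        filter_upwards [Lp.coeFn_smul c w.2] with z hz
        simp only [Prod.smul_snd, hz, Pi.smul_apply, PiLp.smul_apply, smul_eq_mul, mul_assoc])
    rw [e₁, e₂, integral_const_mul, integral_const_mul, h φ hφ hφc i, mul_neg]

/-- The space `D_γ(ℝ^N)` of all `u ∈ L^{2*_γ}(ℝ^N)` whose weak Grushin gradient exists and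
belongs to `L²`. An element is recorded as the pair `(u, ∇_γ u)`; the second component is
determined by the first. It is not normed as a subspace of the product: the norm is `‖·‖_γ`. -/
def D : Type := P.graph

namespace D

variable {P}

instance : AddCommGroup P.D := inferInstanceAs (AddCommGroup P.graph)

instance : Module ℝ P.D := inferInstanceAs (Module ℝ P.graph)

/-- The function underlying an element of `D_γ(ℝ^N)`, as a class in `L^{2*_γ}`. -/
def toLp : P.D →ₗ[ℝ] P.LCrit := (LinearMap.fst ℝ P.LCrit P.LGrad).comp P.graph.subtype

/-- The Grushin gradient `∇_γ u`, as a class in `L²`. -/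
def grad : P.D →ₗ[ℝ] P.LGrad := (LinearMap.snd ℝ P.LCrit P.LGrad).comp P.graph.subtype

lemma isWeakGrad (u : P.D) : P.IsWeakGrad (toLp u) (grad u) := u.2

/-- The pointwise values (a representative) of an element of `D_γ(ℝ^N)`. -/
instance : CoeFun P.D fun _ => P.Pt → ℝ := ⟨fun u => toLp u⟩

lemma grad_injective : Function.Injective (grad (P := P)) := by
  rw [← LinearMap.ker_eq_bot, LinearMap.ker_eq_bot']
  intro u hu
  have h0 : toLp u = 0 := by
    rw [Lp.eq_zero_iff_ae_eq_zero]
    have i₀ : Fin P.m := ⟨0, P.one_le_m⟩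
    have : (volume : Measure P.Pt).IsAddHaarMeasure := by
      rw [Measure.volume_eq_prod]; infer_instance
    refine ae_eq_zero_of_weak_dirDeriv (by linarith [P.two_lt_critExp]) (Lp.memLp (toLp u))
      (e := ((EuclideanSpace.single i₀ (1 : ℝ), 0) : P.Pt)) ?_ fun φ hφ hφc => ?_
    · intro h
      have := congrArg (fun z : P.Pt => z.1 i₀) h
      simp at this
    · have h1 := isWeakGrad u φ hφ hφc (Sum.inl i₀)
      rw [hu] at h1
      have h2 : ∫ z, (0 : P.LGrad) z (Sum.inl i₀) * φ z = 0 :=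
        integral_eq_zero_of_ae (by
          filter_upwards [Lp.coeFn_zero P.Vec 2 (volume : Measure P.Pt)] with z hz
          rw [hz]; simp)
      rw [h2, neg_zero] at h1
      exact h1
  exact Subtype.ext (Prod.ext h0 hu)

/-- `‖u‖_γ = ‖∇_γ u‖_{L²}`. -/
instance : NormedAddCommGroup P.D := NormedAddCommGroup.induced P.D P.LGrad grad grad_injective

/-- `⟨u, w⟩_γ = ∫ ∇_γ u · ∇_γ w`. -/
instance : InnerProductSpace ℝ P.D := InnerProductSpace.induced grad

lemma inner_def (u w : P.D) : inner ℝ u w = ∫ z, inner ℝ (grad u z) (grad w z) := rfl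

lemma norm_def (u : P.D) : ‖u‖ = ‖grad u‖ := rfl

lemma norm_eq_sqrt (u : P.D) : ‖u‖ = √(∫ z, ‖grad u z‖ ^ 2) := by
  rw [norm_def, norm_eq_sqrt_real_inner, L2.inner_def]
  simp only [real_inner_self_eq_norm_sq]

end D

end Params

/-- Hypotheses on the nonlinearity `f : [0, ∞) → ℝ` (values at negative arguments are never
used): continuity, `f(0) = 0`, the growth conditions with exponent `α`, and the
Ambrosetti–Rabinowitz condition for `F(t) = ∫₀ᵗ f`. -/
structure Admissible (P : Params) (f : ℝ → ℝ) : Prop where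
  continuousOn : ContinuousOn f (Ici 0)
  zero : f 0 = 0
  limit_zero : Tendsto (fun t => f t / t) (𝓝[>] 0) (𝓝 0)
  limit_infty : ∃ α : ℝ, 2 < α ∧ α < P.critExp ∧
    ∃ L : ℝ, Tendsto (fun t => f t / t ^ (α - 1)) atTop (𝓝 L)
  ambrosetti_rabinowitz : ∃ θ : ℝ, 2 < θ ∧ ∃ t₀ : ℝ, 0 < t₀ ∧ ∀ t, t₀ < t →
    0 < θ * (∫ s in (0 : ℝ)..t, f s) ∧ θ * (∫ s in (0 : ℝ)..t, f s) ≤ t * f t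

/-- The truncated nonlinearity `f_a`. -/
def fa (f : ℝ → ℝ) (a t : ℝ) : ℝ :=
  if 0 ≤ t then f t - a else if -1 < t then -a * (t + 1) else 0

/-- The primitive `F_a` of `f_a`. -/
def Fa (f : ℝ → ℝ) (a t : ℝ) : ℝ :=
  if 0 ≤ t then (∫ s in (0 : ℝ)..t, f s) - a * t
  else if -1 < t then -(a * t ^ 2) / 2 - a * t else a / 2

/-- The energy `I_a(u) = ½ ‖u‖_γ² - ∫ g F_a(u)`. -/
def energy (P : Params) (f : ℝ → ℝ) (g : P.Pt → ℝ) (a : ℝ) (u : P.D) : ℝ :=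
  1 / 2 * ‖u‖ ^ 2 - ∫ z, g z * Fa f a (u z)

/-- `u` is a weak solution of `-Δ_γ u = g f_a(u)` in `ℝ^N`. -/
def IsWeakSolution (P : Params) (f : ℝ → ℝ) (g : P.Pt → ℝ) (a : ℝ) (u : P.D) : Prop :=
  ∀ φ : P.D, Integrable (fun z => g z * fa f a (u z) * φ z) ∧
    ∫ z, inner ℝ (Params.D.grad u z) (Params.D.grad φ z) = ∫ z, g z * fa f a (u z) * φ z

/-- The mountain pass geometry, uniformly in `a ∈ (0, a₁)`: `I_a ≥ δ > 0` on the sphere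
`‖u‖_γ = ρ`, and `I_a(v) < 0` at a point `v` outside that sphere. -/
structure MountainPassGeometry (P : Params) (f : ℝ → ℝ) (g : P.Pt → ℝ)
    (ρ δ a₁ : ℝ) (v : P.D) : Prop where
  ρ_pos : 0 < ρ
  δ_pos : 0 < δ
  a₁_pos : 0 < a₁
  sphere : ∀ a ∈ Ioo 0 a₁, ∀ u : P.D, ‖u‖ = ρ → δ ≤ energy P f g a u
  far : ρ < ‖v‖
  neg : ∀ a ∈ Ioo 0 a₁, energy P f g a v < 0

/-- `c` is the mountain pass level `inf_p max_{t ∈ [0,1]} I(p(t))`, `p` ranging over the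
continuous paths from `0` to `v`. -/
def IsMountainPassLevel {X : Type*} [NormedAddCommGroup X] (I : X → ℝ) (v : X) (c : ℝ) : Prop :=
  IsGLB {M | ∃ p : Path (0 : X) v, IsGreatest (range fun t => I (p t)) M} c

end Grushin

end

namespace Grushin

/-! ### Ekeland's principle and the mountain pass theorem -/

/-! The weight enters only through the finite measure `ν = g dz`, which is dominated by a multiple
of Lebesgue measure. Suppose `J` is a compact embedding of `D_γ` into `L^α(ν)`. The growth of `f_a`
makes `u ↦ ∫ F_a(J u) dν` continuously differentiable, with gradient `Γ (J u)` for a continuous `Γ`,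
so the gradient of the energy is `u - Γ (J u)`. The Ambrosetti–Rabinowitz inequality bounds
Palais–Smale sequences. Along a subsequence `J u_n` converges, hence so does `u_n = (u_n - Γ (J
u_n)) + Γ (J u_n)`. The mountain pass theorem, obtained by applying Ekeland's principle to the space
of paths, then gives a critical point at the minimax level
(`exists_critical_of_ambrosetti_rabinowitz`). The same inequality bounds the norm of that point by
the level, and the level is at most the maximum of the energy on the segment from `0` to `v`. Both
estimates are uniform for `a < a₁`, which gives the common constant.

The analytic work is the compact embedding, which is built from the following ingredients.

The Sobolev inequality comes from an `L¹` version, `lintegral_rpow_le_of_lines`. Integrating along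
coordinate lines gives the Gagliardo–Nirenberg product bound, in which each `y`-line carries the
weight `|x|^γ`. Where this weight is too small to help, the function is bounded by a power of `|x|`,
and a one-dimensional integral suffices. Applying the `L¹` inequality to a power of `|φ|` gives the
`L²` inequality (`exists_eLpNorm_le_gradSmooth`).

Since `D_γ` is defined through weak derivatives, the inequality has to be carried over from test
functions. Cutoffs follow the Grushin dilations. Mollifiers are much thinner in `x` than in `y`, so
that the commutator with `|x|^γ` is small. The outcome, `exists_smooth_approx`, is almost everywhere
convergence with bounded gradients, which Fatou's lemma turns into estimates on `D_γ`. In particular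
`D_γ` is complete.

For compactness, the translation modulus of `u` in `L¹` of a ball is controlled by `‖u‖_γ`: directly
in `x`, and in `y` away from a thin strip around `{x = 0}` whose small volume is handled by the
Sobolev bound. Hence weakly null sequences tend to zero in `L¹` of balls; the finiteness of `ν`
gives `L¹(ν)`, and interpolation gives `L^α(ν)` for `α < 2*_γ`. -/

/-- A weak form of **Ekeland's variational principle**. -/
theorem exists_ekeland {X : Type*} [MetricSpace X] [CompleteSpace X] {Φ : X → ℝ}
    (hΦ : LowerSemicontinuous Φ) (hb : BddBelow (range Φ)) {ε : ℝ} (hε : 0 < ε) (x₀ : X) :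
    ∃ x, Φ x ≤ Φ x₀ ∧ ∀ y, Φ x ≤ Φ y + ε * dist y x := by
  -- Membership in `S x` is a partial order on points; a minimal element for it is exactly a point
  -- with the required property.
  set S : X → Set X := fun x => {y | Φ y + ε * dist y x ≤ Φ x} with hS
  have hself : ∀ x, x ∈ S x := fun x => by simp [hS]
  have htrans : ∀ x y z, y ∈ S x → z ∈ S y → z ∈ S x := by
    intro x y z hy hz
    simp only [hS, mem_ofPred_eq] at *
    nlinarith [dist_triangle z y x]
  have hclosed : ∀ x, IsClosed (S x) := fun x =>
    (hΦ.add (continuous_const.mul (continuous_id.dist continuous_const)).lowerSemicontinuous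
      ).isClosed_preimage (Φ x)
  have hbS : ∀ x, BddBelow (Φ '' S x) := fun x => hb.mono (image_subset_range _ _)
  have hne : ∀ x, (Φ '' S x).Nonempty := fun x => ⟨_, mem_image_of_mem _ (hself x)⟩
  -- Nearly minimising `Φ` on `S x` leaves little room for further descent, so the sets `S (x n)`
  -- shrink to a point.
  have step : ∀ (n : ℕ) (x : X), ∃ y ∈ S x, Φ y < sInf (Φ '' S x) + (1 / 2) ^ n := by
    intro n x
    obtain ⟨_, ⟨y, hy, rfl⟩, h⟩ := exists_lt_of_csInf_lt (hne x)
      (lt_add_of_pos_right (sInf (Φ '' S x)) (by positivity : (0 : ℝ) < (1 / 2) ^ n))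
    exact ⟨y, hy, h⟩
  choose nxt hnxt hlt using step
  set x : ℕ → X := fun n => Nat.rec x₀ (fun n x => nxt n x) n with hx
  have hx1 : ∀ n, x (n + 1) ∈ S (x n) := fun n => hnxt n (x n)
  have hx2 : ∀ n, Φ (x (n + 1)) < sInf (Φ '' S (x n)) + (1 / 2) ^ n := fun n => hlt n (x n)
  have hmem : ∀ n k, x (n + k) ∈ S (x n) := by
    intro n k
    induction k with
    | zero => exact hself _
    | succ k ih => exact htrans _ _ _ ih (hx1 (n + k))
  -- points of `S (x (n+1))` are close to `x (n+1)`
  have hdist : ∀ n, ∀ y ∈ S (x (n + 1)), Φ (x (n + 1)) < Φ y + (1 / 2) ^ n ∧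
      dist y (x (n + 1)) ≤ (1 / 2) ^ n / ε := by
    intro n y hy
    have h1 : sInf (Φ '' S (x n)) ≤ Φ y :=
      csInf_le (hbS _) ⟨y, htrans _ _ _ (hx1 n) hy, rfl⟩
    have h2 := hx2 n
    refine ⟨by linarith, ?_⟩
    have h3 : Φ y + ε * dist y (x (n + 1)) ≤ Φ (x (n + 1)) := hy
    rw [le_div_iff₀ hε]
    linarith
  have hlim0 : Tendsto (fun n : ℕ => (1 / 2 : ℝ) ^ n / ε) atTop (𝓝 0) := by
    simpa using (tendsto_pow_atTop_nhds_zero_of_lt_one (r := (1 / 2 : ℝ)) (by norm_num)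
      (by norm_num)).div_const ε
  have hcauchy : CauchySeq fun n => x (n + 1) := by
    refine cauchySeq_of_le_tendsto_0' (fun n => (1 / 2 : ℝ) ^ n / ε) (fun n m hnm => ?_) hlim0
    obtain ⟨k, rfl⟩ := Nat.exists_eq_add_of_le hnm
    rw [dist_comm]
    have := hmem (n + 1) k
    rw [show n + 1 + k = n + k + 1 by ring] at this
    exact (hdist n _ this).2
  obtain ⟨z, hz⟩ := cauchySeq_tendsto_of_complete hcauchy
  have hzS : ∀ n, z ∈ S (x n) := by
    intro n
    refine (hclosed (x n)).mem_of_tendsto hz (eventually_atTop.2 ⟨n, fun m hm => ?_⟩)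
    obtain ⟨k, rfl⟩ := Nat.exists_eq_add_of_le hm
    exact hmem n (k + 1)
  refine ⟨z, ?_, fun y => ?_⟩
  · have h := hzS 0
    simp only [hS, mem_ofPred_eq] at h
    have : x 0 = x₀ := rfl
    rw [this] at h
    have := mul_nonneg hε.le (dist_nonneg (x := z) (y := x₀))
    linarith
  -- A point violating the inequality at `z` lies in every `S (x (n + 1))`, so it is also the limit
  -- of the sequence and equals `z`.
  · by_contra! hy
    have hyS : y ∈ S z := hy.le
    have h1 : Tendsto (fun n => x (n + 1)) atTop (𝓝 y) := by
      rw [tendsto_iff_dist_tendsto_zero]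
      refine squeeze_zero (fun _ => dist_nonneg) (fun n => ?_) hlim0
      rw [dist_comm]
      exact (hdist n y (htrans _ _ _ (hzS (n + 1)) hyS)).2
    have h2 : y = z := tendsto_nhds_unique h1 hz
    subst h2
    simp at hy

variable {X : Type*} [NormedAddCommGroup X] [InnerProductSpace ℝ X]

/-- A `C¹` functional decreases along a direction at the rate given by its gradient, uniformly
near a compact set. -/
lemma exists_uniform_expansion {I : X → ℝ} {G : X → X}
    (hI : ∀ u, HasFDerivAt I (innerSL ℝ (G u)) u) (hG : Continuous G) {K : Set X}
    (hK : IsCompact K) {η : ℝ} (hη : 0 < η) :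
    ∃ h₀ > 0, ∀ x ∈ K, ∀ y, dist y x ≤ h₀ →
      I y ≤ I x + inner ℝ (G x) (y - x) + η * ‖y - x‖ := by
  -- Only one of the two points has to lie in the compact set `K`, so the modulus also covers points
  -- near `K`. The mean value inequality on a ball then gives the expansion.
  have h1 := hK.uniformContinuousAt_of_continuousAt G (fun _ _ => hG.continuousAt)
    (Metric.dist_mem_uniformity hη)
  obtain ⟨d, hd, h2⟩ := Metric.mem_uniformity_dist.1 h1
  refine ⟨d / 2, half_pos hd, fun x hx y hy => ?_⟩
  have h3 := (convex_ball x d).norm_image_sub_le_of_norm_hasFDerivWithin_le'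
    (f := I) (f' := fun u => innerSL ℝ (G u)) (φ := innerSL ℝ (G x)) (C := η)
    (fun u _ => (hI u).hasFDerivWithinAt) (fun u hu => ?_) (Metric.mem_ball_self hd)
    (Metric.mem_ball.2 (lt_of_le_of_lt hy (half_lt_self hd)))
  · have h4 := le_of_abs_le h3
    simp only [innerSL_apply_apply] at h4
    linarith
  · rw [← map_sub, innerSL_apply_norm, ← dist_eq_norm, dist_comm]
    have := h2 (a := x) (b := u) (by rw [dist_comm]; exact hu) hx
    exact le_of_lt this

/-- Almost critical points near the mountain pass level. -/
theorem exists_almost_critical [CompleteSpace X] {I : X → ℝ} {G : X → X}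
    (hI : ∀ u, HasFDerivAt I (innerSL ℝ (G u)) u) (hG : Continuous G) {v : X} {c : ℝ}
    (hc : IsMountainPassLevel I v c) (h0 : I 0 < c) (hv : I v < c) {ε : ℝ} (hε : 0 < ε) :
    ∃ u, |I u - c| ≤ ε ∧ ‖G u‖ ≤ ε := by
  have hIc : Continuous I := continuous_iff_continuousAt.2 fun u => (hI u).continuousAt
  -- Both endpoints lie below `c - e`, so a deformation supported above that level keeps them fixed.
  obtain ⟨e, he, hε2, he0, hev⟩ : ∃ e > 0, 2 * e ≤ ε ∧ I 0 ≤ c - e ∧ I v ≤ c - e :=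
    ⟨min (ε / 2) (min (c - I 0) (c - I v)), by
      have := sub_pos.2 h0; have := sub_pos.2 hv; positivity,
      by linarith [min_le_left (ε / 2) (min (c - I 0) (c - I v))],
      by linarith [min_le_right (ε / 2) (min (c - I 0) (c - I v)),
        min_le_left (c - I 0) (c - I v)],
      by linarith [min_le_right (ε / 2) (min (c - I 0) (c - I v)),
        min_le_right (c - I 0) (c - I v)]⟩
  set Γ : Set C(unitInterval, X) := {p | p 0 = 0 ∧ p 1 = v} with hΓ
  have hΓc : IsClosed Γ := by
    refine IsClosed.inter ?_ ?_
    · exact isClosed_singleton.preimage (continuous_eval_const (0 : unitInterval))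
    · exact isClosed_singleton.preimage (continuous_eval_const (1 : unitInterval))
  have : CompleteSpace Γ := hΓc.completeSpace_coe
  have hcomp : ∀ p : C(unitInterval, X), BddAbove (range fun t => I (p t)) := fun p =>
    (isCompact_range (hIc.comp p.continuous)).bddAbove
  set Θ : Γ → ℝ := fun p => ⨆ t, I (p.1 t) with hΘ
  have hle : ∀ (p : Γ) t, I (p.1 t) ≤ Θ p := fun p t => le_ciSup (hcomp p.1) t
  have hpath : ∀ p : Γ, c ≤ Θ p := by
    intro p
    refine hc.1 ⟨⟨p.1, p.2.1, p.2.2⟩, ?_⟩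
    have := (isCompact_range (hIc.comp p.1.continuous)).sSup_mem (range_nonempty _)
    exact ⟨this, fun y hy => le_csSup (hcomp p.1) hy⟩
  have hlsc : LowerSemicontinuous Θ := lowerSemicontinuous_ciSup (fun p => hcomp p.1) fun t =>
    (hIc.comp ((continuous_eval_const t).comp
      continuous_subtype_val)).lowerSemicontinuous
  obtain ⟨M, ⟨p₀, hp₀⟩, -, hM⟩ := hc.exists_between (show c < c + e by linarith)
  set q₀ : Γ := ⟨⟨p₀, p₀.continuous⟩, p₀.source, p₀.target⟩ with hq₀
  have hq₀M : Θ q₀ ≤ M := ciSup_le fun t => hp₀.2 ⟨t, rfl⟩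
  -- The path `p` is almost optimal for the minimax, and moving it by a distance `d` lowers its
  -- maximum by at most `e * d`. The deformation below lowers it faster.
  obtain ⟨p, hp1, hp2⟩ := exists_ekeland hlsc ⟨c, by rintro _ ⟨p, rfl⟩; exact hpath p⟩ he q₀
  by_contra! hcon
  -- The maximum of `I` along `p` is below `c + e`, so all points of `p` above `c - e` are in the
  -- range of the contradiction hypothesis.
  have hbig : ∀ t, c - e ≤ I (p.1 t) → 2 * e < ‖G (p.1 t)‖ := by
    intro t ht
    refine lt_of_le_of_lt hε2 (hcon _ (abs_le.2 ⟨by linarith, ?_⟩))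
    have := hle p t
    linarith
  -- A cutoff in the level: `0` below `c - e`, `1` above `c - e / 2`, linear in between.
  set ψ : ℝ → ℝ := fun s => max 0 (min 1 ((s - (c - e)) * (2 / e))) with hψ
  have hψc : Continuous ψ := by fun_prop
  -- The field is the unit gradient at high levels. The `max` with `e` keeps the denominator away
  -- from zero at low levels, where `G` may vanish, so `w` is continuous.
  set w : unitInterval → X := fun t =>
    (ψ (I (p.1 t)) / max (‖G (p.1 t)‖) e) • G (p.1 t) with hw
  have hmaxpos : ∀ t, 0 < max (‖G (p.1 t)‖) e := fun t => lt_max_of_lt_right he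
  have hwc : Continuous w := by
    have hGp : Continuous fun t => G (p.1 t) := hG.comp p.1.continuous
    exact ((hψc.comp (hIc.comp p.1.continuous)).div (hGp.norm.max continuous_const)
      fun t => (hmaxpos t).ne').smul hGp
  have hψ01 : ∀ s, 0 ≤ ψ s ∧ ψ s ≤ 1 := fun s =>
    ⟨le_max_left _ _, max_le zero_le_one (min_le_left _ _)⟩
  have hψ0 : ∀ s, s ≤ c - e → ψ s = 0 := by
    intro s hs
    refine max_eq_left ((min_le_right _ _).trans ?_)
    exact mul_nonpos_of_nonpos_of_nonneg (by linarith) (by positivity)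
  have hψ1 : ∀ s, c - e / 2 ≤ s → ψ s = 1 := by
    intro s hs
    have : 1 ≤ (s - (c - e)) * (2 / e) := by
      rw [mul_div_assoc', le_div_iff₀ he]
      linarith
    simp [hψ, min_eq_left this]
  have hw1 : ∀ t, ‖w t‖ ≤ 1 := by
    intro t
    rw [hw]
    simp only [norm_smul, norm_div, Real.norm_eq_abs, abs_of_nonneg (hψ01 _).1,
      abs_of_pos (hmaxpos t)]
    rw [div_mul_eq_mul_div, div_le_one (hmaxpos t)]
    exact (mul_le_of_le_one_left (norm_nonneg _) (hψ01 _).2).trans (le_max_left _ _)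
  have hinner : ∀ t, 0 ≤ inner ℝ (G (p.1 t)) (w t) := by
    intro t
    rw [hw]
    simp only [inner_smul_right, real_inner_self_eq_norm_sq]
    have := (hψ01 (I (p.1 t))).1
    have := (hmaxpos t).le
    positivity
  have hinner2 : ∀ t, c - e / 2 ≤ I (p.1 t) → 2 * e ≤ inner ℝ (G (p.1 t)) (w t) := by
    intro t ht
    have hb := hbig t (by linarith)
    rw [hw]
    simp only [inner_smul_right, real_inner_self_eq_norm_sq, hψ1 _ ht]
    rw [max_eq_left (by linarith)]
    have : ‖G (p.1 t)‖ ≠ 0 := by linarith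
    field_simp
    exact hb.le
  obtain ⟨h₀, hh₀, hexp⟩ := exists_uniform_expansion hI hG
    (isCompact_range p.1.continuous) (half_pos he)
  -- With `h ≤ 1 / 4`, points starting below `c - e / 2` end below `c - e / 2 + e * h / 2 ≤ c - 3 /
  -- 2 * e * h`.
  obtain ⟨h, hh, hhh₀, hh4⟩ : ∃ h > 0, h ≤ h₀ ∧ h ≤ 1 / 4 :=
    ⟨min h₀ (1 / 4), by positivity, min_le_left _ _, min_le_right _ _⟩
  have hend : ∀ t, I (p.1 t) ≤ c - e → w t = 0 := by
    intro t ht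
    simp [hw, hψ0 _ ht]
  set q : Γ := ⟨p.1 - h • (⟨w, hwc⟩ : C(unitInterval, X)), by
    have h3 : w 0 = 0 := hend 0 (by rw [p.2.1]; exact he0)
    have h4 : w 1 = 0 := hend 1 (by rw [p.2.2]; exact hev)
    constructor
    · simp [p.2.1, h3]
    · simp [p.2.2, h4]⟩ with hq
  have hqt : ∀ t, q.1 t - p.1 t = -(h • w t) := by
    intro t
    simp [hq]
  have hnorm : ∀ t, ‖q.1 t - p.1 t‖ ≤ h := by
    intro t
    rw [hqt, norm_neg, norm_smul, Real.norm_of_nonneg hh.le]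
    exact mul_le_of_le_one_right hh.le (hw1 t)
  have hdist : dist q p ≤ h := by
    rw [Subtype.dist_eq, ContinuousMap.dist_le hh.le]
    intro t
    rw [dist_eq_norm]
    exact hnorm t
  -- At high levels the gradient yields a gain of `2 * e * h` and the expansion error costs `e / 2 *
  -- h`. The net rate `3 / 2 * e` exceeds the rate `e` that Ekeland's principle allows.
  have hΘq : Θ q ≤ Θ p - 3 / 2 * e * h := by
    refine ciSup_le fun t => ?_
    have h5 := hexp (p.1 t) ⟨t, rfl⟩ (q.1 t) (by rw [dist_eq_norm]; exact (hnorm t).trans hhh₀)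
    have h6 : e / 2 * ‖q.1 t - p.1 t‖ ≤ e / 2 * h :=
      mul_le_mul_of_nonneg_left (hnorm t) (by positivity)
    rw [show inner ℝ (G (p.1 t)) (q.1 t - p.1 t) = -(h * inner ℝ (G (p.1 t)) (w t)) by
      rw [hqt, inner_neg_right, inner_smul_right]] at h5
    rcases le_or_gt (c - e / 2) (I (p.1 t)) with ht | ht
    · have := mul_le_mul_of_nonneg_left (hinner2 t ht) hh.le
      have := hle p t
      nlinarith
    · have := mul_nonneg hh.le (hinner t)
      have := hpath p
      nlinarith
  have := hp2 q
  nlinarith [mul_le_mul_of_nonneg_left hdist he.le, mul_pos he hh]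

/-- The **mountain pass theorem** of Ambrosetti and Rabinowitz on a Hilbert space. -/
theorem exists_critical_of_isMountainPassLevel [CompleteSpace X] {I : X → ℝ} {G : X → X}
    (hI : ∀ u, HasFDerivAt I (innerSL ℝ (G u)) u) (hG : Continuous G) {v : X} {c : ℝ}
    (hc : IsMountainPassLevel I v c) (h0 : I 0 < c) (hv : I v < c)
    (hPS : ∀ u : ℕ → X, Tendsto (fun n => I (u n)) atTop (𝓝 c) →
      Tendsto (fun n => G (u n)) atTop (𝓝 0) →
      ∃ (x : X) (s : ℕ → ℕ), StrictMono s ∧ Tendsto (u ∘ s) atTop (𝓝 x)) :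
    ∃ u, G u = 0 ∧ I u = c := by
  have hIc : Continuous I := continuous_iff_continuousAt.2 fun u => (hI u).continuousAt
  have hex : ∀ n : ℕ, ∃ u, |I u - c| ≤ 1 / ((n : ℝ) + 1) ∧ ‖G u‖ ≤ 1 / ((n : ℝ) + 1) :=
    fun n => exists_almost_critical hI hG hc h0 hv (by positivity)
  choose u hu1 hu2 using hex
  have h1 : Tendsto (fun n => I (u n)) atTop (𝓝 c) := by
    rw [tendsto_iff_dist_tendsto_zero]
    exact squeeze_zero (fun _ => dist_nonneg) hu1 tendsto_one_div_add_atTop_nhds_zero_nat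
  have h2 : Tendsto (fun n => G (u n)) atTop (𝓝 0) :=
    squeeze_zero_norm hu2 tendsto_one_div_add_atTop_nhds_zero_nat
  obtain ⟨x, s, hs, hx⟩ := hPS u h1 h2
  exact ⟨x, tendsto_nhds_unique ((hG.tendsto x).comp hx) (h2.comp hs.tendsto_atTop),
    tendsto_nhds_unique ((hIc.tendsto x).comp hx) (h1.comp hs.tendsto_atTop)⟩

/-- Existence of the mountain pass level above a sphere on which the functional is large. -/
theorem exists_isMountainPassLevel {I : X → ℝ} (hI : Continuous I) {v : X} {ρ δ : ℝ}
    (hρ : 0 ≤ ρ) (hv : ρ ≤ ‖v‖) (hδ : ∀ u, ‖u‖ = ρ → δ ≤ I u) :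
    ∃ c, IsMountainPassLevel I v c ∧ δ ≤ c ∧
      ∀ M, (∀ t : unitInterval, I ((t : ℝ) • v) ≤ M) → c ≤ M := by
  set S := {M | ∃ p : Path (0 : X) v, IsGreatest (range fun t => I (p t)) M} with hS
  have hgr : ∀ p : Path (0 : X) v, ∃ M, IsGreatest (range fun t => I (p t)) M := fun p =>
    (isCompact_range (hI.comp p.continuous)).exists_isGreatest (range_nonempty _)
  have hlow : ∀ M ∈ S, δ ≤ M := by
    rintro M ⟨p, hp⟩
    obtain ⟨t, ht⟩ : ∃ t, ‖p t‖ = ρ := by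
      have hc : Continuous fun t => ‖p t‖ := p.continuous.norm
      exact mem_range_of_exists_le_of_exists_ge hc ⟨0, by simpa using hρ⟩ ⟨1, by simpa using hv⟩
    exact (hδ _ ht).trans (hp.2 ⟨t, rfl⟩)
  -- The segment shows that the set of path maxima is nonempty and also supplies the upper bound for
  -- the level.
  let p₁ : Path (0 : X) v := ⟨⟨fun t => (t : ℝ) • v, by fun_prop⟩, by simp, by simp⟩
  obtain ⟨M₁, hM₁⟩ := hgr p₁
  have hb : BddBelow S := ⟨δ, hlow⟩
  refine ⟨sInf S, isGLB_csInf ⟨M₁, p₁, hM₁⟩ hb, le_csInf ⟨M₁, p₁, hM₁⟩ hlow, fun M hM => ?_⟩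
  refine (csInf_le hb ⟨p₁, hM₁⟩).trans ?_
  obtain ⟨t, ht⟩ := hM₁.1
  rw [← ht]
  exact hM t

end Grushin

namespace Grushin

/-! ### The Grushin isoperimetric-type inequality in `L¹` -/

lemma lintegral_Ioi_rpow_neg {Q r : ℝ} (hQ : 2 ≤ Q) (hr : 0 < r) :
    ∫⁻ t in Ioi r, ENNReal.ofReal |t| ^ (-Q) ≤ ENNReal.ofReal (r ^ (1 - Q)) := by
  have h1 : IntegrableOn (fun t : ℝ => t ^ (-Q)) (Ioi r) :=
    integrableOn_Ioi_rpow_of_lt (by linarith) hr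
  have h2 : ∫⁻ t in Ioi r, ENNReal.ofReal |t| ^ (-Q) =
      ∫⁻ t in Ioi r, ENNReal.ofReal (t ^ (-Q)) := by
    refine setLIntegral_congr_fun measurableSet_Ioi fun t ht => ?_
    have : 0 < t := hr.trans ht
    rw [abs_of_pos this, ENNReal.ofReal_rpow_of_pos this]
  rw [h2, ← ofReal_integral_eq_lintegral_ofReal h1, integral_Ioi_rpow_of_lt (by linarith) hr]
  · refine ENNReal.ofReal_le_ofReal ?_
    rw [neg_add_eq_sub, ← neg_sub Q 1, neg_div_neg_eq]
    exact div_le_self (by positivity) (by linarith)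
  · filter_upwards [ae_restrict_mem measurableSet_Ioi] with t ht
    exact Real.rpow_nonneg (hr.trans ht).le _

/-- The two competitors agree at `|t| = r = H^(-1/(Q-1))`. The interval `[-r, r]` contributes `2 *
H` and each tail at most `H`. The linear dependence on `H` is what allows the result to be
integrated again in the remaining variables. -/
lemma lintegral_min_rpow_le {Q : ℝ} (hQ : 2 ≤ Q) (H : ℝ≥0∞) :
    ∫⁻ t : ℝ, min (H ^ (Q / (Q - 1))) (ENNReal.ofReal |t| ^ (-Q)) ≤ 4 * H := by
  have hQ1 : 0 < Q - 1 := by linarith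
  have hq : 0 < Q / (Q - 1) := by apply div_pos <;> linarith
  rcases eq_or_ne H 0 with rfl | h0
  · simp [ENNReal.zero_rpow_of_pos hq]
  rcases eq_or_ne H ⊤ with rfl | htop
  · simp
  obtain ⟨x, hx, rfl⟩ : ∃ x : ℝ, 0 < x ∧ H = ENNReal.ofReal x :=
    ⟨H.toReal, ENNReal.toReal_pos h0 htop, (ENNReal.ofReal_toReal htop).symm⟩
  set r : ℝ := x ^ (-(1 / (Q - 1))) with hr
  have hr0 : 0 < r := Real.rpow_pos_of_pos hx _
  have e1 : r ^ (1 - Q) = x := by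
    rw [hr, ← Real.rpow_mul hx.le]
    rw [show -(1 / (Q - 1)) * (1 - Q) = 1 by field_simp; ring, Real.rpow_one]
  have e2 : x ^ (Q / (Q - 1)) * (2 * r) = 2 * x := by
    rw [hr, mul_left_comm, ← Real.rpow_add hx]
    rw [show Q / (Q - 1) + -(1 / (Q - 1)) = 1 by field_simp; ring, Real.rpow_one]
  set F : ℝ → ℝ≥0∞ := fun t =>
    min (ENNReal.ofReal x ^ (Q / (Q - 1))) (ENNReal.ofReal |t| ^ (-Q)) with hF
  have hcov : (univ : Set ℝ) = Icc (-r) r ∪ (Ioi r ∪ Iio (-r)) := by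
    ext t
    simp only [mem_univ, mem_union, mem_Icc, mem_Ioi, mem_Iio, true_iff]
    rcases le_or_gt t r with h | h
    · rcases le_or_gt (-r) t with h' | h'
      · exact Or.inl ⟨h', h⟩
      · exact Or.inr (Or.inr h')
    · exact Or.inr (Or.inl h)
  have hA : ∫⁻ t in Icc (-r) r, F t ≤ ENNReal.ofReal (2 * x) := by
    calc ∫⁻ t in Icc (-r) r, F t ≤ ∫⁻ _ in Icc (-r) r, ENNReal.ofReal x ^ (Q / (Q - 1)) :=
          lintegral_mono fun t => min_le_left _ _
      _ = ENNReal.ofReal (2 * x) := by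
          rw [setLIntegral_const, Real.volume_Icc, ENNReal.ofReal_rpow_of_pos hx,
            ← ENNReal.ofReal_mul (by positivity), ← e2]
          congr 2
          ring
  have hB : ∫⁻ t in Ioi r, F t ≤ ENNReal.ofReal x := by
    refine (lintegral_mono fun t => min_le_right _ _).trans ?_
    exact (lintegral_Ioi_rpow_neg hQ hr0).trans (by rw [e1])
  have hC : ∫⁻ t in Iio (-r), F t = ∫⁻ t in Ioi r, F t := by
    have := (Measure.measurePreserving_neg (volume : Measure ℝ)).setLIntegral_comp_preimage_emb
      (MeasurableEquiv.neg ℝ).measurableEmbedding F (Ioi r)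
    rw [← this]
    have hs : Neg.neg ⁻¹' Ioi r = Iio (-r) := by ext t; simp [lt_neg]
    rw [hs]
    simp [hF]
  calc ∫⁻ t, F t = ∫⁻ t in Icc (-r) r ∪ (Ioi r ∪ Iio (-r)), F t := by
        rw [← hcov, Measure.restrict_univ]
    _ ≤ ENNReal.ofReal (2 * x) + (ENNReal.ofReal x + ENNReal.ofReal x) := by
        refine (lintegral_union_le _ _ _).trans (add_le_add hA ?_)
        exact (lintegral_union_le _ _ _).trans (add_le_add hB (hC.trans_le hB))
    _ = 4 * ENNReal.ofReal x := by
        rw [← ENNReal.ofReal_add hx.le hx.le, ← ENNReal.ofReal_add (by positivity) (by positivity),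
          ← ENNReal.ofReal_ofNat 4, ← ENNReal.ofReal_mul (by norm_num)]
        congr 1
        ring

section Grid

variable {κ τ : Type*} [Fintype κ] [Fintype τ]

/-- Each `y`-direction brings one factor `R ^ γ`, so the Gagliardo–Nirenberg product controls a
power of `U` with total weight `R ^ (γ * card τ * s)`. -/
lemma rpow_mul_rpow_le_prod {s : ℝ} (hs : 0 ≤ s) (γ : ℝ) {U R : ℝ≥0∞}
    {J : κ ⊕ τ → ℝ≥0∞} (h1 : ∀ i, U ≤ J (.inl i)) (h2 : ∀ j, R ^ γ * U ≤ J (.inr j)) :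
    U ^ ((Fintype.card κ + Fintype.card τ) * s) * R ^ (γ * Fintype.card τ * s) ≤
      ∏ i, J i ^ s := by
  rw [Fintype.prod_sum_type]
  calc U ^ ((Fintype.card κ + Fintype.card τ) * s) * R ^ (γ * Fintype.card τ * s)
      = (∏ _i : κ, U ^ s) * ∏ _j : τ, (R ^ γ * U) ^ s := by
        simp only [Finset.prod_const, Finset.card_univ]
        rw [ENNReal.mul_rpow_of_nonneg _ _ hs, mul_pow, ← ENNReal.rpow_natCast,
          ← ENNReal.rpow_natCast, ← ENNReal.rpow_natCast, ← ENNReal.rpow_mul, ← ENNReal.rpow_mul,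
          ← ENNReal.rpow_mul, ← ENNReal.rpow_mul, add_mul,
          ENNReal.rpow_add_of_nonneg _ _ (by positivity) (by positivity)]
        rw [mul_comm (Fintype.card κ : ℝ) s, mul_comm (Fintype.card τ : ℝ) s,
          show γ * Fintype.card τ * s = γ * (s * Fintype.card τ) by ring, ENNReal.rpow_mul,
          mul_assoc, mul_comm (U ^ (s * (Fintype.card τ : ℝ)))]
    _ ≤ _ := by
        gcongr with i _ j _
        · exact h1 i
        · exact h2 j

/-- An `L¹` Gagliardo–Nirenberg inequality for the Grushin geometry, in terms of integrals
along the coordinate lines. -/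
theorem lintegral_rpow_le_of_lines [DecidableEq κ] [DecidableEq τ] {γ Q : ℝ} (hγ : 0 ≤ γ)
    (hQ : Q = Fintype.card κ + (1 + γ) * Fintype.card τ)
    (hN : 2 ≤ Fintype.card κ + Fintype.card τ) (i₀ : κ) {U G : (κ ⊕ τ → ℝ) → ℝ≥0∞}
    {R : (κ ⊕ τ → ℝ) → ℝ≥0∞} (hR : ∀ z, ENNReal.ofReal |z (.inl i₀)| ≤ R z)
    (hRtop : ∀ z, R z ≠ ⊤) (hG : Measurable G)
    (h1 : ∀ z i, U z ≤ ∫⁻ t, G (Function.update z (.inl i) t))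
    (h2 : ∀ z j, R z ^ γ * U z ≤ ∫⁻ t, G (Function.update z (.inr j) t))
    (hG1 : ∫⁻ z, G z ≤ 1) :
    ∫⁻ z, U z ^ (Q / (Q - 1)) ≤ 5 := by
  have hN' : (2 : ℝ) ≤ Fintype.card κ + Fintype.card τ := by exact_mod_cast hN
  have hγτ : 0 ≤ γ * Fintype.card τ := by positivity
  set N : ℝ := Fintype.card κ + Fintype.card τ with hNdef
  have hQN : Q = N + γ * Fintype.card τ := by rw [hQ, hNdef]; ring
  have hQ2 : 2 ≤ Q := by linarith
  have hQ1 : 0 < Q - 1 := by linarith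
  have hN1 : 0 < N - 1 := by linarith
  have hq : 0 < Q / (Q - 1) := by apply div_pos <;> linarith
  have hcard : (Fintype.card (κ ⊕ τ) : ℝ) = N := by simp [hNdef]
  set J : (κ ⊕ τ → ℝ) → κ ⊕ τ → ℝ≥0∞ := fun z i => ∫⁻ t, G (Function.update z i t) with hJ
  set A : (κ ⊕ τ → ℝ) → ℝ≥0∞ := fun z =>
    min (J z (.inl i₀) ^ (Q / (Q - 1))) (ENNReal.ofReal |z (.inl i₀)| ^ (-Q)) with hA
  set B : (κ ⊕ τ → ℝ) → ℝ≥0∞ := fun z =>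
    ∏ i, J z i ^ ((1 : ℝ) / (Fintype.card (κ ⊕ τ) - 1 : ℝ)) with hB
  have hJm : ∀ i, Measurable fun z => J z i := by
    intro i
    have := hG.lmarginal (s := {i}) (fun _ : κ ⊕ τ => (volume : Measure ℝ))
    simpa only [lmarginal_singleton] using this
  have hAm : Measurable A :=
    ((hJm _).pow_const _).min
      ((ENNReal.measurable_ofReal.comp (measurable_pi_apply _).abs).pow_const _)
  have hBm : Measurable B := Finset.measurable_fun_prod _ fun i _ => (hJm i).pow_const _
  have hpt : ∀ z, U z ^ (Q / (Q - 1)) ≤ A z + B z := by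
    intro z
    have hUJ : U z ^ (Q / (Q - 1)) ≤ J z (.inl i₀) ^ (Q / (Q - 1)) :=
      ENNReal.rpow_le_rpow (h1 z i₀) hq.le
    -- The threshold is the pointwise size that the homogeneous dimension predicts for unit mass;
    -- this is why `∫ G ≤ 1` is assumed. Below it, `U ^ (Q / (Q - 1))` is at most `R ^ (-Q)`.
    rcases le_or_gt (U z) (R z ^ (-(Q - 1))) with hU | hU
    · refine le_add_right (le_min hUJ ?_)
      calc U z ^ (Q / (Q - 1)) ≤ (R z ^ (-(Q - 1))) ^ (Q / (Q - 1)) :=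
            ENNReal.rpow_le_rpow hU hq.le
        _ = R z ^ (-Q) := by
            rw [← ENNReal.rpow_mul]
            congr 1
            field_simp
        _ ≤ ENNReal.ofReal |z (.inl i₀)| ^ (-Q) := by
            rw [ENNReal.rpow_neg, ENNReal.rpow_neg]
            exact ENNReal.inv_le_inv.2 (ENNReal.rpow_le_rpow (hR z) (by linarith))
    · refine le_add_left ?_
      have hR0 : R z ≠ 0 := by
        intro h
        rw [h, ENNReal.zero_rpow_of_neg (by linarith)] at hU
        exact not_top_lt hU
      set s : ℝ := 1 / (N - 1) with hs
      set β : ℝ := γ * Fintype.card τ * s with hβ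
      have hs0 : 0 ≤ s := by positivity
      have hβ0 : 0 ≤ β := by positivity
      -- Above the threshold a factor at least one can be inserted. It supplies the weight `R ^ β`
      -- of the line product and raises the exponent `Q / (Q - 1)` to the Euclidean `N / (N - 1)`.
      have hone : 1 ≤ U z ^ (β / (Q - 1)) * R z ^ β := by
        have h3 : R z ^ (-β) ≤ U z ^ (β / (Q - 1)) := by
          calc R z ^ (-β) = (R z ^ (-(Q - 1))) ^ (β / (Q - 1)) := by
                rw [← ENNReal.rpow_mul]
                congr 1
                field_simp
            _ ≤ _ := ENNReal.rpow_le_rpow hU.le (by positivity)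
        calc (1 : ℝ≥0∞) = R z ^ (-β) * R z ^ β := by
              rw [← ENNReal.rpow_add _ _ hR0 (hRtop z), neg_add_cancel, ENNReal.rpow_zero]
          _ ≤ _ := by gcongr
      have hexp : Q / (Q - 1) + β / (Q - 1) = N * s := by
        rw [hβ, hs, hQN]
        have : N + γ * Fintype.card τ - 1 ≠ 0 := by linarith
        field_simp
        ring
      calc U z ^ (Q / (Q - 1)) ≤ U z ^ (Q / (Q - 1)) * (U z ^ (β / (Q - 1)) * R z ^ β) :=
            le_mul_of_one_le_right zero_le hone
        _ = U z ^ (N * s) * R z ^ β := by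
            rw [← mul_assoc, ← ENNReal.rpow_add_of_nonneg _ _ hq.le (by positivity), hexp]
        _ ≤ ∏ i, J z i ^ s := rpow_mul_rpow_le_prod hs0 γ (h1 z) (h2 z)
        _ = B z := by simp only [hB, hcard, hs]
  -- This is the Euclidean Gagliardo–Nirenberg estimate for products of line integrals.
  have hBint : ∫⁻ z, B z ≤ 1 := by
    have hconj : Real.HolderConjugate (Fintype.card (κ ⊕ τ)) (N / (N - 1)) := by
      rw [hcard]
      exact Real.HolderConjugate.conjExponent (by linarith)
    refine (lintegral_prod_lintegral_pow_le (fun _ => volume) hconj hG).trans ?_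
    exact ENNReal.rpow_le_one hG1 (by apply div_nonneg <;> linarith)
  -- The line integral `J z (.inl i₀)` does not depend on the coordinate `i₀`, so integrating in
  -- that coordinate first is `lintegral_min_rpow_le` with `H` constant.
  have hAint : ∫⁻ z, A z ≤ 4 * ∫⁻ z, G z := by
    rw [← lintegral_const_mul _ hG]
    refine lintegral_le_of_lmarginal_le (μ := fun _ : κ ⊕ τ => (volume : Measure ℝ))
      {Sum.inl i₀} hAm (hG.const_mul 4) fun z => ?_
    rw [lmarginal_singleton, lmarginal_singleton]
    beta_reduce
    rw [lintegral_const_mul _ (by fun_prop)]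
    simp only [hA, hJ, Function.update_idem, Function.update_self]
    exact lintegral_min_rpow_le hQ2 _
  calc ∫⁻ z, U z ^ (Q / (Q - 1)) ≤ ∫⁻ z, (A z + B z) := lintegral_mono hpt
    _ = (∫⁻ z, A z) + ∫⁻ z, B z := lintegral_add_left hAm _
    _ ≤ 4 * 1 + 1 := add_le_add (hAint.trans (mul_le_mul_right hG1 4)) hBint
    _ = 5 := by norm_num

end Grid

end Grushin

namespace Grushin

namespace Params

variable (P : Params)

/-! ### The Sobolev inequality for test functions -/

/-- The identification of `ℝ^m × ℝ^ℓ` with a product of lines. -/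
def ofCoords : (Fin P.m ⊕ Fin P.l → ℝ) →L[ℝ] P.Pt :=
  ((PiLp.continuousLinearEquiv 2 ℝ (fun _ : Fin P.m => ℝ)).symm.toContinuousLinearMap.comp
    (ContinuousLinearMap.pi fun i => ContinuousLinearMap.proj (Sum.inl i))).prod
  ((PiLp.continuousLinearEquiv 2 ℝ (fun _ : Fin P.l => ℝ)).symm.toContinuousLinearMap.comp
    (ContinuousLinearMap.pi fun j => ContinuousLinearMap.proj (Sum.inr j)))

lemma ofCoords_apply (w : Fin P.m ⊕ Fin P.l → ℝ) :
    P.ofCoords w = (WithLp.toLp 2 fun i => w (.inl i), WithLp.toLp 2 fun j => w (.inr j)) := rfl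

lemma measurePreserving_ofCoords : MeasurePreserving P.ofCoords := by
  have h1 := volume_measurePreserving_sumPiEquivProdPi (fun _ : Fin P.m ⊕ Fin P.l => ℝ)
  have h2 := (PiLp.volume_preserving_toLp (Fin P.m)).prod (PiLp.volume_preserving_toLp (Fin P.l))
  exact h2.comp h1

lemma isClosedEmbedding_ofCoords : IsClosedEmbedding P.ofCoords := by
  refine (LinearMap.isClosedEmbedding_of_injective (f := P.ofCoords.toLinearMap) ?_)
  rw [LinearMap.ker_eq_bot]
  intro a b hab
  have h : P.ofCoords a = P.ofCoords b := hab
  rw [ofCoords_apply, ofCoords_apply, Prod.mk.injEq] at h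
  ext (i | j)
  · exact congrArg (fun x : EuclideanSpace ℝ (Fin P.m) => x i) h.1
  · exact congrArg (fun x : EuclideanSpace ℝ (Fin P.l) => x j) h.2

lemma ofCoords_single_inl (i : Fin P.m) :
    P.ofCoords (Pi.single (Sum.inl i) 1) = (EuclideanSpace.single i 1, 0) := by
  rw [ofCoords_apply]
  ext k
  · simp [Pi.single_apply]
  · simp

lemma ofCoords_single_inr (j : Fin P.l) :
    P.ofCoords (Pi.single (Sum.inr j) 1) = (0, EuclideanSpace.single j 1) := by
  rw [ofCoords_apply]
  ext k
  · simp
  · simp [Pi.single_apply]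

lemma gradSmooth_inl (φ : P.Pt → ℝ) (z : P.Pt) (i : Fin P.m) :
    P.gradSmooth φ z (.inl i) = fderiv ℝ φ z (EuclideanSpace.single i 1, 0) := rfl

lemma gradSmooth_inr (φ : P.Pt → ℝ) (z : P.Pt) (j : Fin P.l) :
    P.gradSmooth φ z (.inr j) = ‖z.1‖ ^ P.γ * fderiv ℝ φ z (0, EuclideanSpace.single j 1) := rfl

lemma continuous_gradSmooth {φ : P.Pt → ℝ} (hφ : ContDiff ℝ 1 φ) :
    Continuous (P.gradSmooth φ) := by
  have h := hφ.continuous_fderiv (by simp)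
  refine (PiLp.continuous_toLp 2 _).comp (continuous_pi fun i => ?_)
  rcases i with i | j
  · exact h.clm_apply continuous_const
  · exact (continuous_fst.norm.rpow_const fun _ => Or.inr P.γ_nonneg).mul
      (h.clm_apply continuous_const)

lemma hasCompactSupport_gradSmooth {φ : P.Pt → ℝ} (hφ : HasCompactSupport φ) :
    HasCompactSupport (P.gradSmooth φ) := by
  refine (hφ.fderiv ℝ).mono fun z hz => ?_
  contrapose! hz
  have hz' : fderiv ℝ φ z = 0 := by simpa using hz
  have : P.gradSmooth φ z = 0 := by
    ext (i | j) <;> simp [gradSmooth, hz']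
  simpa using this

/-- The fundamental theorem of calculus along a coordinate line, started where `ψ` vanishes. -/
lemma enorm_le_lintegral_line {ψ : P.Pt → ℝ} (hψ : ContDiff ℝ 1 ψ) (hψc : HasCompactSupport ψ)
    (w : Fin P.m ⊕ Fin P.l → ℝ) (i : Fin P.m ⊕ Fin P.l) :
    ‖ψ (P.ofCoords w)‖ₑ ≤ ∫⁻ t, ‖fderiv ℝ ψ (P.ofCoords (Function.update w i t))
      (P.ofCoords (Pi.single i 1))‖ₑ := by
  set u : (Fin P.m ⊕ Fin P.l → ℝ) → ℝ := ψ ∘ P.ofCoords with hu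
  have hud : ContDiff ℝ 1 u := hψ.comp P.ofCoords.contDiff
  have huc : HasCompactSupport u := hψc.comp_isClosedEmbedding P.isClosedEmbedding_ofCoords
  calc ‖ψ (P.ofCoords w)‖ₑ
    _ ≤ ∫⁻ t in Iic (w i), ‖deriv (u ∘ Function.update w i) t‖ₑ := by
        apply le_trans (by simp [hu]) (HasCompactSupport.enorm_le_lintegral_Ici_deriv _ _ _)
        · exact hud.comp (by convert! contDiff_update 1 w i)
        · exact huc.comp_isClosedEmbedding (isClosedEmbedding_update w i)
    _ ≤ ∫⁻ t, ‖deriv (u ∘ Function.update w i) t‖ₑ := setLIntegral_le_lintegral _ _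
    _ = _ := by
        refine lintegral_congr fun t => ?_
        have h1 := (hasDerivAt_update w i t)
        have h2 := (hψ.differentiable one_ne_zero
          (P.ofCoords (Function.update w i t))).hasFDerivAt
        have h3 := P.ofCoords.hasFDerivAt.comp_hasDerivAt t h1
        have h4 := HasFDerivAt.comp_hasDerivAt (f := P.ofCoords ∘ Function.update w i) t h2 h3
        rw [show u ∘ Function.update w i = ψ ∘ (P.ofCoords ∘ Function.update w i) from rfl,
          h4.deriv]

/-- The `L¹` Grushin–Sobolev inequality for test functions. -/
lemma lintegral_rpow_le_gradSmooth {ψ : P.Pt → ℝ} (hψ : ContDiff ℝ 1 ψ)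
    (hψc : HasCompactSupport ψ) :
    ∫⁻ z, ‖ψ z‖ₑ ^ (P.homDim / (P.homDim - 1)) ≤
      5 * (∫⁻ z, ‖P.gradSmooth ψ z‖ₑ) ^ (P.homDim / (P.homDim - 1)) := by
  set Q := P.homDim with hQ
  have hQ2 : 2 < Q := P.two_lt_homDim
  set q := Q / (Q - 1) with hq
  have hq0 : 0 < q := by apply div_pos <;> linarith
  set S := ∫⁻ z, ‖P.gradSmooth ψ z‖ₑ with hS
  have hcont := P.continuous_gradSmooth hψ
  have hSt : S ≠ ⊤ :=
    (hcont.integrable_of_hasCompactSupport (P.hasCompactSupport_gradSmooth hψc)).2.ne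
  -- the normalised inequality
  have key : ∀ s, S < s → s < ⊤ → ∫⁻ z, ‖ψ z‖ₑ ^ q ≤ 5 * s ^ q := by
    intro s hs hst
    have hs0 : s ≠ 0 := (zero_le.trans_lt hs).ne'
    have hm : Measurable fun w => s⁻¹ * ‖P.gradSmooth ψ (P.ofCoords w)‖ₑ :=
      (hcont.comp P.ofCoords.continuous).enorm.measurable.const_mul _
    have hline : ∀ w i, s⁻¹ * ‖ψ (P.ofCoords w)‖ₑ ≤ ∫⁻ t, s⁻¹ * ‖fderiv ℝ ψ
        (P.ofCoords (Function.update w i t)) (P.ofCoords (Pi.single i 1))‖ₑ := by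
      intro w i
      rw [lintegral_const_mul' _ _ (ENNReal.inv_ne_top.2 hs0)]
      gcongr
      exact P.enorm_le_lintegral_line hψ hψc w i
    have h := lintegral_rpow_le_of_lines (κ := Fin P.m) (τ := Fin P.l) P.γ_nonneg (Q := Q)
      (by simp [hQ, homDim]) (by have := P.three_le; simp; omega) ⟨0, P.one_le_m⟩
      (U := fun w => s⁻¹ * ‖ψ (P.ofCoords w)‖ₑ)
      (G := fun w => s⁻¹ * ‖P.gradSmooth ψ (P.ofCoords w)‖ₑ)
      (R := fun w => ‖(P.ofCoords w).1‖ₑ) (fun w => ?_) (fun w => enorm_ne_top) hm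
      (fun w i => ?_) (fun w j => ?_) ?_
    · have e1 : ∫⁻ w, (s⁻¹ * ‖ψ (P.ofCoords w)‖ₑ) ^ q = s⁻¹ ^ q * ∫⁻ z, ‖ψ z‖ₑ ^ q := by
        simp_rw [ENNReal.mul_rpow_of_nonneg _ _ hq0.le]
        rw [lintegral_const_mul' _ _ (ENNReal.rpow_ne_top_of_nonneg hq0.le
          (ENNReal.inv_ne_top.2 hs0))]
        rw [← P.measurePreserving_ofCoords.lintegral_comp
          (hψ.continuous.enorm.measurable.pow_const q)]
      rw [e1, ENNReal.inv_rpow] at h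
      have h0 : s ^ q ≠ 0 := by simp [hs0, hst.ne]
      have ht : s ^ q ≠ ⊤ := ENNReal.rpow_ne_top_of_nonneg hq0.le hst.ne
      calc ∫⁻ z, ‖ψ z‖ₑ ^ q = s ^ q * ((s ^ q)⁻¹ * ∫⁻ z, ‖ψ z‖ₑ ^ q) := by
            rw [← mul_assoc, ENNReal.mul_inv_cancel h0 ht, one_mul]
        _ ≤ s ^ q * 5 := by gcongr
        _ = _ := mul_comm _ _
    · rw [← Real.norm_eq_abs, ofReal_norm]
      exact enorm_le_iff_norm_le.2 (PiLp.norm_apply_le (P.ofCoords w).1 _)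
    · refine (hline w (.inl i)).trans (lintegral_mono fun t => ?_)
      rw [ofCoords_single_inl]
      gcongr
      exact enorm_le_iff_norm_le.2
        (PiLp.norm_apply_le (P.gradSmooth ψ (P.ofCoords (Function.update w (.inl i) t))) (.inl i))
    · have hfin : ‖(P.ofCoords w).1‖ₑ ^ P.γ ≠ ⊤ :=
        ENNReal.rpow_ne_top_of_nonneg P.γ_nonneg enorm_ne_top
      refine (mul_le_mul_right (hline w (.inr j)) _).trans ?_
      rw [← lintegral_const_mul' _ _ hfin]
      refine lintegral_mono fun t => ?_
      rw [ofCoords_single_inr, mul_left_comm]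
      gcongr
      -- The weight depends on `x` alone, hence is constant along a `y`-line and passes under the
      -- integral.
      have hx : (P.ofCoords (Function.update w (.inr j) t)).1 = (P.ofCoords w).1 := by
        simp [ofCoords_apply]
      refine le_trans (le_of_eq ?_) (enorm_le_iff_norm_le.2
        (PiLp.norm_apply_le (P.gradSmooth ψ (P.ofCoords (Function.update w (.inr j) t))) (.inr j)))
      rw [gradSmooth_inr, enorm_mul, hx, Real.enorm_rpow_of_nonneg (norm_nonneg _) P.γ_nonneg,
        enorm_norm]
    · rw [lintegral_const_mul' _ _ (ENNReal.inv_ne_top.2 hs0)]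
      rw [P.measurePreserving_ofCoords.lintegral_comp
        (f := fun z => ‖P.gradSmooth ψ z‖ₑ) hcont.enorm.measurable]
      rw [ENNReal.inv_mul_le_iff hs0 hst.ne, mul_one]
      exact hs.le
  -- Normalising by every `s > S` and letting `s` decrease to `S` avoids a division by `S`, which
  -- may be zero.
  have hlt : S < ⊤ := lt_top_iff_ne_top.2 hSt
  have : (𝓝[>] S).NeBot := nhdsGT_neBot_of_exists_gt ⟨⊤, hlt⟩
  have htend : Tendsto (fun s : ℝ≥0∞ => 5 * s ^ q) (𝓝[>] S) (𝓝 (5 * S ^ q)) :=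
    ((ENNReal.continuous_const_mul (by norm_num)).comp
      ENNReal.continuous_rpow_const).continuousWithinAt
  refine ge_of_tendsto htend ?_
  filter_upwards [Ioo_mem_nhdsGT hlt] with s hs
  exact key s hs.1 hs.2

/-- The **Grushin–Sobolev inequality** for test functions. -/
theorem exists_eLpNorm_le_gradSmooth : ∃ C : NNReal, ∀ φ : P.Pt → ℝ, ContDiff ℝ 1 φ →
    HasCompactSupport φ →
    eLpNorm φ (ENNReal.ofReal P.critExp) volume ≤ C * eLpNorm (P.gradSmooth φ) 2 volume := by
  set Q := P.homDim with hQ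
  have hQ2 : 2 < Q := P.two_lt_homDim
  set q := Q / (Q - 1) with hq
  have hq0 : 0 < q := by apply div_pos <;> linarith
  -- The exponent is fixed by `s * q = 2 * (s - 1) = 2*_γ`. Thus the left side of the `L¹`
  -- inequality for `|φ| ^ s` and the factor `|φ| ^ (s - 1)` produced by the chain rule lead to the
  -- same integral `X`.
  set s : ℝ := 2 * (Q - 1) / (Q - 2) with hs
  have hs1 : 1 < s := by rw [hs, lt_div_iff₀ (by linarith)]; linarith
  set C : ENNReal := 5 ^ (1 / q) * ENNReal.ofReal s with hC
  have hCt : C ≠ ⊤ := ENNReal.mul_ne_top (ENNReal.rpow_ne_top_of_nonneg (by positivity)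
    (by norm_num)) ENNReal.ofReal_ne_top
  refine ⟨C.toNNReal, fun φ hφ hφc => ?_⟩
  rw [ENNReal.coe_toNNReal hCt]
  have hp2 := P.two_lt_critExp
  set p := P.critExp with hp
  have hpQ : p = 2 * Q / (Q - 2) := rfl
  have hsq : s * q = p := by
    rw [hs, hq, hpQ]
    have : Q - 1 ≠ 0 := by linarith
    field_simp
  have hs1p : (s - 1) * 2 = p := by
    rw [hs, hpQ]
    have : Q - 2 ≠ 0 := by linarith
    field_simp
    ring
  have hexp : (1 - q / 2) * (1 / q) = 1 / p := by
    rw [hq, hpQ]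
    have : Q - 2 ≠ 0 := by linarith
    have : Q - 1 ≠ 0 := by linarith
    have : Q ≠ 0 := by linarith
    field_simp
    ring
  have h1q : 0 ≤ 1 - q / 2 := by
    have : q ≤ 2 := by rw [hq, div_le_iff₀ (by linarith)]; linarith
    linarith
  set X := ∫⁻ z, ‖φ z‖ₑ ^ p with hX
  set B := ∫⁻ z, ‖P.gradSmooth φ z‖ₑ ^ (2 : ℝ) with hB
  have hgoal : X ^ (1 / p) ≤ C * B ^ (1 / (2 : ℝ)) := by
    have hcontφ := hφ.continuous
    have hXt : X ≠ ⊤ := by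
      have := (hcontφ.memLp_of_hasCompactSupport (p := ENNReal.ofReal p) (μ := volume) hφc)
      have h := lintegral_rpow_enorm_lt_top_of_eLpNorm_lt_top (by simp; linarith) (by simp)
        this.eLpNorm_lt_top
      rw [ENNReal.toReal_ofReal (by linarith)] at h
      exact h.ne
    rcases eq_or_ne X 0 with hX0 | hX0
    · rw [hX0, ENNReal.zero_rpow_of_pos (by positivity)]
      exact zero_le
    set ψ : P.Pt → ℝ := fun z => ‖φ z‖ ^ s with hψ
    have hψd : ContDiff ℝ 1 ψ := hφ.norm_rpow hs1
    have hψc : HasCompactSupport ψ := by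
      refine hφc.mono fun z hz => ?_
      contrapose! hz
      have : φ z = 0 := by simpa using hz
      simp [hψ, this, Real.zero_rpow (by linarith : s ≠ 0)]
    have h1 := P.lintegral_rpow_le_gradSmooth hψd hψc
    have hgrad : ∀ z, ‖P.gradSmooth ψ z‖ₑ ≤
        ENNReal.ofReal s * (‖φ z‖ₑ ^ (s - 1) * ‖P.gradSmooth φ z‖ₑ) := by
      intro z
      have e : P.gradSmooth ψ z = (s * ‖φ z‖ ^ (s - 2) * φ z) • P.gradSmooth φ z := by
        have hf := (hφ.differentiable one_ne_zero).fderiv_norm_rpow (x := z) hs1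
        ext (i | j)
        · rw [PiLp.smul_apply, gradSmooth_inl, gradSmooth_inl, hf]
          simp only [smul_apply, ContinuousLinearMap.comp_apply,
            innerSL_apply_apply, smul_eq_mul, RCLike.inner_apply, conj_trivial]
          ring
        · rw [PiLp.smul_apply, gradSmooth_inr, gradSmooth_inr, hf]
          simp only [smul_apply, ContinuousLinearMap.comp_apply,
            innerSL_apply_apply, smul_eq_mul, RCLike.inner_apply, conj_trivial]
          ring
      rw [e, enorm_smul, ← mul_assoc]
      gcongr
      have e3 : ‖s * ‖φ z‖ ^ (s - 2) * φ z‖ = s * ‖φ z‖ ^ (s - 1) := by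
        rw [norm_mul, norm_mul, Real.norm_of_nonneg (by linarith : 0 ≤ s),
          Real.norm_of_nonneg (Real.rpow_nonneg (norm_nonneg _) _), mul_assoc]
        rcases eq_or_ne (φ z) 0 with h0 | h0
        · simp [h0, Real.zero_rpow (by linarith : s - 1 ≠ 0)]
        · rw [← Real.rpow_add_one (norm_ne_zero_iff.2 h0)]
          ring_nf
      rw [← ofReal_norm, e3, ENNReal.ofReal_mul (by linarith),
        ← ENNReal.ofReal_rpow_of_nonneg (norm_nonneg _) (by linarith), ofReal_norm]
    have hHolder : ∫⁻ z, ‖φ z‖ₑ ^ (s - 1) * ‖P.gradSmooth φ z‖ₑ ≤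
        X ^ (1 / (2 : ℝ)) * B ^ (1 / (2 : ℝ)) := by
      have h := ENNReal.lintegral_mul_le_Lp_mul_Lq volume Real.HolderConjugate.two_two
        (f := fun z => ‖φ z‖ₑ ^ (s - 1)) (g := fun z => ‖P.gradSmooth φ z‖ₑ)
        (hcontφ.enorm.measurable.pow_const _).aemeasurable
        (P.continuous_gradSmooth hφ).enorm.measurable.aemeasurable
      simp only [Pi.mul_apply, ← ENNReal.rpow_mul, hs1p] at h
      exact h
    have h2 : X ≤ 5 * (ENNReal.ofReal s * (X ^ (1 / (2 : ℝ)) * B ^ (1 / (2 : ℝ)))) ^ q := by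
      calc X = ∫⁻ z, ‖ψ z‖ₑ ^ q := by
            refine lintegral_congr fun z => ?_
            rw [hψ, Real.enorm_rpow_of_nonneg (norm_nonneg _) (by linarith), enorm_norm,
              ← ENNReal.rpow_mul, hsq]
        _ ≤ _ := h1
        _ ≤ _ := by
            gcongr
            refine (lintegral_mono hgrad).trans ?_
            rw [lintegral_const_mul' _ _ ENNReal.ofReal_ne_top]
            gcongr
    -- The power of `X` on the right is absorbed by division, which is legitimate because `X` is
    -- neither zero nor infinite.
    have h3 : X ^ (1 - q / 2) ≤ 5 * (ENNReal.ofReal s * B ^ (1 / (2 : ℝ))) ^ q := by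
      have e1 : X ^ (1 - q / 2) * X ^ (q / 2) = X := by
        rw [← ENNReal.rpow_add _ _ hX0 hXt, sub_add_cancel, ENNReal.rpow_one]
      have e2 : (ENNReal.ofReal s * (X ^ (1 / (2 : ℝ)) * B ^ (1 / (2 : ℝ)))) ^ q =
          (ENNReal.ofReal s * B ^ (1 / (2 : ℝ))) ^ q * X ^ (q / 2) := by
        rw [mul_left_comm, ENNReal.mul_rpow_of_nonneg _ _ hq0.le, ← ENNReal.rpow_mul, mul_comm]
        congr 2
        ring
      rw [e2, ← mul_assoc] at h2
      replace h2 := e1.trans_le h2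
      have h0 : X ^ (q / 2) ≠ 0 := by simp [hX0, hXt]
      have ht : X ^ (q / 2) ≠ ⊤ := ENNReal.rpow_ne_top_of_nonneg (by positivity) hXt
      exact (ENNReal.mul_le_mul_iff_left h0 ht).1 h2
    calc X ^ (1 / p) = (X ^ (1 - q / 2)) ^ (1 / q) := by rw [← ENNReal.rpow_mul, hexp]
      _ ≤ (5 * (ENNReal.ofReal s * B ^ (1 / (2 : ℝ))) ^ q) ^ (1 / q) := by gcongr
      _ = C * B ^ (1 / (2 : ℝ)) := by
        rw [ENNReal.mul_rpow_of_nonneg _ _ (by positivity), ← ENNReal.rpow_mul,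
          mul_one_div_cancel hq0.ne', ENNReal.rpow_one, hC, mul_assoc]
  rw [eLpNorm_eq_lintegral_rpow_enorm_toReal (by simp; linarith) (by simp),
    eLpNorm_eq_lintegral_rpow_enorm_toReal (by simp) (by simp),
    ENNReal.toReal_ofReal (by linarith), ENNReal.toReal_ofNat]
  exact hgoal

end Params

end Grushin

namespace Grushin

/-! ### Convolution estimates -/

section Convolution

variable {E : Type*} [NormedAddCommGroup E] [NormedSpace ℝ E] [FiniteDimensional ℝ E]
  [MeasurableSpace E] [BorelSpace E] {μ : Measure E} [μ.IsAddHaarMeasure]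

/-- A case of **Young's inequality** for convolutions: `‖f * k‖₂ ≤ ‖k‖₁ ‖f‖₂`. -/
lemma eLpNorm_lintegral_mul_sub_le {f k : E → ℝ≥0∞} (hf : Measurable f) (hk : Measurable k) :
    eLpNorm (fun z => ∫⁻ w, f w * k (z - w) ∂μ) 2 μ ≤ (∫⁻ w, k w ∂μ) * eLpNorm f 2 μ := by
  -- Cauchy–Schwarz with respect to the measure `k (z - w) dw`, by splitting `k` into two square
  -- roots.
  have hcs : ∀ z, (∫⁻ w, f w * k (z - w) ∂μ) ^ (2 : ℝ) ≤
      (∫⁻ w, k w ∂μ) * ∫⁻ w, f w ^ (2 : ℝ) * k (z - w) ∂μ := by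
    intro z
    have hkz : Measurable fun w => k (z - w) := hk.comp (measurable_const.sub measurable_id)
    have h := ENNReal.lintegral_mul_le_Lp_mul_Lq μ Real.HolderConjugate.two_two
      (f := fun w => k (z - w) ^ (1 / 2 : ℝ)) (g := fun w => f w * k (z - w) ^ (1 / 2 : ℝ))
      (hkz.pow_const _).aemeasurable (hf.mul (hkz.pow_const _)).aemeasurable
    have e1 : ∀ w, k (z - w) ^ (1 / 2 : ℝ) * (f w * k (z - w) ^ (1 / 2 : ℝ)) =
        f w * k (z - w) := by
      intro w
      rw [mul_left_comm, ← ENNReal.rpow_add_of_nonneg _ _ (by norm_num) (by norm_num)]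
      norm_num
    have e2 : ∀ w, (k (z - w) ^ (1 / 2 : ℝ)) ^ (2 : ℝ) = k (z - w) := by
      intro w
      rw [← ENNReal.rpow_mul]
      norm_num
    simp only [Pi.mul_apply, e1, e2, ENNReal.mul_rpow_of_nonneg _ _ zero_le_two] at h
    rw [lintegral_sub_left_eq_self (fun w => k w) z] at h
    calc (∫⁻ w, f w * k (z - w) ∂μ) ^ (2 : ℝ) ≤ _ := ENNReal.rpow_le_rpow h zero_le_two
      _ = _ := by
        rw [ENNReal.mul_rpow_of_nonneg _ _ zero_le_two, ← ENNReal.rpow_mul, ← ENNReal.rpow_mul]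
        norm_num
  have htot : ∫⁻ z, ∫⁻ w, f w ^ (2 : ℝ) * k (z - w) ∂μ ∂μ =
      (∫⁻ w, f w ^ (2 : ℝ) ∂μ) * ∫⁻ w, k w ∂μ := by
    rw [lintegral_lintegral_swap]
    · rw [← lintegral_mul_const _ (hf.pow_const _)]
      refine lintegral_congr fun w => ?_
      rw [lintegral_const_mul _ (by fun_prop),
        lintegral_sub_right_eq_self (fun z => k z) w]
    · exact (((hf.pow_const _).comp measurable_snd).mul
        (hk.comp (measurable_fst.sub measurable_snd))).aemeasurable
  rw [eLpNorm_eq_lintegral_rpow_enorm_toReal (by simp) (by simp),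
    eLpNorm_eq_lintegral_rpow_enorm_toReal (by simp) (by simp), ENNReal.toReal_ofNat]
  simp only [enorm_eq_self]
  calc (∫⁻ z, (∫⁻ w, f w * k (z - w) ∂μ) ^ (2 : ℝ) ∂μ) ^ (1 / (2 : ℝ))
      ≤ ((∫⁻ w, k w ∂μ) * ((∫⁻ w, f w ^ (2 : ℝ) ∂μ) * ∫⁻ w, k w ∂μ)) ^ (1 / (2 : ℝ)) := by
        gcongr
        rw [← htot, ← lintegral_const_mul]
        · exact lintegral_mono hcs
        · exact Measurable.lintegral_prod_right' (((hf.pow_const _).comp measurable_snd).mul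
            (hk.comp (measurable_fst.sub measurable_snd)))
    _ = ((∫⁻ w, k w ∂μ) ^ (2 : ℝ)) ^ (1 / (2 : ℝ)) *
          (∫⁻ w, f w ^ (2 : ℝ) ∂μ) ^ (1 / (2 : ℝ)) := by
        rw [← ENNReal.mul_rpow_of_nonneg _ _ (by norm_num), ENNReal.rpow_two]
        congr 1
        ring
    _ = _ := by
        rw [← ENNReal.rpow_mul]
        norm_num

/-- The derivative of a mollification. -/
lemma fderiv_mollify {u κ : E → ℝ} (hu : LocallyIntegrable u μ) (hκ : ContDiff ℝ ∞ κ)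
    (hκc : HasCompactSupport κ) (z e : E) :
    fderiv ℝ (fun z => ∫ w, u w * κ (z - w) ∂μ) z e = ∫ w, u w * fderiv ℝ κ (z - w) e ∂μ := by
  have h1 := hκc.hasFDerivAt_convolution_right (ContinuousLinearMap.mul ℝ ℝ) hu
    (hκ.of_le (by exact_mod_cast le_top)) z
  have hint : Integrable (fun w => ((ContinuousLinearMap.mul ℝ ℝ).precompR E (u w))
      (fderiv ℝ κ (z - w))) μ :=
    (hκc.fderiv ℝ).convolutionExists_right _ hu (hκ.continuous_fderiv (by simp)) z
  have h2 : (fun z => ∫ w, u w * κ (z - w) ∂μ) =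
      convolution u κ (ContinuousLinearMap.mul ℝ ℝ) μ := by
    ext z
    simp [convolution_def]
  rw [h2, h1.fderiv, convolution_def, ContinuousLinearMap.integral_apply hint]
  simp [ContinuousLinearMap.precompR_apply]

lemma contDiff_mollify {F : Type*} [NormedAddCommGroup F] [NormedSpace ℝ F] [MeasurableSpace F]
    [BorelSpace F] {ν : Measure F} {u κ : F → ℝ} (hu : LocallyIntegrable u ν)
    (hκ : ContDiff ℝ ∞ κ) (hκc : HasCompactSupport κ) :
    ContDiff ℝ ∞ fun z => ∫ w, u w * κ (z - w) ∂ν := by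
  have := hκc.contDiff_convolution_right (n := ⊤) (ContinuousLinearMap.mul ℝ ℝ) hu hκ
  convert! this using 2

lemma hasCompactSupport_mollify {u κ : E → ℝ} (hu : HasCompactSupport u)
    (hκc : HasCompactSupport κ) : HasCompactSupport fun z => ∫ w, u w * κ (z - w) ∂μ := by
  have := hκc.convolution (μ := μ) (ContinuousLinearMap.mul ℝ ℝ) hu
  rw [← convolution_flip] at this
  convert! this using 2
  simp [convolution_def]

/-- Continuity of translations in `L¹`. -/
lemma exists_eLpNorm_translate_le {u : E → ℝ} (hu : MemLp u 1 μ) {η : ℝ≥0∞} (hη : 0 < η) :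
    ∃ r > 0, ∀ h : E, ‖h‖ ≤ r → eLpNorm (fun z => u (z - h) - u z) 1 μ ≤ η := by
  set U : Lp ℝ 1 μ := hu.toLp u with hU
  let T : E → C(E, E) := fun h => ⟨fun z => z - h, by fun_prop⟩
  have hT : Continuous T := ContinuousMap.continuous_of_continuous_uncurry _ (by
    change Continuous fun p : E × E => p.2 - p.1
    fun_prop)
  have hmp : ∀ h : E, MeasurePreserving (T h) μ μ := fun h => measurePreserving_sub_right μ h
  have htend : Tendsto (fun h : E => Lp.compMeasurePreserving (T h) (hmp h) U) (𝓝 0)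
      (𝓝 (Lp.compMeasurePreserving (T 0) (hmp 0) U)) :=
    tendsto_const_nhds.compMeasurePreservingLp (hT.tendsto 0) hmp (hmp 0) (by simp)
  have h0 : Lp.compMeasurePreserving (T 0) (hmp 0) U = U := by
    refine Lp.ext ?_
    filter_upwards [Lp.coeFn_compMeasurePreserving U (hmp 0)] with z hz
    rw [hz]
    simp [T]
  rw [h0, tendsto_iff_edist_tendsto_0, ENNReal.tendsto_nhds_zero] at htend
  obtain ⟨r, hr, hball⟩ := Metric.eventually_nhds_iff_ball.1 (htend η hη)
  refine ⟨r / 2, half_pos hr, fun h hh => ?_⟩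
  have h1 := hball h (by simp; linarith)
  rw [Lp.edist_def] at h1
  refine le_trans (le_of_eq (eLpNorm_congr_ae ?_)) h1
  have e1 := hu.coeFn_toLp
  have e2 := (hmp h).quasiMeasurePreserving.ae_eq_comp e1
  filter_upwards [Lp.coeFn_compMeasurePreserving U (hmp h), e1, e2] with z hz hz1 hz2
  rw [Pi.sub_apply, hz, hU, hz1, hz2]
  rfl

/-- Mollification with a kernel of small support is close to the identity in `L¹`. -/
lemma eLpNorm_mollify_sub_le {u κ : E → ℝ} (hu : MemLp u 1 μ) (hum : Measurable u)
    (hκ : Continuous κ) (hκ0 : ∀ z, 0 ≤ κ z) (hκ1 : ∫ z, κ z ∂μ = 1) {r : ℝ}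
    (hκr : ∀ z, κ z ≠ 0 → ‖z‖ ≤ r) {η : ℝ≥0∞}
    (hη : ∀ h : E, ‖h‖ ≤ r → eLpNorm (fun z => u (z - h) - u z) 1 μ ≤ η) :
    eLpNorm (fun z => (∫ w, u w * κ (z - w) ∂μ) - u z) 1 μ ≤ η := by
  have hκc : HasCompactSupport κ :=
    HasCompactSupport.intro (isCompact_closedBall (0 : E) r) fun z hz => by
      by_contra h
      exact hz (by simpa using hκr z h)
  have hκint : Integrable κ μ := hκ.integrable_of_hasCompactSupport hκc
  have hl1 : ∫⁻ h, ‖κ h‖ₑ ∂μ = 1 := by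
    rw [← ENNReal.ofReal_one, ← hκ1, ofReal_integral_eq_lintegral_ofReal hκint (ae_of_all _ hκ0)]
    exact lintegral_congr fun z => Real.enorm_of_nonneg (hκ0 z)
  have hloc : LocallyIntegrable u μ := hu.locallyIntegrable le_rfl
  have hpt : ∀ z, ‖(∫ w, u w * κ (z - w) ∂μ) - u z‖ₑ ≤ ∫⁻ h, ‖u (z - h) - u z‖ₑ * ‖κ h‖ₑ ∂μ := by
    intro z
    have e1 : ∫ w, u w * κ (z - w) ∂μ = ∫ h, u (z - h) * κ h ∂μ := by
      rw [← integral_sub_left_eq_self (fun w => u w * κ (z - w)) μ z]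
      simp
    have hi1 : Integrable (fun h => u (z - h) * κ h) μ := by
      have := hκc.convolutionExists_right (μ := μ) (ContinuousLinearMap.mul ℝ ℝ) hloc hκ z
      have := this.integrable.comp_sub_left z
      simpa using this
    have e2 : (∫ w, u w * κ (z - w) ∂μ) - u z = ∫ h, (u (z - h) - u z) * κ h ∂μ := by
      rw [e1]
      simp only [sub_mul]
      rw [integral_sub hi1 (hκint.const_mul _), integral_const_mul, hκ1, mul_one]
    rw [e2]
    refine (enorm_integral_le_lintegral_enorm _).trans (le_of_eq ?_)
    simp only [enorm_mul]
  rw [eLpNorm_one_eq_lintegral_enorm]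
  calc ∫⁻ z, ‖(∫ w, u w * κ (z - w) ∂μ) - u z‖ₑ ∂μ
      ≤ ∫⁻ z, ∫⁻ h, ‖u (z - h) - u z‖ₑ * ‖κ h‖ₑ ∂μ ∂μ := lintegral_mono hpt
    _ = ∫⁻ h, ∫⁻ z, ‖u (z - h) - u z‖ₑ * ‖κ h‖ₑ ∂μ ∂μ := by
        rw [lintegral_lintegral_swap]
        refine Measurable.aemeasurable ?_
        exact (((hum.comp (measurable_fst.sub measurable_snd)).sub
          (hum.comp measurable_fst)).enorm).mul ((hκ.measurable.comp measurable_snd).enorm)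
    _ ≤ ∫⁻ h, η * ‖κ h‖ₑ ∂μ := by
        refine lintegral_mono fun h => ?_
        rw [lintegral_mul_const' _ _ enorm_ne_top]
        rcases eq_or_ne (κ h) 0 with h0 | h0
        · simp [h0]
        · gcongr
          rw [← eLpNorm_one_eq_lintegral_enorm]
          exact hη h (hκr h h0)
    _ = η := by rw [lintegral_const_mul _ hκ.enorm.measurable, hl1, mul_one]

end Convolution

end Grushin

namespace Grushin

/-! ### Mollification of functions with a weak Grushin gradient -/

lemma enorm_le_sum_enorm {ι : Type*} [Fintype ι] (x : EuclideanSpace ℝ ι) :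
    ‖x‖ₑ ≤ ∑ i, ‖x i‖ₑ := by
  classical
  have h : x = ∑ i, x i • EuclideanSpace.single i (1 : ℝ) := by
    ext k
    simp [Pi.single_apply]
  calc ‖x‖ₑ = ‖∑ i, x i • EuclideanSpace.single i (1 : ℝ)‖ₑ := by rw [← h]
    _ ≤ ∑ i, ‖x i • EuclideanSpace.single i (1 : ℝ)‖ₑ := enorm_sum_le _ _
    _ = ∑ i, ‖x i‖ₑ := by
        refine Finset.sum_congr rfl fun i _ => ?_
        rw [enorm_smul, ← ofReal_norm (EuclideanSpace.single i (1 : ℝ))]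
        simp

namespace Params

variable (P : Params)

instance isAddHaarMeasure_volume : (volume : Measure P.Pt).IsAddHaarMeasure := by
  rw [Measure.volume_eq_prod]; infer_instance

/-- Anisotropic mollifiers: the support in `x` can be shrunk without changing the `L¹` norm of the
`y`-derivatives. -/
lemma exists_mollifier {ε : ℝ} (hε : 0 < ε) : ∃ A : NNReal, ∀ δ : ℝ, 0 < δ → ∃ κ : P.Pt → ℝ,
    ContDiff ℝ ∞ κ ∧ HasCompactSupport κ ∧ (∀ z, 0 ≤ κ z) ∧ ∫ z, κ z = 1 ∧
    (∀ z, κ z ≠ 0 → ‖z.1‖ ≤ δ ∧ ‖z.2‖ ≤ ε) ∧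
    ∀ j, ∫⁻ z, ‖fderiv ℝ κ z (0, EuclideanSpace.single j 1)‖ₑ ≤ A := by
  let b : ContDiffBump (0 : EuclideanSpace ℝ (Fin P.l)) := ⟨ε / 2, ε, by positivity, by linarith⟩
  set η := b.normed volume with hη
  have hηd : ContDiff ℝ ∞ η := b.contDiff_normed
  have hηc : HasCompactSupport η := b.hasCompactSupport_normed
  have hfin : ∀ j, ∫⁻ y, ‖fderiv ℝ η y (EuclideanSpace.single j 1)‖ₑ ≠ ⊤ := by
    intro j
    have hc : Continuous fun y => fderiv ℝ η y (EuclideanSpace.single j 1) :=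
      (hηd.continuous_fderiv (by simp)).clm_apply continuous_const
    exact (hc.integrable_of_hasCompactSupport ((hηc.fderiv ℝ).mono fun y hy => by
      contrapose! hy
      simp at hy
      simp [hy])).2.ne
  -- The constant sees only the `y`-factor `η`; the `x`-factor `ζ` has mass one whatever `δ` is.
  refine ⟨∑ j, (∫⁻ y, ‖fderiv ℝ η y (EuclideanSpace.single j 1)‖ₑ).toNNReal, fun δ hδ => ?_⟩
  let a : ContDiffBump (0 : EuclideanSpace ℝ (Fin P.m)) := ⟨δ / 2, δ, by positivity, by linarith⟩
  set ζ := a.normed volume with hζ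
  have hζd : ContDiff ℝ ∞ ζ := a.contDiff_normed
  have hζc : HasCompactSupport ζ := a.hasCompactSupport_normed
  have hsupp : ∀ z : P.Pt, ζ z.1 * η z.2 ≠ 0 → ‖z.1‖ ≤ δ ∧ ‖z.2‖ ≤ ε := by
    intro z hz
    have h1 : z.1 ∈ Function.support ζ := left_ne_zero_of_mul hz
    have h2 : z.2 ∈ Function.support η := right_ne_zero_of_mul hz
    rw [hζ, a.support_normed_eq] at h1
    rw [hη, b.support_normed_eq] at h2
    exact ⟨by simpa using (mem_ball_zero_iff.1 h1).le, by simpa using (mem_ball_zero_iff.1 h2).le⟩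
  refine ⟨fun z => ζ z.1 * η z.2, (hζd.comp contDiff_fst).mul (hηd.comp contDiff_snd), ?_,
    fun z => mul_nonneg (a.nonneg_normed _) (b.nonneg_normed _), ?_, hsupp, fun j => ?_⟩
  · refine HasCompactSupport.intro (K := Metric.closedBall 0 δ ×ˢ Metric.closedBall 0 ε)
      ((isCompact_closedBall _ _).prod (isCompact_closedBall _ _)) fun z hz => ?_
    by_contra h
    exact hz ⟨by simpa using (hsupp z h).1, by simpa using (hsupp z h).2⟩
  · rw [Measure.volume_eq_prod, integral_prod_mul, a.integral_normed, b.integral_normed, one_mul]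
  · have e : ∀ z : P.Pt, fderiv ℝ (fun z : P.Pt => ζ z.1 * η z.2) z
        (0, EuclideanSpace.single j 1) = ζ z.1 * fderiv ℝ η z.2 (EuclideanSpace.single j 1) := by
      intro z
      have h1 := ((hζd.differentiable (by simp)) z.1).hasFDerivAt.comp z hasFDerivAt_fst
      have h2 := ((hηd.differentiable (by simp)) z.2).hasFDerivAt.comp z hasFDerivAt_snd
      have h3 : HasFDerivAt (fun z : P.Pt => ζ z.1 * η z.2) _ z := h1.mul h2
      rw [h3.fderiv]
      simp
    simp only [e, enorm_mul]
    rw [Measure.volume_eq_prod, lintegral_prod_mul (f := fun x => ‖ζ x‖ₑ)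
      (g := fun y => ‖fderiv ℝ η y (EuclideanSpace.single j 1)‖ₑ)]
    · have h1 : ∫⁻ x, ‖ζ x‖ₑ = 1 := by
        rw [← ENNReal.ofReal_one, ← a.integral_normed (μ := volume),
          ofReal_integral_eq_lintegral_ofReal
            (hζd.continuous.integrable_of_hasCompactSupport hζc)
            (ae_of_all _ a.nonneg_normed)]
        exact lintegral_congr fun z => Real.enorm_of_nonneg (a.nonneg_normed z)
      rw [h1, one_mul, ← ENNReal.coe_toNNReal (hfin j)]
      exact_mod_cast Finset.single_le_sum (f := fun j =>
        (∫⁻ y, ‖fderiv ℝ η y (EuclideanSpace.single j 1)‖ₑ).toNNReal)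
        (fun _ _ => zero_le) (Finset.mem_univ j)
    · exact hζd.continuous.enorm.aemeasurable
    · exact ((hηd.continuous_fderiv (by simp)).clm_apply
        continuous_const).enorm.aemeasurable

variable {P}

lemma fderiv_comp_const_sub {κ : P.Pt → ℝ} (hκ : ContDiff ℝ ∞ κ) (z w e : P.Pt) :
    fderiv ℝ (fun w => κ (z - w)) w e = - fderiv ℝ κ (z - w) e := by
  have h1 := (hκ.differentiable (by simp) (z - w)).hasFDerivAt
  have h2 : HasFDerivAt (fun w => κ (z - w)) _ w :=
    h1.comp w ((hasFDerivAt_id w).const_sub z)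
  rw [h2.fderiv]
  simp

/-- The `x`-derivatives of a mollification. -/
lemma IsWeakGrad.integral_fderiv_inl {u : P.Pt → ℝ} {v : P.Pt → P.Vec} (h : P.IsWeakGrad u v)
    {κ : P.Pt → ℝ} (hκ : ContDiff ℝ ∞ κ) (hκc : HasCompactSupport κ) (z : P.Pt) (i : Fin P.m) :
    ∫ w, u w * fderiv ℝ κ (z - w) (EuclideanSpace.single i 1, 0) =
      ∫ w, v w (.inl i) * κ (z - w) := by
  have h1 := h (fun w => κ (z - w)) (hκ.comp (contDiff_const.sub contDiff_id))
    (hκc.comp_homeomorph (Homeomorph.subLeft z)) (.inl i)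
  simp only [gradSmooth_inl, fderiv_comp_const_sub hκ, mul_neg, integral_neg] at h1
  linarith

/-- The `y`-derivatives of a mollification, away from the degeneracy set. -/
lemma IsWeakGrad.integral_fderiv_inr {u : P.Pt → ℝ} {v : P.Pt → P.Vec} (h : P.IsWeakGrad u v)
    {κ : P.Pt → ℝ} (hκ : ContDiff ℝ ∞ κ) (hκc : HasCompactSupport κ) {δ : ℝ} (hδ : 0 < δ)
    (hκδ : ∀ z, κ z ≠ 0 → ‖z.1‖ ≤ δ) (z : P.Pt) (hz : P.γ = 0 ∨ 2 * δ ≤ ‖z.1‖) (j : Fin P.l) :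
    ∫ w, u w * fderiv ℝ κ (z - w) (0, EuclideanSpace.single j 1) =
      ∫ w, v w (.inr j) * (‖w.1‖ ^ (-P.γ) * κ (z - w)) := by
  -- The negative power cancels the weight of `|x|^γ ∂_y`. The product is smooth because, when `γ ≠
  -- 0`, the kernel centred at `z` vanishes for `‖w.1‖ < δ`.
  set ψ : P.Pt → ℝ := fun w => ‖w.1‖ ^ (-P.γ) * κ (z - w) with hψ
  have hκz : ContDiff ℝ ∞ fun w => κ (z - w) := hκ.comp (contDiff_const.sub contDiff_id)
  have hψc : HasCompactSupport ψ := (hκc.comp_homeomorph (Homeomorph.subLeft z)).mul_left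
  have hfar : P.γ ≠ 0 → ∀ w : P.Pt, ‖w.1‖ < δ → κ (z - w) = 0 := by
    intro h0 w hw
    by_contra hne
    have h1 := hκδ _ hne
    have h2 := hz.resolve_left h0
    have h3 := norm_sub_norm_le z.1 w.1
    rw [Prod.fst_sub] at h1
    linarith
  have hψd : ContDiff ℝ ∞ ψ := by
    rcases eq_or_ne P.γ 0 with h0 | h0
    · simpa [hψ, h0] using hκz
    · rw [contDiff_iff_contDiffAt]
      intro w
      rcases eq_or_ne w.1 0 with hw | hw
      · refine (contDiffAt_const (c := (0 : ℝ))).congr_of_eventuallyEq ?_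
        have : ∀ᶠ w' : P.Pt in 𝓝 w, ‖w'.1‖ < δ :=
          (continuous_fst.norm.tendsto w).eventually_lt_const (by simpa [hw] using hδ)
        filter_upwards [this] with w' hw'
        simp [hψ, hfar h0 w' hw']
      · exact (((contDiffAt_norm ℝ hw).comp w contDiffAt_fst).rpow_const_of_ne
          (norm_ne_zero_iff.2 hw)).mul hκz.contDiffAt
  have hgrad : ∀ w, P.gradSmooth ψ w (.inr j) =
      - fderiv ℝ κ (z - w) (0, EuclideanSpace.single j 1) := by
    intro w
    set e : P.Pt := (0, EuclideanSpace.single j 1) with he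
    have h1 : fderiv ℝ ψ w e = ‖w.1‖ ^ (-P.γ) * - fderiv ℝ κ (z - w) e := by
      rw [← (hψd.differentiable (by simp) w).lineDeriv_eq_fderiv]
      have h2 : HasLineDerivAt ℝ (fun w => κ (z - w)) (- fderiv ℝ κ (z - w) e) w e := by
        rw [← fderiv_comp_const_sub hκ]
        exact (hκz.differentiable (by simp) w).hasFDerivAt.hasLineDerivAt e
      have h3 : HasLineDerivAt ℝ ψ (‖w.1‖ ^ (-P.γ) * - fderiv ℝ κ (z - w) e) w e := by
        have := HasDerivAt.const_mul (‖w.1‖ ^ (-P.γ)) h2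
        refine this.congr_of_eventuallyEq (Eventually.of_forall fun t => ?_)
        simp [hψ, he]
      exact h3.lineDeriv
    rw [gradSmooth_inr, h1, ← mul_assoc]
    rcases eq_or_ne P.γ 0 with h0 | h0
    · simp [h0]
    rcases eq_or_ne w.1 0 with hw | hw
    · have : fderiv ℝ κ (z - w) e = 0 := by
        have h4 : fderiv ℝ (fun w => κ (z - w)) w = 0 := by
          have : (fun w => κ (z - w)) =ᶠ[𝓝 w] fun _ => 0 := by
            have : ∀ᶠ w' : P.Pt in 𝓝 w, ‖w'.1‖ < δ :=
              (continuous_fst.norm.tendsto w).eventually_lt_const (by simpa [hw] using hδ)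
            filter_upwards [this] with w' hw' using hfar h0 w' hw'
          rw [this.fderiv_eq]
          simp
        have h5 := fderiv_comp_const_sub hκ z w e
        rw [h4] at h5
        simpa using h5.symm
      simp [this]
    · rw [Real.rpow_neg (norm_nonneg _), mul_inv_cancel₀
        (Real.rpow_pos_of_pos (norm_pos_iff.2 hw) _).ne', one_mul]
  have h1 := h ψ hψd hψc (.inr j)
  simp only [hgrad, mul_neg, integral_neg] at h1
  linarith

/-- Pointwise bound for the Grushin gradient of a mollification. -/
lemma IsWeakGrad.enorm_gradSmooth_mollify_le {u : P.Pt → ℝ} {v : P.Pt → P.Vec}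
    (h : P.IsWeakGrad u v) (hu : LocallyIntegrable u)
    {κ : P.Pt → ℝ} (hκ : ContDiff ℝ ∞ κ) (hκc : HasCompactSupport κ) {δ : ℝ} (hδ : 0 < δ)
    (hκδ : ∀ z, κ z ≠ 0 → ‖z.1‖ ≤ δ) {t : ℝ≥0∞}
    (ht : P.γ ≠ 0 → ENNReal.ofReal ((2 * δ) ^ P.γ) ≤ t) (z : P.Pt) :
    ‖P.gradSmooth (fun z => ∫ w, u w * κ (z - w)) z‖ₑ ≤
      (∫⁻ w, ‖v w‖ₑ * ((P.m + P.l * ENNReal.ofReal (2 ^ P.γ)) * ‖κ (z - w)‖ₑ)) +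
      ∫⁻ w, ‖u w‖ₑ * (t * ∑ j, ‖fderiv ℝ κ (z - w) (0, EuclideanSpace.single j 1)‖ₑ) := by
  set φ : P.Pt → ℝ := fun z => ∫ w, u w * κ (z - w) with hφ
  set M := ∫⁻ w, ‖v w‖ₑ * ‖κ (z - w)‖ₑ with hM
  set D : Fin P.l → ℝ≥0∞ := fun j =>
    ∫⁻ w, ‖u w‖ₑ * ‖fderiv ℝ κ (z - w) (0, EuclideanSpace.single j 1)‖ₑ with hD
  have hx : ∀ i, ‖P.gradSmooth φ z (.inl i)‖ₑ ≤ M := by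
    intro i
    rw [gradSmooth_inl, hφ, fderiv_mollify hu hκ hκc, h.integral_fderiv_inl hκ hκc]
    refine (enorm_integral_le_lintegral_enorm _).trans (lintegral_mono fun w => ?_)
    rw [enorm_mul]
    gcongr
    exact enorm_le_iff_norm_le.2 (PiLp.norm_apply_le (v w) (.inl i))
  have hy : ∀ j, ‖P.gradSmooth φ z (.inr j)‖ₑ ≤ ENNReal.ofReal (2 ^ P.γ) * M + t * D j := by
    intro j
    rw [gradSmooth_inr, hφ, fderiv_mollify hu hκ hκc]
    -- If `‖z.1‖ ≥ 2 * δ`, the points seen by the kernel satisfy `‖z.1‖ ≤ 2 * ‖w.1‖`, so the weights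
    -- are comparable up to `2 ^ γ` and `v` can be used. In the remaining strip the weight is at
    -- most `(2 * δ) ^ γ`, and the derivative is left on the kernel.
    by_cases hz : P.γ = 0 ∨ 2 * δ ≤ ‖z.1‖
    · refine le_add_right ?_
      rw [h.integral_fderiv_inr hκ hκc hδ hκδ z hz, ← integral_const_mul, hM,
        ← lintegral_const_mul' _ _ ENNReal.ofReal_ne_top]
      refine (enorm_integral_le_lintegral_enorm _).trans (lintegral_mono fun w => ?_)
      have e : ‖z.1‖ ^ P.γ * (v w (.inr j) * (‖w.1‖ ^ (-P.γ) * κ (z - w))) =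
          (‖z.1‖ ^ P.γ * ‖w.1‖ ^ (-P.γ)) * (v w (.inr j) * κ (z - w)) := by ring
      rw [e, enorm_mul, enorm_mul (v w (.inr j))]
      rcases eq_or_ne (κ (z - w)) 0 with h0 | h0
      · simp [h0]
      gcongr
      · rw [Real.enorm_of_nonneg (by positivity)]
        refine ENNReal.ofReal_le_ofReal ?_
        rcases eq_or_ne P.γ 0 with hg | hg
        · simp [hg]
        have h2 := hz.resolve_left hg
        have h1 := hκδ _ h0
        have h3 := norm_sub_norm_le z.1 w.1
        rw [Prod.fst_sub] at h1
        have hw : 0 < ‖w.1‖ := by linarith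
        rw [Real.rpow_neg hw.le, ← div_eq_mul_inv, div_le_iff₀ (Real.rpow_pos_of_pos hw _),
          ← Real.mul_rpow zero_le_two hw.le]
        exact Real.rpow_le_rpow (norm_nonneg _) (by linarith) P.γ_nonneg
      · exact enorm_le_iff_norm_le.2 (PiLp.norm_apply_le (v w) (.inr j))
    · push Not at hz
      refine le_add_left ?_
      rw [enorm_mul]
      refine mul_le_mul' (le_trans ?_ (ht hz.1)) ?_
      · rw [Real.enorm_of_nonneg (by positivity)]
        exact ENNReal.ofReal_le_ofReal (Real.rpow_le_rpow (norm_nonneg _) hz.2.le P.γ_nonneg)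
      · refine (enorm_integral_le_lintegral_enorm _).trans (le_of_eq ?_)
        simp only [enorm_mul, hD]
  have hDm : ∀ j, AEMeasurable fun w =>
      ‖u w‖ₑ * ‖fderiv ℝ κ (z - w) (0, EuclideanSpace.single j 1)‖ₑ := fun j =>
    hu.aestronglyMeasurable.enorm.mul (((hκ.continuous_fderiv (by simp)).comp
      (continuous_const.sub continuous_id)).clm_apply continuous_const).enorm.aemeasurable
  calc ‖P.gradSmooth φ z‖ₑ ≤ ∑ i, ‖P.gradSmooth φ z i‖ₑ := enorm_le_sum_enorm _
    _ ≤ (∑ _i : Fin P.m, M) + ∑ j : Fin P.l, (ENNReal.ofReal (2 ^ P.γ) * M + t * D j) := by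
        rw [Fintype.sum_sum_type]
        gcongr with i _ j _
        · exact hx i
        · exact hy j
    _ = (P.m + P.l * ENNReal.ofReal (2 ^ P.γ)) * M + t * ∑ j, D j := by
        rw [Finset.sum_add_distrib, ← Finset.mul_sum Finset.univ D t]
        simp only [Finset.sum_const, Finset.card_univ, Fintype.card_fin, nsmul_eq_mul]
        ring
    _ ≤ _ := by
        gcongr
        · rw [hM, ← lintegral_const_mul' _ _ (by finiteness)]
          exact lintegral_mono fun w => by rw [mul_left_comm]
        · rw [hD, ← lintegral_finsetSum' _ fun j _ => hDm j]
          refine (lintegral_const_mul_le _ _).trans (le_of_eq (lintegral_congr fun w => ?_))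
          rw [← Finset.mul_sum, mul_left_comm]

/-- A function in `L²` with compact support and a weak Grushin gradient in `L²` can be
approximated by test functions in `L¹`, with control of the gradients in `L²`. -/
theorem exists_smooth_approx_of_hasCompactSupport : ∃ C : NNReal, ∀ (u : P.Pt → ℝ)
    (v : P.Pt → P.Vec), P.IsWeakGrad u v → Measurable u → Measurable v → HasCompactSupport u →
    MemLp u 1 → MemLp u 2 → ∀ η : ℝ≥0∞, 0 < η → ∃ φ : P.Pt → ℝ, ContDiff ℝ ∞ φ ∧
      HasCompactSupport φ ∧ eLpNorm (fun z => φ z - u z) 1 volume ≤ η ∧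
      eLpNorm (P.gradSmooth φ) 2 volume ≤ C * eLpNorm v 2 volume + η := by
  refine ⟨(P.m + P.l * ENNReal.ofReal (2 ^ P.γ)).toNNReal, ?_⟩
  rw [ENNReal.coe_toNNReal (by finiteness)]
  intro u v h hum hvm huc hu1 hu2 η hη
  have hloc : LocallyIntegrable u := hu1.locallyIntegrable le_rfl
  obtain ⟨r, hr, htrans⟩ := exists_eLpNorm_translate_le hu1 hη
  obtain ⟨A, hA⟩ := P.exists_mollifier hr
  set K : ℝ≥0∞ := P.l * A * eLpNorm u 2 volume with hK
  have hKt : K ≠ ⊤ := ENNReal.mul_ne_top (by finiteness) hu2.2.ne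
  -- The `y`-radius `r` is fixed, and so is the bound `A` on the `y`-derivatives of the kernel.
  -- Shrinking `δ` alone makes the strip term small. For `γ = 0` there is no strip and `t = 0`
  -- works.
  obtain ⟨δ, hδ, hδr, t, ht, htK⟩ : ∃ δ : ℝ, 0 < δ ∧ δ ≤ r ∧ ∃ t : ℝ≥0∞,
      (P.γ ≠ 0 → ENNReal.ofReal ((2 * δ) ^ P.γ) ≤ t) ∧ t * K ≤ η := by
    rcases eq_or_ne P.γ 0 with hg | hg
    · exact ⟨r, hr, le_rfl, 0, fun h => absurd hg h, by simp⟩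
    have hg0 : 0 < P.γ := lt_of_le_of_ne P.γ_nonneg hg.symm
    have hlim : Tendsto (fun δ : ℝ => ENNReal.ofReal ((2 * δ) ^ P.γ) * K) (𝓝[>] 0) (𝓝 0) := by
      have h1 : ContinuousAt (fun δ : ℝ => (2 * δ) ^ P.γ) 0 :=
        ((continuous_const.mul continuous_id).rpow_const fun _ => Or.inr hg0.le).continuousAt
      have h2 : Tendsto (fun δ : ℝ => ENNReal.ofReal ((2 * δ) ^ P.γ)) (𝓝[>] 0) (𝓝 0) := by
        have := ENNReal.tendsto_ofReal (h1.tendsto.mono_left (nhdsWithin_le_nhds (s := Ioi 0)))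
        simpa [Real.zero_rpow hg] using this
      simpa using ENNReal.Tendsto.mul_const h2 (Or.inr hKt)
    obtain ⟨δ, h1, h2, h3⟩ := ((ENNReal.tendsto_nhds_zero.1 hlim η hη).and
      (Ioc_mem_nhdsGT hr)).exists
    exact ⟨δ, h2, h3, _, fun _ => le_rfl, h1⟩
  obtain ⟨κ, hκ, hκc, hκ0, hκ1, hκs, hκA⟩ := hA δ hδ
  have hkm : Measurable fun w => (P.m + P.l * ENNReal.ofReal (2 ^ P.γ)) * ‖κ w‖ₑ :=
    hκ.continuous.measurable.enorm.const_mul _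
  have hdm : ∀ j, Measurable fun w => ‖fderiv ℝ κ w (0, EuclideanSpace.single j 1)‖ₑ := fun j =>
    ((hκ.continuous_fderiv (by simp)).clm_apply continuous_const).measurable.enorm
  have hDm : Measurable fun w =>
      t * ∑ j, ‖fderiv ℝ κ w (0, EuclideanSpace.single j 1)‖ₑ :=
    (Finset.measurable_fun_sum _ fun j _ => hdm j).const_mul _
  refine ⟨fun z => ∫ w, u w * κ (z - w), contDiff_mollify hloc hκ hκc,
    hasCompactSupport_mollify huc hκc, ?_, ?_⟩
  · refine eLpNorm_mollify_sub_le hu1 hum hκ.continuous hκ0 hκ1 (fun z hz => ?_) htrans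
    have := hκs z hz
    exact max_le (this.1.trans hδr) this.2
  · have hb := fun z => h.enorm_gradSmooth_mollify_le hloc hκ hκc hδ (fun z hz => (hκs z hz).1) ht z
    calc eLpNorm (P.gradSmooth fun z => ∫ w, u w * κ (z - w)) 2 volume
        ≤ eLpNorm ((fun z => ∫⁻ w, ‖v w‖ₑ *
            ((P.m + P.l * ENNReal.ofReal (2 ^ P.γ)) * ‖κ (z - w)‖ₑ)) +
          (fun z => ∫⁻ w, ‖u w‖ₑ *
            (t * ∑ j, ‖fderiv ℝ κ (z - w) (0, EuclideanSpace.single j 1)‖ₑ))) 2 volume :=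
          eLpNorm_mono_enorm fun z => by simpa using hb z
      _ ≤ _ := eLpNorm_add_le (Measurable.lintegral_prod_right'
            ((hvm.enorm.comp measurable_snd).mul
              (hkm.comp (measurable_fst.sub measurable_snd)))).aestronglyMeasurable
            (Measurable.lintegral_prod_right' ((hum.enorm.comp measurable_snd).mul
              (hDm.comp (measurable_fst.sub measurable_snd)))).aestronglyMeasurable
            (by norm_num)
      _ ≤ (P.m + P.l * ENNReal.ofReal (2 ^ P.γ)) * eLpNorm v 2 volume + t * K := by
        refine add_le_add ?_ ?_
        · refine (eLpNorm_lintegral_mul_sub_le hvm.enorm hkm).trans ?_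
          rw [eLpNorm_enorm]
          gcongr
          rw [lintegral_const_mul _ hκ.continuous.measurable.enorm]
          have : ∫⁻ w, ‖κ w‖ₑ = 1 := by
            rw [← ENNReal.ofReal_one, ← hκ1, ofReal_integral_eq_lintegral_ofReal
              (hκ.continuous.integrable_of_hasCompactSupport hκc) (ae_of_all _ hκ0)]
            exact lintegral_congr fun z => Real.enorm_of_nonneg (hκ0 z)
          rw [this, mul_one]
        · refine (eLpNorm_lintegral_mul_sub_le hum.enorm hDm).trans ?_
          rw [eLpNorm_enorm, hK, ← mul_assoc]
          gcongr
          rw [lintegral_const_mul _ (Finset.measurable_fun_sum _ fun j _ => hdm j),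
            lintegral_finsetSum _ fun j _ => hdm j]
          gcongr
          refine (Finset.sum_le_sum fun j _ => hκA j).trans ?_
          simp
      _ ≤ _ := by gcongr

end Params

end Grushin

namespace Grushin

namespace Params

variable (P : Params)

/-! ### Cutoffs adapted to the Grushin dilations -/

/-- The anisotropic dilation `(x, y) ↦ (R⁻¹ x, R^{-(1+γ)} y)`. -/
noncomputable def dilation (R : ℝ) : P.Pt →L[ℝ] P.Pt :=
  (R⁻¹ • ContinuousLinearMap.fst ℝ _ _).prod
    ((R ^ (-(1 + P.γ))) • ContinuousLinearMap.snd ℝ _ _)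

lemma dilation_apply (R : ℝ) (z : P.Pt) :
    P.dilation R z = (R⁻¹ • z.1, (R ^ (-(1 + P.γ))) • z.2) := rfl

/-- The Grushin fields are homogeneous of degree one. A `y`-derivative produces `R^{-(1+γ)}`, and
rescaling `|x|^γ` gives back `R^γ`. -/
lemma gradSmooth_comp_dilation {χ : P.Pt → ℝ} (hχ : ContDiff ℝ ∞ χ) {R : ℝ} (hR : 0 < R)
    (z : P.Pt) : P.gradSmooth (χ ∘ P.dilation R) z = R⁻¹ • P.gradSmooth χ (P.dilation R z) := by
  have h1 : HasFDerivAt (χ ∘ P.dilation R) _ z :=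
    (hχ.differentiable (by simp) (P.dilation R z)).hasFDerivAt.comp z
      (P.dilation R).hasFDerivAt
  ext (i | j)
  · rw [PiLp.smul_apply, gradSmooth_inl, gradSmooth_inl, h1.fderiv,
      ContinuousLinearMap.comp_apply]
    have : P.dilation R (EuclideanSpace.single i 1, 0) =
        R⁻¹ • ((EuclideanSpace.single i 1, 0) : P.Pt) := by
      simp [dilation_apply]
    rw [this, map_smul]
  · rw [PiLp.smul_apply, gradSmooth_inr, gradSmooth_inr, h1.fderiv,
      ContinuousLinearMap.comp_apply]
    have : P.dilation R (0, EuclideanSpace.single j 1) =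
        R ^ (-(1 + P.γ)) • ((0, EuclideanSpace.single j 1) : P.Pt) := by
      simp [dilation_apply]
    rw [this, map_smul, dilation_apply, norm_smul, Real.norm_of_nonneg (by positivity),
      Real.mul_rpow (by positivity) (norm_nonneg _), smul_eq_mul, smul_eq_mul, neg_add,
      Real.rpow_add hR, Real.rpow_neg hR.le, Real.rpow_neg hR.le, Real.rpow_one,
      Real.inv_rpow hR.le]
    ring

lemma gradSmooth_mul {χ φ : P.Pt → ℝ} (hχ : ContDiff ℝ ∞ χ) (hφ : ContDiff ℝ ∞ φ) (z : P.Pt)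
    (i : Fin P.m ⊕ Fin P.l) : P.gradSmooth (fun z => χ z * φ z) z i =
      χ z * P.gradSmooth φ z i + φ z * P.gradSmooth χ z i := by
  have h : HasFDerivAt (fun z => χ z * φ z) _ z :=
    (hχ.differentiable (by simp) z).hasFDerivAt.mul (hφ.differentiable (by simp) z).hasFDerivAt
  rcases i with i | j
  · rw [gradSmooth_inl, gradSmooth_inl, gradSmooth_inl, h.fderiv]
    simp
  · rw [gradSmooth_inr, gradSmooth_inr, gradSmooth_inr, h.fderiv]
    simp
    ring

/-- The product rule for weak Grushin gradients. -/
lemma isWeakGrad_mul (u : P.D) {χ : P.Pt → ℝ} (hχ : ContDiff ℝ ∞ χ) :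
    P.IsWeakGrad (fun z => χ z * u z)
      (fun z => χ z • D.grad u z + u z • P.gradSmooth χ z) := by
  intro φ hφ hφc i
  have hχφ : ContDiff ℝ ∞ fun z => χ z * φ z := hχ.mul hφ
  have hχφc : HasCompactSupport fun z => χ z * φ z := hφc.mul_left
  have h := D.isWeakGrad u _ hχφ hχφc i
  have hi1 := P.integrable_mul_gradSmooth (D.toLp u) hχφ hχφc i
  have hi2 := P.integrable_comp_mul (D.grad u) hχφ hχφc i
  have hi3 : Integrable fun z => u z * (φ z * P.gradSmooth χ z i) :=
    ((Lp.memLp (D.toLp u)).locallyIntegrable Fact.out).integrable_smul_right_of_hasCompactSupport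
      (hφ.continuous.mul (P.gradSmooth_apply_continuous hχ i)) hφc.mul_right
  have e1 : ∫ z, χ z * u z * P.gradSmooth φ z i =
      ∫ z, (u z * P.gradSmooth (fun z => χ z * φ z) z i - u z * (φ z * P.gradSmooth χ z i)) := by
    congr 1
    ext z
    rw [P.gradSmooth_mul hχ hφ]
    ring
  have e2 : ∫ z, (χ z • D.grad u z + u z • P.gradSmooth χ z) i * φ z =
      ∫ z, (D.grad u z i * (χ z * φ z) + u z * (φ z * P.gradSmooth χ z i)) := by
    congr 1
    ext z
    simp only [PiLp.add_apply, PiLp.smul_apply, smul_eq_mul]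
    ring
  rw [e1, e2, integral_sub hi1 hi3, integral_add hi2 hi3, h]
  ring

lemma tendsto_dilation (z : P.Pt) : Tendsto (fun R : ℝ => P.dilation R z) atTop (𝓝 0) := by
  have h1 : Tendsto (fun R : ℝ => R⁻¹ • z.1) atTop (𝓝 ((0 : ℝ) • z.1)) :=
    tendsto_inv_atTop_zero.smul_const z.1
  have h2 : Tendsto (fun R : ℝ => R ^ (-(1 + P.γ)) • z.2) atTop (𝓝 ((0 : ℝ) • z.2)) := by
    have := P.γ_nonneg
    exact (tendsto_rpow_neg_atTop (by linarith : 0 < 1 + P.γ)).smul_const z.2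
  rw [zero_smul] at h1 h2
  exact h1.prodMk_nhds h2

lemma dilation_preimage_subset {R : ℝ} (hR : 0 < R) : {z : P.Pt | ‖P.dilation R z‖ ≤ 2} ⊆
    Metric.closedBall 0 (R * 2) ×ˢ Metric.closedBall 0 (R ^ (1 + P.γ) * 2) := by
  intro z hz
  simp only [mem_ofPred_eq, dilation_apply, Prod.norm_mk, sup_le_iff, norm_smul, norm_inv] at hz
  rw [Real.norm_of_nonneg hR.le, Real.norm_of_nonneg (by positivity),
    Real.rpow_neg hR.le, inv_mul_le_iff₀ hR, inv_mul_le_iff₀ (by positivity)] at hz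
  exact ⟨by simpa using hz.1, by simpa using hz.2⟩

/-- The inverse dilation multiplies volumes by `R^m * R^{(1+γ)ℓ}`, which is where the homogeneous
dimension comes from. -/
lemma volume_dilation_preimage_le : ∃ c : NNReal, ∀ R : ℝ, 0 < R →
    volume {z : P.Pt | ‖P.dilation R z‖ ≤ 2} ≤ c * ENNReal.ofReal (R ^ P.homDim) := by
  refine ⟨(volume (Metric.closedBall (0 : EuclideanSpace ℝ (Fin P.m)) 2) *
    volume (Metric.closedBall (0 : EuclideanSpace ℝ (Fin P.l)) 2)).toNNReal, fun R hR => ?_⟩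
  rw [ENNReal.coe_toNNReal (ENNReal.mul_ne_top measure_closedBall_lt_top.ne
    measure_closedBall_lt_top.ne)]
  refine (measure_mono (P.dilation_preimage_subset hR)).trans (le_of_eq ?_)
  rw [Measure.volume_eq_prod, Measure.prod_prod, Measure.addHaar_closedBall_mul _ _ hR.le zero_le_two,
    Measure.addHaar_closedBall_mul _ _ (by positivity) zero_le_two]
  have : ENNReal.ofReal (R ^ P.homDim) = ENNReal.ofReal (R ^ P.m) *
      ENNReal.ofReal ((R ^ (1 + P.γ)) ^ P.l) := by
    rw [← ENNReal.ofReal_mul (by positivity), homDim, Real.rpow_add hR, Real.rpow_natCast,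
      Real.rpow_mul hR.le, Real.rpow_natCast]
  rw [this]
  simp only [finrank_euclideanSpace, Fintype.card_fin]
  ring

/-- The commutator with the dilated cutoffs tends to zero. -/
lemma tendsto_eLpNorm_smul_gradSmooth_cutoff {χ : P.Pt → ℝ} (hχ : ContDiff ℝ ∞ χ)
    (hχ1 : ∀ z, ‖z‖ ≤ 1 → χ z = 1) (hχ0 : ∀ z, χ z ≠ 0 → ‖z‖ < 2) {u : P.Pt → ℝ}
    (hu : MemLp u (ENNReal.ofReal P.critExp)) :
    Tendsto (fun R : ℝ => eLpNorm (fun z => u z • P.gradSmooth (χ ∘ P.dilation R) z) 2 volume)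
      atTop (𝓝 0) := by
  have hp2 := P.two_lt_critExp
  have hQ2 := P.two_lt_homDim
  have hχc : HasCompactSupport χ := HasCompactSupport.intro
    (isCompact_closedBall (0 : P.Pt) 2) fun z hz => by
      by_contra h
      exact hz (by simpa using (hχ0 z h).le)
  obtain ⟨M, hM⟩ := (P.hasCompactSupport_gradSmooth hχc).exists_bound_of_continuous
    (P.continuous_gradSmooth (hχ.of_le (by exact_mod_cast le_top)))
  have hM0 : 0 ≤ M := (norm_nonneg _).trans (hM 0)
  obtain ⟨c, hc⟩ := P.volume_dilation_preimage_le
  -- Outside this shell the cutoff is locally constant. Each fixed point leaves the shell as `R`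
  -- grows, so only a tail of `u` contributes.
  set T : ℝ → Set P.Pt := fun R => {z | 1 ≤ ‖P.dilation R z‖ ∧ ‖P.dilation R z‖ ≤ 2} with hT
  have hTm : ∀ R, MeasurableSet (T R) := fun R =>
    ((isClosed_le continuous_const (P.dilation R).continuous.norm).inter
      (isClosed_le (P.dilation R).continuous.norm continuous_const)).measurableSet
  -- the tails of `u`
  have htail : Tendsto (fun R : ℝ => eLpNorm ((T R).indicator u) (ENNReal.ofReal P.critExp)
      volume) atTop (𝓝 0) := by
    have hint := lintegral_rpow_enorm_lt_top_of_eLpNorm_lt_top (by simp; linarith) (by simp)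
      hu.eLpNorm_lt_top
    rw [ENNReal.toReal_ofReal (by linarith)] at hint
    have h1 : Tendsto (fun R : ℝ => ∫⁻ z, ‖(T R).indicator u z‖ₑ ^ P.critExp) atTop
        (𝓝 (∫⁻ _ : P.Pt, 0)) := by
      refine tendsto_lintegral_filter_of_dominated_convergence' (fun z => ‖u z‖ₑ ^ P.critExp)
        (Eventually.of_forall fun R => ?_) (Eventually.of_forall fun R => ae_of_all _ fun z => ?_)
        hint.ne (ae_of_all _ fun z => ?_)
      · exact (hu.1.indicator (hTm R)).enorm.pow_const _
      · have := enorm_indicator_le_enorm_self u (s := T R) z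
        gcongr
      · refine tendsto_const_nhds.congr' ?_
        have : ∀ᶠ R in atTop, ‖P.dilation R z‖ < 1 :=
          (P.tendsto_dilation z).norm.eventually_lt_const (by simp)
        filter_upwards [this] with R hR
        have : z ∉ T R := fun h => absurd h.1 (not_le.2 hR)
        rw [indicator_of_notMem this, enorm_zero, ENNReal.zero_rpow_of_pos (by linarith)]
    simp only [lintegral_zero] at h1
    have h2 := h1.ennrpow_const (1 / P.critExp)
    rw [ENNReal.zero_rpow_of_pos (by apply one_div_pos.2; linarith)] at h2
    refine h2.congr fun R => ?_
    rw [eLpNorm_eq_lintegral_rpow_enorm_toReal (by simp; linarith) (by simp),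
      ENNReal.toReal_ofReal (by linarith)]
  have hbound : ∀ R : ℝ, 0 < R →
      eLpNorm (fun z => u z • P.gradSmooth (χ ∘ P.dilation R) z) 2 volume ≤
        ENNReal.ofReal M * (c : ℝ≥0∞) ^ (1 / P.homDim) *
          eLpNorm ((T R).indicator u) (ENNReal.ofReal P.critExp) volume := by
    intro R hR
    have hpt : ∀ z, ‖u z • P.gradSmooth (χ ∘ P.dilation R) z‖ ≤
        (M * R⁻¹) * ‖(T R).indicator u z‖ := by
      intro z
      rw [P.gradSmooth_comp_dilation hχ hR, norm_smul, norm_smul, norm_inv,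
        Real.norm_of_nonneg hR.le]
      by_cases hz : z ∈ T R
      · rw [indicator_of_mem hz]
        have := mul_le_mul_of_nonneg_left (hM (P.dilation R z))
          (by positivity : 0 ≤ ‖u z‖ * R⁻¹)
        nlinarith
      · have : P.gradSmooth χ (P.dilation R z) = 0 := by
          have h0 : fderiv ℝ χ (P.dilation R z) = 0 := by
            simp only [hT, mem_ofPred_eq, not_and_or, not_le] at hz
            rcases hz with hz | hz
            · have : χ =ᶠ[𝓝 (P.dilation R z)] fun _ => 1 := by
                filter_upwards [continuous_norm.continuousAt.eventually_lt_const hz] with w hw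
                exact hχ1 w hw.le
              rw [this.fderiv_eq]
              simp
            · have : χ =ᶠ[𝓝 (P.dilation R z)] fun _ => 0 := by
                filter_upwards [continuous_norm.continuousAt.eventually_const_lt hz] with w hw
                by_contra h
                exact absurd (hχ0 w h) (not_lt.2 hw.le)
              rw [this.fderiv_eq]
              simp
          ext (i | j) <;> simp [gradSmooth, h0]
        simp [this, indicator_of_notMem hz]
    -- This is the definition of the critical exponent. Hölder on the shell costs `(R ^ N_γ) ^ (1 /
    -- N_γ) = R`, which cancels the `R⁻¹` from the gradient of the cutoff.
    have hexp : 1 / (2 : ℝ≥0∞).toReal - 1 / (ENNReal.ofReal P.critExp).toReal = 1 / P.homDim := by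
      rw [ENNReal.toReal_ofReal (by linarith), ENNReal.toReal_ofNat, critExp]
      have : P.homDim - 2 ≠ 0 := by linarith
      field_simp
      ring
    have hvol : volume (T R) ^ (1 / P.homDim) ≤
        (c : ℝ≥0∞) ^ (1 / P.homDim) * ENNReal.ofReal R := by
      have hle : volume (T R) ≤ c * ENNReal.ofReal (R ^ P.homDim) :=
        (measure_mono fun z hz => hz.2).trans (hc R hR)
      calc volume (T R) ^ (1 / P.homDim) ≤ (c * ENNReal.ofReal (R ^ P.homDim)) ^ (1 / P.homDim) :=
            ENNReal.rpow_le_rpow hle (by apply one_div_nonneg.2; linarith)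
        _ = _ := by
            rw [ENNReal.mul_rpow_of_nonneg _ _ (by apply one_div_nonneg.2; linarith),
              ENNReal.ofReal_rpow_of_pos (by positivity), ← Real.rpow_mul hR.le,
              mul_one_div_cancel (by linarith), Real.rpow_one]
    calc eLpNorm (fun z => u z • P.gradSmooth (χ ∘ P.dilation R) z) 2 volume
        ≤ ENNReal.ofReal (M * R⁻¹) * eLpNorm ((T R).indicator u) 2 volume :=
          eLpNorm_le_mul_eLpNorm_of_ae_le_mul (ae_of_all _ hpt) 2
      _ ≤ ENNReal.ofReal (M * R⁻¹) * (eLpNorm ((T R).indicator u) (ENNReal.ofReal P.critExp)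
            volume * volume (T R) ^ (1 / P.homDim)) := by
          gcongr
          rw [eLpNorm_indicator_eq_eLpNorm_restrict (hTm R),
            eLpNorm_indicator_eq_eLpNorm_restrict (hTm R)]
          have h := eLpNorm_le_eLpNorm_mul_rpow_measure_univ (μ := volume.restrict (T R))
            (p := 2) (q := ENNReal.ofReal P.critExp)
            (by rw [← ENNReal.ofReal_ofNat 2]; exact ENNReal.ofReal_le_ofReal hp2.le)
            hu.1.restrict
          rwa [hexp, Measure.restrict_apply_univ] at h
      _ ≤ ENNReal.ofReal (M * R⁻¹) * (eLpNorm ((T R).indicator u) (ENNReal.ofReal P.critExp)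
            volume * ((c : ℝ≥0∞) ^ (1 / P.homDim) * ENNReal.ofReal R)) := by gcongr
      _ = (ENNReal.ofReal (M * R⁻¹) * ENNReal.ofReal R) * (c : ℝ≥0∞) ^ (1 / P.homDim) *
          eLpNorm ((T R).indicator u) (ENNReal.ofReal P.critExp) volume := by ring
      _ = _ := by
          rw [← ENNReal.ofReal_mul (by positivity), mul_assoc M, inv_mul_cancel₀ hR.ne', mul_one]
  have hlim := ENNReal.Tendsto.const_mul htail (a := ENNReal.ofReal M * (c : ℝ≥0∞) ^ (1 / P.homDim))
    (Or.inr (by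
      refine ENNReal.mul_ne_top ENNReal.ofReal_ne_top
        (ENNReal.rpow_ne_top_of_nonneg (by apply one_div_nonneg.2; linarith) (by simp))))
  rw [mul_zero] at hlim
  refine tendsto_of_tendsto_of_tendsto_of_le_of_le' tendsto_const_nhds hlim
    (Eventually.of_forall fun _ => zero_le) ?_
  filter_upwards [eventually_gt_atTop 0] with R hR using hbound R hR

/-- Elements of `D_γ` are almost everywhere limits of test functions with bounded gradients. -/
theorem exists_smooth_approx : ∃ C : NNReal, ∀ u : P.D, ∃ φ : ℕ → P.Pt → ℝ,
    (∀ n, ContDiff ℝ ∞ (φ n)) ∧ (∀ n, HasCompactSupport (φ n)) ∧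
    (∀ᵐ z, Tendsto (fun n => φ n z) atTop (𝓝 (u z))) ∧
    ∀ n : ℕ, eLpNorm (P.gradSmooth (φ n)) 2 volume ≤
      C * eLpNorm (D.grad u) 2 volume + ((n : ℝ≥0∞) + 1)⁻¹ := by
  obtain ⟨C, hC⟩ := exists_smooth_approx_of_hasCompactSupport (P := P)
  refine ⟨C, fun u => ?_⟩
  have hp2 := P.two_lt_critExp
  let χ : ContDiffBump (0 : P.Pt) := ⟨1, 2, one_pos, one_lt_two⟩
  have hχd : ContDiff ℝ ∞ (χ : P.Pt → ℝ) := χ.contDiff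
  have hχ1 : ∀ z : P.Pt, ‖z‖ ≤ 1 → χ z = 1 := fun z hz =>
    χ.one_of_mem_closedBall (by simpa using hz)
  have hχ0 : ∀ z : P.Pt, χ z ≠ 0 → ‖z‖ < 2 := by
    intro z hz
    have : z ∈ Function.support χ := hz
    rw [χ.support_eq] at this
    exact mem_ball_zero_iff.1 this
  have hum : Measurable (D.toLp u) := (Lp.stronglyMeasurable (D.toLp u)).measurable
  have hgm : Measurable (D.grad u) := (Lp.stronglyMeasurable (D.grad u)).measurable
  have hlim := P.tendsto_eLpNorm_smul_gradSmooth_cutoff hχd hχ1 hχ0 (Lp.memLp (D.toLp u))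
  have hstep : ∀ n : ℕ, ∃ (R : ℝ) (φ : P.Pt → ℝ), (n : ℝ) + 1 ≤ R ∧ ContDiff ℝ ∞ φ ∧
      HasCompactSupport φ ∧
      eLpNorm (fun z => φ z - χ (P.dilation R z) * u z) 1 volume ≤ ((n : ℝ≥0∞) + 1)⁻¹ ∧
      eLpNorm (P.gradSmooth φ) 2 volume ≤
        C * eLpNorm (D.grad u) 2 volume + ((n : ℝ≥0∞) + 1)⁻¹ := by
    intro n
    -- The cutoff error `e` is multiplied by `C` and the mollification adds another `e`, for a total
    -- of `(C + 1) * e`.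
    set e : ℝ≥0∞ := ((C : ℝ≥0∞) + 1)⁻¹ * ((n : ℝ≥0∞) + 1)⁻¹ with he
    have he0 : 0 < e := by
      rw [he, pos_iff_ne_zero]
      exact mul_ne_zero (ENNReal.inv_ne_zero.2 (by finiteness))
        (ENNReal.inv_ne_zero.2 (by finiteness))
    have hC1 : ((C : ℝ≥0∞) + 1) * e = ((n : ℝ≥0∞) + 1)⁻¹ := by
      rw [he, ← mul_assoc, ENNReal.mul_inv_cancel (by simp) (by finiteness), one_mul]
    obtain ⟨R, hR1, hR2⟩ := ((ENNReal.tendsto_nhds_zero.1 hlim e he0).and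
      (eventually_ge_atTop ((n : ℝ) + 1))).exists
    have hR0 : 0 < R := lt_of_lt_of_le (by positivity) hR2
    have hψd : ContDiff ℝ ∞ (χ ∘ P.dilation R) := hχd.comp (P.dilation R).contDiff
    have hzero : ∀ z : P.Pt, z ∉ {z : P.Pt | ‖P.dilation R z‖ ≤ 2} →
        χ (P.dilation R z) * u z = 0 := by
      intro z hz
      have : χ (P.dilation R z) = 0 := by
        by_contra h
        exact hz (hχ0 _ h).le
      rw [this, zero_mul]
    obtain ⟨c, hc⟩ := P.volume_dilation_preimage_le
    have hvol : volume {z : P.Pt | ‖P.dilation R z‖ ≤ 2} ≠ ⊤ :=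
      ne_top_of_le_ne_top (by finiteness) (hc R hR0)
    have hmem : MemLp (fun z => χ (P.dilation R z) * u z) (ENNReal.ofReal P.critExp) volume := by
      refine (Lp.memLp (D.toLp u)).of_le_mul (c := 1)
        ((hψd.continuous.measurable.mul hum).aestronglyMeasurable) (ae_of_all _ fun z => ?_)
      rw [norm_mul]
      gcongr
      rw [Real.norm_of_nonneg χ.nonneg]
      exact χ.le_one
    have hmem1 : MemLp (fun z => χ (P.dilation R z) * u z) 1 volume :=
      hmem.mono_exponent_of_measure_support_ne_top hzero hvol Fact.out
    have hmem2 : MemLp (fun z => χ (P.dilation R z) * u z) 2 volume :=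
      hmem.mono_exponent_of_measure_support_ne_top hzero hvol
        (by rw [← ENNReal.ofReal_ofNat 2]; exact ENNReal.ofReal_le_ofReal hp2.le)
    have hcs : HasCompactSupport fun z => χ (P.dilation R z) * u z :=
      HasCompactSupport.intro ((isCompact_closedBall _ _).prod (isCompact_closedBall _ _))
        fun z hz => hzero z fun h => hz (P.dilation_preimage_subset hR0 h)
    have hgs := P.continuous_gradSmooth (hψd.of_le (by exact_mod_cast le_top))
    have hvm : Measurable fun z =>
        (χ ∘ P.dilation R) z • D.grad u z + u z • P.gradSmooth (χ ∘ P.dilation R) z :=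
      (hψd.continuous.measurable.smul hgm).add (hum.smul hgs.measurable)
    obtain ⟨φ, h1, h2, h3, h4⟩ := hC _ _ (P.isWeakGrad_mul u hψd)
      (hψd.continuous.measurable.mul hum) hvm hcs hmem1 hmem2 e he0
    refine ⟨R, φ, hR2, h1, h2, h3.trans ?_, h4.trans ?_⟩
    · rw [← hC1]
      exact le_mul_of_one_le_left zero_le le_add_self
    · have h5 : eLpNorm (fun z =>
          (χ ∘ P.dilation R) z • D.grad u z + u z • P.gradSmooth (χ ∘ P.dilation R) z) 2 volume ≤
          eLpNorm (D.grad u) 2 volume + e := by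
        refine (eLpNorm_add_le (hψd.continuous.measurable.smul hgm).aestronglyMeasurable
          (hum.smul hgs.measurable).aestronglyMeasurable (by norm_num)).trans ?_
        refine add_le_add (eLpNorm_mono fun z => ?_) hR1
        rw [Pi.smul_apply', norm_smul]
        refine mul_le_of_le_one_left (norm_nonneg _) ?_
        rw [Function.comp_apply, Real.norm_of_nonneg χ.nonneg]
        exact χ.le_one
      calc (C : ℝ≥0∞) * _ + e ≤ C * (eLpNorm (D.grad u) 2 volume + e) + e := by gcongr
        _ = C * eLpNorm (D.grad u) 2 volume + (C + 1) * e := by ring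
        _ = _ := by rw [hC1]
  choose R φ hR hφ hφc h1 h2 using hstep
  have hinv : Tendsto (fun n : ℕ => ((n : ℝ≥0∞) + 1)⁻¹) atTop (𝓝 0) := by
    have := (tendsto_add_atTop_iff_nat 1).2 ENNReal.tendsto_inv_nat_nhds_zero
    simpa using this
  have hL1 : Tendsto (fun n => eLpNorm ((fun z => φ n z - χ (P.dilation (R n) z) * u z) - 0) 1
      volume) atTop (𝓝 0) := by
    refine tendsto_of_tendsto_of_tendsto_of_le_of_le tendsto_const_nhds hinv
      (fun _ => zero_le) fun n => ?_
    simpa using h1 n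
  -- The difference from the cut-off function tends to zero in `L¹`, hence almost everywhere along a
  -- subsequence. At each fixed point the cutoff is eventually `1`, so the limit is `u`.
  have hmeas := tendstoInMeasure_of_tendsto_eLpNorm one_ne_zero (fun n => ?_)
    aestronglyMeasurable_zero hL1
  · obtain ⟨s, hs, hae⟩ := hmeas.exists_seq_tendsto_ae
    refine ⟨fun k => φ (s k), fun k => hφ _, fun k => hφc _, ?_, fun k => (h2 _).trans ?_⟩
    · filter_upwards [hae] with z hz
      have hχz : ∀ᶠ n in atTop, χ (P.dilation (R n) z) = 1 := by
        have hRtop : Tendsto R atTop atTop := tendsto_atTop_mono (fun n => (by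
          have := hR n
          linarith : (n : ℝ) ≤ R n)) tendsto_natCast_atTop_atTop
        filter_upwards [((P.tendsto_dilation z).comp hRtop).norm.eventually_le_const
          (by simp : ‖(0 : P.Pt)‖ < 1)] with n hn using hχ1 _ hn
      have := hs.tendsto_atTop.eventually hχz
      have h3 := hz.add_const (u z)
      simp only [Pi.zero_apply, zero_add] at h3
      refine h3.congr' ?_
      filter_upwards [this] with k hk
      rw [hk]
      ring
    · gcongr
      exact hs.id_le k
  · exact ((hφ n).continuous.measurable.sub
      ((hχd.continuous.measurable.comp (P.dilation (R n)).continuous.measurable).mul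
        hum)).aestronglyMeasurable

end Params

end Grushin

namespace Grushin

namespace Params

variable (P : Params)

/-- The element of `D_γ` with given components. -/
def D.mk {P : Params} (w : P.LCrit × P.LGrad) (hw : w ∈ P.graph) : P.D := ⟨w, hw⟩

lemma D.grad_mk {P : Params} (w : P.LCrit × P.LGrad) (hw : w ∈ P.graph) :
    D.grad (D.mk w hw) = w.2 := rfl

/-! ### The Sobolev inequality and completeness of `D_γ` -/

lemma enorm_eq_eLpNorm_grad (u : P.D) : ‖u‖ₑ = eLpNorm (D.grad u) 2 volume := by
  rw [← Lp.enorm_def]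
  exact enorm_eq_iff_norm_eq.2 (D.norm_def u)

lemma tendsto_const_mul_add_inv {C : ℝ≥0∞} (hC : C ≠ ⊤) (x : ℝ≥0∞) :
    Tendsto (fun n : ℕ => C * (x + ((n : ℝ≥0∞) + 1)⁻¹)) atTop (𝓝 (C * x)) := by
  have h1 : Tendsto (fun n : ℕ => ((n : ℝ≥0∞) + 1)⁻¹) atTop (𝓝 0) := by
    simpa using (tendsto_add_atTop_iff_nat 1).2 ENNReal.tendsto_inv_nat_nhds_zero
  have h2 := ENNReal.Tendsto.const_mul (h1.const_add x) (Or.inr hC)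
  rwa [add_zero] at h2

/-- Lower semicontinuous estimates pass from test functions to `D_γ`. -/
lemma exists_eLpNorm_le_of_smooth : ∃ C : NNReal, ∀ (T : (P.Pt → ℝ) → P.Pt → ℝ) (p : ℝ≥0∞)
    (A : NNReal),
    (∀ φ, ContDiff ℝ ∞ φ → HasCompactSupport φ → AEStronglyMeasurable (T φ) volume ∧
      eLpNorm (T φ) p volume ≤ A * eLpNorm (P.gradSmooth φ) 2 volume) →
    (∀ (φ : ℕ → P.Pt → ℝ) (u : P.Pt → ℝ), (∀ᵐ z, Tendsto (fun n => φ n z) atTop (𝓝 (u z))) →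
      ∀ᵐ z, Tendsto (fun n => T (φ n) z) atTop (𝓝 (T u z))) →
    ∀ u : P.D, eLpNorm (T u) p volume ≤ C * A * ‖u‖ₑ := by
  obtain ⟨C, hC⟩ := P.exists_smooth_approx
  refine ⟨C, fun T p A hT hlim u => ?_⟩
  obtain ⟨φ, hφ, hφc, hae, hb⟩ := hC u
  refine (Lp.eLpNorm_lim_le_liminf_eLpNorm (fun n => (hT _ (hφ n) (hφc n)).1) _
    (hlim φ u hae)).trans ?_
  have h1 : Tendsto (fun n : ℕ => (A : ℝ≥0∞) * (C * ‖u‖ₑ + ((n : ℝ≥0∞) + 1)⁻¹)) atTop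
      (𝓝 (A * (C * ‖u‖ₑ))) := tendsto_const_mul_add_inv (by simp) _
  calc _ ≤ atTop.liminf fun n : ℕ => (A : ℝ≥0∞) * (C * ‖u‖ₑ + ((n : ℝ≥0∞) + 1)⁻¹) := by
        refine liminf_le_liminf (Eventually.of_forall fun n => ?_)
        refine (hT _ (hφ n) (hφc n)).2.trans ?_
        rw [enorm_eq_eLpNorm_grad]
        gcongr
        exact hb n
    _ = A * (C * ‖u‖ₑ) := h1.liminf_eq
    _ = _ := by ring

/-- The **Grushin–Sobolev inequality** on `D_γ`. -/
theorem exists_eLpNorm_le_norm : ∃ C : NNReal, ∀ u : P.D,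
    eLpNorm u (ENNReal.ofReal P.critExp) volume ≤ C * ‖u‖ₑ := by
  obtain ⟨A, hA⟩ := P.exists_eLpNorm_le_gradSmooth
  obtain ⟨C, hC⟩ := P.exists_eLpNorm_le_of_smooth
  refine ⟨C * A, fun u => ?_⟩
  push_cast
  exact hC id _ A (fun φ hφ hφc => ⟨hφ.continuous.aestronglyMeasurable,
    hA φ (hφ.of_le (by exact_mod_cast le_top)) hφc⟩) (fun _ _ h => h) u

/-- For a fixed test function, both sides of the defining identity are pairings with fixed functions
in the dual Lebesgue spaces, hence continuous in the pair. -/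
lemma isClosed_graph : IsClosed (P.graph : Set (P.LCrit × P.LGrad)) := by
  have hp2 := P.two_lt_critExp
  obtain ⟨q, hpq⟩ : ∃ q, P.critExp.HolderConjugate q :=
    ⟨_, Real.HolderConjugate.conjExponent (by linarith)⟩
  have := hpq.ennrealOfReal
  have : Fact (1 ≤ ENNReal.ofReal q) := ⟨ENNReal.HolderConjugate.one_le _ (ENNReal.ofReal P.critExp)⟩
  have hset : (P.graph : Set (P.LCrit × P.LGrad)) = ⋂ (φ : P.Pt → ℝ) (_ : ContDiff ℝ ∞ φ)
      (_ : HasCompactSupport φ) (i : Fin P.m ⊕ Fin P.l),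
      {w | ∫ z, w.1 z * P.gradSmooth φ z i = - ∫ z, w.2 z i * φ z} := by
    ext w
    simp only [mem_iInter]
    rfl
  rw [hset]
  refine isClosed_iInter fun φ => isClosed_iInter fun hφ => isClosed_iInter fun hφc =>
    isClosed_iInter fun i => isClosed_eq ?_ (Continuous.neg ?_)
  · have hm : MemLp (fun z => P.gradSmooth φ z i) (ENNReal.ofReal q) volume :=
      (P.gradSmooth_apply_continuous hφ i).memLp_of_hasCompactSupport
        (P.gradSmooth_apply_hasCompactSupport hφc i)
    have hc : Continuous fun w : P.LCrit × P.LGrad => (ContinuousLinearMap.mul ℝ ℝ).lpPairing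
        volume (ENNReal.ofReal P.critExp) (ENNReal.ofReal q) w.1 (hm.toLp _) := by fun_prop
    refine hc.congr fun w => ?_
    rw [ContinuousLinearMap.lpPairing_eq_integral]
    refine integral_congr_ae ?_
    filter_upwards [hm.coeFn_toLp] with z hz
    simp [hz]
  · have hm : MemLp φ 2 volume := hφ.continuous.memLp_of_hasCompactSupport hφc
    let B : P.Vec →L[ℝ] ℝ →L[ℝ] ℝ :=
      (ContinuousLinearMap.mul ℝ ℝ).comp (EuclideanSpace.proj i)
    have hc : Continuous fun w : P.LCrit × P.LGrad => B.lpPairing volume 2 2 w.2 (hm.toLp _) := by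
      fun_prop
    refine hc.congr fun w => ?_
    rw [ContinuousLinearMap.lpPairing_eq_integral]
    refine integral_congr_ae ?_
    filter_upwards [hm.coeFn_toLp] with z hz
    simp [hz, B]

lemma exists_norm_toLp_le : ∃ C : ℝ, 0 < C ∧ ∀ u : P.D, ‖D.toLp u‖ ≤ C * ‖u‖ := by
  obtain ⟨C, hC⟩ := P.exists_eLpNorm_le_norm
  refine ⟨C + 1, by positivity, fun u => ?_⟩
  have h := hC u
  rw [← Lp.enorm_def, ← ofReal_norm, ← ofReal_norm, ← ENNReal.ofReal_coe_nnreal,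
    ← ENNReal.ofReal_mul C.coe_nonneg, ENNReal.ofReal_le_ofReal_iff (by positivity)] at h
  nlinarith [norm_nonneg u]

/-- By the Sobolev inequality a Cauchy sequence for `‖·‖_γ` is Cauchy in both components of the
graph, and the graph is closed. -/
instance completeSpace_D : CompleteSpace P.D := by
  refine Metric.complete_of_cauchySeq_tendsto fun u hu => ?_
  obtain ⟨C, hC0, hC⟩ := P.exists_norm_toLp_le
  have h1 : CauchySeq fun n => D.grad (u n) := by
    rw [Metric.cauchySeq_iff] at hu ⊢
    intro ε hε
    obtain ⟨N, hN⟩ := hu ε hε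
    refine ⟨N, fun m hm n hn => ?_⟩
    rw [dist_eq_norm, ← map_sub, ← D.norm_def, ← dist_eq_norm]
    exact hN m hm n hn
  have h2 : CauchySeq fun n => D.toLp (u n) := by
    rw [Metric.cauchySeq_iff] at hu ⊢
    intro ε hε
    obtain ⟨N, hN⟩ := hu (ε / C) (by positivity)
    refine ⟨N, fun m hm n hn => ?_⟩
    rw [dist_eq_norm, ← map_sub]
    refine (hC _).trans_lt ?_
    have := hN m hm n hn
    rw [dist_eq_norm, lt_div_iff₀ hC0] at this
    linarith
  obtain ⟨V, hV⟩ := cauchySeq_tendsto_of_complete h1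
  obtain ⟨U, hU⟩ := cauchySeq_tendsto_of_complete h2
  have hmem : (U, V) ∈ P.graph := by
    refine P.isClosed_graph.mem_of_tendsto (hU.prodMk_nhds hV) (Eventually.of_forall fun n => ?_)
    exact (u n).2
  refine ⟨D.mk (U, V) hmem, ?_⟩
  rw [tendsto_iff_norm_sub_tendsto_zero] at hV ⊢
  refine hV.congr fun n => ?_
  rw [D.norm_def, map_sub, D.grad_mk]

/-- The gradient is an isometry into a separable `L²` space. Separability is what makes the weak
compactness of balls sequential. -/
instance secondCountableTopology_D : SecondCountableTopology P.D := by
  have : Isometry (D.grad (P := P)) :=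
    AddMonoidHomClass.isometry_of_norm _ fun u => (D.norm_def u).symm
  have h2 : Fact ((2 : ℝ≥0∞) ≠ ⊤) := ⟨by simp⟩
  have h3 : SecondCountableTopology P.LGrad := by
    have : SigmaFinite (volume : Measure P.Pt) := inferInstance
    have := MeasureTheory.isSeparable_of_sigmaFinite (volume : Measure P.Pt)
    exact Lp.SecondCountableTopology
  exact this.isEmbedding.secondCountableTopology

/-! ### Translation estimates -/

/-- Write the difference as an integral of the derivative over the segment from `z` to `z + e`, then
use Cauchy–Schwarz in `t`, Fubini and translation invariance. Since `W` is constant along `e`, it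
can be moved under the integral; the cases of interest are `1` for `x`-shifts and `|x|^γ` for
`y`-shifts. -/
lemma eLpNorm_smul_translate_le {φ : P.Pt → ℝ} (hφ : ContDiff ℝ 1 φ) {W : P.Pt → ℝ}
    (hW : Continuous W) {e : P.Pt} (hWe : ∀ (z : P.Pt) (t : ℝ), W (z + t • e) = W z) :
    eLpNorm (fun z => W z * (φ (z + e) - φ z)) 2 volume ≤
      eLpNorm (fun z => W z * fderiv ℝ φ z e) 2 volume := by
  set a : P.Pt → ℝ≥0∞ := fun z => ‖W z * fderiv ℝ φ z e‖ₑ with ha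
  have hcont : Continuous fun z => fderiv ℝ φ z e :=
    (hφ.continuous_fderiv (by simp)).clm_apply continuous_const
  have ham : Measurable a := (hW.mul hcont).measurable.enorm
  have hm1 : ∀ z, Measurable fun t : ℝ => a (z + t • e) := fun z => ham.comp (by fun_prop)
  have hpt : ∀ z, ‖W z * (φ (z + e) - φ z)‖ₑ ^ (2 : ℝ) ≤
      ∫⁻ t in Icc (0 : ℝ) 1, a (z + t • e) ^ (2 : ℝ) := by
    intro z
    have hderiv : ∀ t : ℝ, HasDerivAt (fun t : ℝ => φ (z + t • e)) (fderiv ℝ φ (z + t • e) e) t := by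
      intro t
      have h1 : HasDerivAt (fun t : ℝ => z + t • e) e t := by
        simpa using ((hasDerivAt_id t).smul_const e).const_add z
      exact (hφ.differentiable one_ne_zero (z + t • e)).hasFDerivAt.comp_hasDerivAt t h1
    have hFTC : φ (z + e) - φ z = ∫ t in (0 : ℝ)..1, fderiv ℝ φ (z + t • e) e := by
      rw [intervalIntegral.integral_eq_sub_of_hasDerivAt (fun t _ => hderiv t)
        ((hcont.comp (by fun_prop)).intervalIntegrable _ _)]
      simp
    have h1 : ‖W z * (φ (z + e) - φ z)‖ₑ ≤ ∫⁻ t in Icc (0 : ℝ) 1, a (z + t • e) := by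
      rw [hFTC, intervalIntegral.integral_of_le zero_le_one, ← integral_const_mul]
      refine (enorm_integral_le_lintegral_enorm _).trans ?_
      refine (lintegral_mono_set Ioc_subset_Icc_self).trans (le_of_eq ?_)
      refine lintegral_congr fun t => ?_
      rw [ha]
      simp only [hWe]
    have h2 := ENNReal.lintegral_mul_le_Lp_mul_Lq (volume.restrict (Icc (0 : ℝ) 1))
      Real.HolderConjugate.two_two (f := fun t => a (z + t • e)) (g := fun _ => 1)
      (hm1 z).aemeasurable aemeasurable_const
    simp only [Pi.mul_apply, mul_one, ENNReal.one_rpow, lintegral_const,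
      Measure.restrict_apply_univ, Real.volume_Icc, sub_zero, ENNReal.ofReal_one] at h2
    calc ‖W z * (φ (z + e) - φ z)‖ₑ ^ (2 : ℝ)
        ≤ ((∫⁻ t in Icc (0 : ℝ) 1, a (z + t • e) ^ (2 : ℝ)) ^ (1 / (2 : ℝ))) ^ (2 : ℝ) := by
          gcongr
          exact h1.trans h2
      _ = _ := by
          rw [← ENNReal.rpow_mul]
          norm_num
  rw [eLpNorm_eq_lintegral_rpow_enorm_toReal (by simp) (by simp),
    eLpNorm_eq_lintegral_rpow_enorm_toReal (by simp) (by simp), ENNReal.toReal_ofNat]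
  gcongr ?_ ^ _
  calc ∫⁻ z, ‖W z * (φ (z + e) - φ z)‖ₑ ^ (2 : ℝ)
      ≤ ∫⁻ z, ∫⁻ t in Icc (0 : ℝ) 1, a (z + t • e) ^ (2 : ℝ) := lintegral_mono hpt
    _ = ∫⁻ t in Icc (0 : ℝ) 1, ∫⁻ z, a (z + t • e) ^ (2 : ℝ) := by
        rw [lintegral_lintegral_swap]
        exact ((ham.comp (by fun_prop)).pow_const _).aemeasurable
    _ = ∫⁻ t in Icc (0 : ℝ) 1, ∫⁻ z, a z ^ (2 : ℝ) := by
        refine lintegral_congr fun t => ?_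
        rw [lintegral_add_right_eq_self (fun z => a z ^ (2 : ℝ)) (t • e)]
    _ = _ := by simp [ha]

lemma abs_fderiv_fst_le (φ : P.Pt → ℝ) (z : P.Pt) (h : EuclideanSpace ℝ (Fin P.m)) :
    ‖fderiv ℝ φ z (h, 0)‖ ≤ P.m * ‖h‖ * ‖P.gradSmooth φ z‖ := by
  have e : ((h, 0) : P.Pt) = ∑ i, h i • ((EuclideanSpace.single i 1, 0) : P.Pt) := by
    ext k
    · simp [Prod.fst_sum, Pi.single_apply]
    · simp [Prod.snd_sum]
  rw [e, map_sum]
  calc _ ≤ ∑ _i : Fin P.m, ‖h‖ * ‖P.gradSmooth φ z‖ := by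
        refine norm_sum_le_of_le _ fun i _ => ?_
        rw [map_smul, norm_smul, ← P.gradSmooth_inl]
        exact mul_le_mul (PiLp.norm_apply_le h i) (PiLp.norm_apply_le _ _) (norm_nonneg _)
          (norm_nonneg _)
    _ = _ := by simp; ring

lemma abs_fderiv_snd_le (φ : P.Pt → ℝ) (z : P.Pt) (k : EuclideanSpace ℝ (Fin P.l)) :
    ‖‖z.1‖ ^ P.γ * fderiv ℝ φ z (0, k)‖ ≤ P.l * ‖k‖ * ‖P.gradSmooth φ z‖ := by
  have e : ((0, k) : P.Pt) = ∑ j, k j • ((0, EuclideanSpace.single j 1) : P.Pt) := by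
    ext i
    · simp [Prod.fst_sum]
    · simp [Prod.snd_sum, Pi.single_apply]
  rw [e, map_sum, Finset.mul_sum]
  calc _ ≤ ∑ _j : Fin P.l, ‖k‖ * ‖P.gradSmooth φ z‖ := by
        refine norm_sum_le_of_le _ fun j _ => ?_
        rw [map_smul, smul_eq_mul, mul_left_comm, norm_mul, ← P.gradSmooth_inr]
        exact mul_le_mul (PiLp.norm_apply_le k j) (PiLp.norm_apply_le _ _) (norm_nonneg _)
          (norm_nonneg _)
    _ = _ := by simp; ring

lemma ae_tendsto_translate {φ : ℕ → P.Pt → ℝ} {u : P.Pt → ℝ} (e : P.Pt)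
    (h : ∀ᵐ z, Tendsto (fun n => φ n z) atTop (𝓝 (u z))) :
    ∀ᵐ z, Tendsto (fun n => φ n (z + e)) atTop (𝓝 (u (z + e))) :=
  (measurePreserving_add_right volume e).quasiMeasurePreserving.ae h

/-- Translations in the `x` and `y` directions. -/
lemma exists_eLpNorm_translate_le : ∃ C : NNReal, ∀ u : P.D,
    (∀ h : EuclideanSpace ℝ (Fin P.m),
      eLpNorm (fun z => u (z + (h, 0)) - u z) 2 volume ≤ C * ‖h‖ₑ * ‖u‖ₑ) ∧
    ∀ k : EuclideanSpace ℝ (Fin P.l),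
      eLpNorm (fun z => ‖z.1‖ ^ P.γ * (u (z + (0, k)) - u z)) 2 volume ≤ C * ‖k‖ₑ * ‖u‖ₑ := by
  obtain ⟨C, hC⟩ := P.exists_eLpNorm_le_of_smooth
  have hWc : Continuous fun z : P.Pt => ‖z.1‖ ^ P.γ :=
    continuous_fst.norm.rpow_const fun _ => Or.inr P.γ_nonneg
  refine ⟨C * (P.m + P.l), fun u => ⟨fun h => ?_, fun k => ?_⟩⟩
  · refine (hC (fun φ z => φ (z + (h, 0)) - φ z) 2 (P.m * ‖h‖₊) (fun φ hφ hφc => ⟨?_, ?_⟩)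
      (fun φ u hφ => ?_) u).trans ?_
    · exact ((hφ.continuous.comp (by fun_prop)).sub hφ.continuous).aestronglyMeasurable
    · have h1 := P.eLpNorm_smul_translate_le (hφ.of_le (by exact_mod_cast le_top))
        (W := fun _ => 1) continuous_const (e := (h, 0)) (fun _ _ => rfl)
      simp only [one_mul] at h1
      refine h1.trans ?_
      refine (eLpNorm_le_mul_eLpNorm_of_ae_le_mul
        (ae_of_all _ fun z => P.abs_fderiv_fst_le φ z h) 2).trans (le_of_eq ?_)
      rw [ENNReal.ofReal_mul (by positivity), ofReal_norm]
      simp [enorm_eq_nnnorm]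
    · filter_upwards [hφ, P.ae_tendsto_translate (h, 0) hφ] with z h1 h2 using h2.sub h1
    · push_cast
      rw [enorm_eq_nnnorm h, ← mul_assoc (C : ℝ≥0∞)]
      gcongr ?_ * _ * _
      refine mul_le_mul_right ?_ _
      exact le_self_add (a := (P.m : ℝ≥0∞))
  · refine (hC (fun φ z => ‖z.1‖ ^ P.γ * (φ (z + (0, k)) - φ z)) 2 (P.l * ‖k‖₊)
      (fun φ hφ hφc => ⟨?_, ?_⟩) (fun φ u hφ => ?_) u).trans ?_
    · exact (hWc.mul ((hφ.continuous.comp (by fun_prop)).sub hφ.continuous)).aestronglyMeasurable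
    · have h1 := P.eLpNorm_smul_translate_le (hφ.of_le (by exact_mod_cast le_top))
        hWc (e := (0, k)) (fun z t => by simp)
      refine h1.trans ?_
      refine (eLpNorm_le_mul_eLpNorm_of_ae_le_mul
        (ae_of_all _ fun z => P.abs_fderiv_snd_le φ z k) 2).trans (le_of_eq ?_)
      rw [ENNReal.ofReal_mul (by positivity), ofReal_norm]
      simp [enorm_eq_nnnorm]
    · filter_upwards [hφ, P.ae_tendsto_translate (0, k) hφ] with z h1 h2
        using (h2.sub h1).const_mul _
    · push_cast
      rw [enorm_eq_nnnorm k, ← mul_assoc (C : ℝ≥0∞)]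
      gcongr ?_ * _ * _
      refine mul_le_mul_right ?_ _
      exact le_add_self (a := (P.l : ℝ≥0∞))

end Params

end Grushin

/-! ### Weak compactness and convergence in Lebesgue spaces -/

namespace Grushin

/-- Bounded sequences in a separable Hilbert space have weakly convergent subsequences. -/
lemma exists_weakly_convergent_subseq {X : Type*} [NormedAddCommGroup X] [InnerProductSpace ℝ X]
    [CompleteSpace X] [SecondCountableTopology X] {u : ℕ → X} {B : ℝ} (hB : ∀ n, ‖u n‖ ≤ B) :
    ∃ (x : X) (s : ℕ → ℕ), StrictMono s ∧
      ∀ l : X →L[ℝ] ℝ, Tendsto (fun n => l (u (s n) - x)) atTop (𝓝 0) := by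
  have hc := WeakDual.isSeqCompact_closedBall ℝ X 0 B
  obtain ⟨a, -, s, hs, ha⟩ := hc (x := fun n => StrongDual.toWeakDual
    (InnerProductSpace.toDual ℝ X (u n))) (fun n => by
      rw [mem_preimage, mem_closedBall_zero_iff]
      exact ((InnerProductSpace.toDual ℝ X).norm_map (u n)).trans_le (hB n))
  refine ⟨(InnerProductSpace.toDual ℝ X).symm (WeakDual.toStrongDual a), s, hs, fun l => ?_⟩
  set y := (InnerProductSpace.toDual ℝ X).symm l with hy
  have hl : ∀ w, l w = inner ℝ w y := fun w => by
    rw [real_inner_comm, hy, InnerProductSpace.toDual_symm_apply]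
  have h1 := ((WeakDual.eval_continuous y).tendsto a).comp ha
  have h2 : Tendsto (fun n => inner ℝ (u (s n)) y) atTop (𝓝 (WeakDual.toStrongDual a y)) := h1
  have h3 := h2.sub_const (WeakDual.toStrongDual a y)
  rw [sub_self] at h3
  refine h3.congr fun n => ?_
  rw [hl, inner_sub_left, InnerProductSpace.toDual_symm_apply]

lemma setLIntegral_enorm_le {α : Type*} [MeasurableSpace α] {μ : Measure α} {f : α → ℝ} {p : ℝ}
    (hp : 1 ≤ p) (hf : AEStronglyMeasurable f μ) (S : Set α) :
    ∫⁻ z in S, ‖f z‖ₑ ∂μ ≤ eLpNorm f (ENNReal.ofReal p) μ * μ S ^ (1 - 1 / p) := by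
  have h := eLpNorm_le_eLpNorm_mul_rpow_measure_univ (p := 1) (q := ENNReal.ofReal p)
    (ENNReal.one_le_ofReal.2 hp) (hf.restrict (s := S))
  rw [eLpNorm_one_eq_lintegral_enorm, ENNReal.toReal_one, one_div_one,
    ENNReal.toReal_ofReal (by linarith), Measure.restrict_apply_univ] at h
  refine h.trans ?_
  gcongr
  exact Measure.restrict_le_self

namespace Params

variable (P : Params)

/-- The strips decrease to `{x = 0}`, a null set because `m ≥ 1`. Near this set the weighted bound
on `y`-translations degenerates, and small volume has to replace it. -/
lemma tendsto_volume_strip (R : ℝ) : Tendsto (fun n : ℕ => volume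
    (Metric.closedBall (0 : P.Pt) R ∩ {z | ‖z.1‖ ≤ ((n : ℝ) + 1)⁻¹})) atTop (𝓝 0) := by
  have hcl : ∀ n : ℕ, IsClosed {z : P.Pt | ‖z.1‖ ≤ ((n : ℝ) + 1)⁻¹} := fun n =>
    isClosed_le (by fun_prop) continuous_const
  have h := tendsto_measure_iInter_atTop (μ := (volume : Measure P.Pt))
    (s := fun n : ℕ => Metric.closedBall (0 : P.Pt) R ∩ {z | ‖z.1‖ ≤ ((n : ℝ) + 1)⁻¹})
    (fun n => (Metric.isClosed_closedBall.inter (hcl n)).measurableSet.nullMeasurableSet)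
    (fun m n hmn z hz => ⟨hz.1, le_trans (b := ((n : ℝ) + 1)⁻¹) hz.2
      (inv_anti₀ (by positivity) (by gcongr))⟩)
    ⟨0, ((measure_mono inter_subset_left).trans_lt
      (isCompact_closedBall (0 : P.Pt) R).measure_lt_top).ne⟩
  have h0 : volume (⋂ n : ℕ, Metric.closedBall (0 : P.Pt) R ∩
      {z | ‖z.1‖ ≤ ((n : ℝ) + 1)⁻¹}) = 0 := by
    refine measure_mono_null (t := ({0} : Set (EuclideanSpace ℝ (Fin P.m))) ×ˢ univ) ?_ ?_
    · intro z hz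
      rw [mem_iInter] at hz
      have : ‖z.1‖ ≤ 0 := ge_of_tendsto'
        (tendsto_one_div_add_atTop_nhds_zero_nat (𝕜 := ℝ)) fun n => by
          rw [one_div]; exact (hz n).2
      simpa using this
    · have : Nonempty (Fin P.m) := ⟨⟨0, P.one_le_m⟩⟩
      rw [Measure.volume_eq_prod, Measure.prod_prod]
      simp
  rwa [h0] at h

/-- Translations are continuous in `L¹` of a ball, uniformly on bounded sets of `D_γ`. -/
lemma exists_lintegral_translate_le (B : ℝ) (R : ℝ) {η : ℝ≥0∞} (hη : 0 < η) :
    ∃ r : ℝ, 0 < r ∧ ∀ h : P.Pt, ‖h‖ ≤ r → ∀ w : P.D, ‖w‖ ≤ B →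
      ∫⁻ z in Metric.closedBall 0 R, ‖w (z + h) - w z‖ₑ ≤ η := by
  obtain ⟨C₁, hC₁⟩ := P.exists_eLpNorm_translate_le
  obtain ⟨C₂, hC₂⟩ := P.exists_eLpNorm_le_norm
  have hp2 := P.two_lt_critExp
  set K := Metric.closedBall (0 : P.Pt) R with hK
  have hKt : volume K ≠ ⊤ := (isCompact_closedBall (0 : P.Pt) R).measure_lt_top.ne
  set V : ℝ≥0∞ := volume K ^ (1 - 1 / (2 : ℝ)) with hV
  have hVt : V ≠ ⊤ := ENNReal.rpow_ne_top_of_nonneg (by norm_num) hKt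
  set β : ℝ≥0∞ := ENNReal.ofReal B with hβ
  set σ : ℝ := 1 - 1 / P.critExp with hσ
  have hσ0 : 0 < σ := by
    rw [hσ, sub_pos, div_lt_one (by linarith)]; linarith
  -- the strip around `{x = 0}`
  obtain ⟨n, hn⟩ : ∃ n : ℕ, 2 * (C₂ * β) *
      volume (K ∩ {z : P.Pt | ‖z.1‖ ≤ ((n : ℝ) + 1)⁻¹}) ^ σ < η / 2 := by
    have h1 := ((ENNReal.continuous_rpow_const (y := σ)).tendsto 0).comp (P.tendsto_volume_strip R)
    rw [ENNReal.zero_rpow_of_pos hσ0] at h1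
    have h2 := ENNReal.Tendsto.const_mul (a := 2 * (C₂ * β)) h1
      (Or.inr (by rw [hβ]; finiteness))
    rw [mul_zero] at h2
    exact (h2.eventually_lt_const (ENNReal.half_pos hη.ne')).exists
  set ρ : ℝ := ((n : ℝ) + 1)⁻¹ with hρ
  have hρ0 : 0 < ρ := by positivity
  set S : Set P.Pt := {z | ‖z.1‖ ≤ ρ} with hS
  have hSm : MeasurableSet S := (isClosed_le (by fun_prop) continuous_const).measurableSet
  -- Removing the weight off the strip costs `ρ ^ (-γ)`. The width `ρ` is already fixed, so `r` can
  -- be chosen afterwards to compensate.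
  set A : ℝ≥0∞ := C₁ * β * V + ENNReal.ofReal (ρ ^ (-P.γ)) * (C₁ * β * V) with hA
  have hAt : A ≠ ⊤ := by rw [hA, hβ]; finiteness
  obtain ⟨r, hr0, hr⟩ : ∃ r : ℝ, 0 < r ∧ A * ENNReal.ofReal r < η / 2 := by
    have h1 : Tendsto (fun r : ℝ => A * ENNReal.ofReal r) (𝓝[>] 0) (𝓝 (A * ENNReal.ofReal 0)) :=
      ENNReal.Tendsto.const_mul ((ENNReal.continuous_ofReal.tendsto 0).mono_left
        nhdsWithin_le_nhds) (Or.inr hAt)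
    rw [ENNReal.ofReal_zero, mul_zero] at h1
    obtain ⟨r, h2, h3⟩ := ((h1.eventually_lt_const (ENNReal.half_pos hη.ne')).and
      self_mem_nhdsWithin).exists
    exact ⟨r, h3, h2⟩
  refine ⟨r, hr0, fun h hh w hw => ?_⟩
  have hwm : Measurable fun z => w z := (Lp.stronglyMeasurable (D.toLp w)).measurable
  have hwβ : ‖w‖ₑ ≤ β := by rw [← ofReal_norm]; exact ENNReal.ofReal_le_ofReal hw
  have hh1 : ‖h.1‖ₑ ≤ ENNReal.ofReal r := by
    rw [← ofReal_norm]; exact ENNReal.ofReal_le_ofReal ((norm_fst_le h).trans hh)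
  have hh2 : ‖h.2‖ₑ ≤ ENNReal.ofReal r := by
    rw [← ofReal_norm]; exact ENNReal.ofReal_le_ofReal ((norm_snd_le h).trans hh)
  have e2 : ENNReal.ofReal (2 : ℝ) = 2 := by simp
  -- The shift by `h` is a `y`-shift followed by an `x`-shift: the difference is `f₁ (z + (0, h.2))
  -- + f₂ z`.
  set f₁ : P.Pt → ℝ := fun z => w (z + (h.1, 0)) - w z with hf₁
  set f₂ : P.Pt → ℝ := fun z => w (z + (0, h.2)) - w z with hf₂
  have hf₁m : Measurable f₁ := by fun_prop
  have hf₂m : Measurable f₂ := by fun_prop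
  have b1 : ∫⁻ z in K, ‖f₁ (z + (0, h.2))‖ₑ ≤ C₁ * β * V * ENNReal.ofReal r := by
    refine (setLIntegral_enorm_le (p := 2) (by norm_num)
      (hf₁m.comp (measurable_add_const _)).aestronglyMeasurable K).trans ?_
    rw [e2]
    have h1 := eLpNorm_comp_measurePreserving (p := 2) hf₁m.aestronglyMeasurable
      (measurePreserving_add_right (volume : Measure P.Pt) ((0, h.2) : P.Pt))
    rw [h1]
    calc _ ≤ C₁ * ENNReal.ofReal r * β * V := by
          gcongr
          refine ((hC₁ w).1 h.1).trans ?_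
          gcongr
      _ = _ := by ring
  have b2 : ∫⁻ z in K \ S, ‖f₂ z‖ₑ ≤
      ENNReal.ofReal (ρ ^ (-P.γ)) * (C₁ * β * V) * ENNReal.ofReal r := by
    calc ∫⁻ z in K \ S, ‖f₂ z‖ₑ
        ≤ ∫⁻ z in K \ S, ENNReal.ofReal (ρ ^ (-P.γ)) * ‖‖z.1‖ ^ P.γ * f₂ z‖ₑ := by
          refine setLIntegral_mono' (measurableSet_closedBall.diff hSm) fun z hz => ?_
          have hz1 : ρ ≤ ‖z.1‖ := (not_le.1 hz.2).le
          rw [enorm_mul, ← mul_assoc]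
          conv_lhs => rw [← one_mul ‖f₂ z‖ₑ]
          gcongr
          rw [← ofReal_norm (‖z.1‖ ^ P.γ), ← ENNReal.ofReal_mul (by positivity),
            Real.norm_of_nonneg (by positivity), ENNReal.one_le_ofReal, Real.rpow_neg hρ0.le,
            ← div_eq_inv_mul, one_le_div (by positivity)]
          exact Real.rpow_le_rpow hρ0.le hz1 P.γ_nonneg
      _ ≤ ENNReal.ofReal (ρ ^ (-P.γ)) * ∫⁻ z in K, ‖‖z.1‖ ^ P.γ * f₂ z‖ₑ := by
          rw [lintegral_const_mul _ (by fun_prop)]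
          gcongr
          exact sdiff_subset
      _ ≤ ENNReal.ofReal (ρ ^ (-P.γ)) * (C₁ * ENNReal.ofReal r * β * V) := by
          gcongr
          refine (setLIntegral_enorm_le (p := 2) (by norm_num)
            (Measurable.aestronglyMeasurable (by fun_prop)) K).trans ?_
          rw [e2]
          gcongr
          refine ((hC₁ w).2 h.2).trans ?_
          gcongr
      _ = _ := by ring
  -- On the strip no derivative is used: both translates are bounded in `L^{2*}`, and Hölder's
  -- inequality brings in the small volume.
  have b3 : ∫⁻ z in K ∩ S, ‖f₂ z‖ₑ ≤ 2 * (C₂ * β) * volume (K ∩ S) ^ σ := by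
    refine (setLIntegral_enorm_le (p := P.critExp) (by linarith)
      hf₂m.aestronglyMeasurable (K ∩ S)).trans ?_
    gcongr
    have h1 := eLpNorm_comp_measurePreserving (p := ENNReal.ofReal P.critExp)
      hwm.aestronglyMeasurable
      (measurePreserving_add_right (volume : Measure P.Pt) ((0, h.2) : P.Pt))
    have h2 := eLpNorm_sub_le (p := ENNReal.ofReal P.critExp) (μ := (volume : Measure P.Pt))
      (hwm.comp (measurable_add_const ((0, h.2) : P.Pt))).aestronglyMeasurable
      hwm.aestronglyMeasurable Fact.out
    refine h2.trans ?_
    have h3 : eLpNorm w (ENNReal.ofReal P.critExp) volume ≤ C₂ * β :=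
      (hC₂ w).trans (by gcongr)
    rw [show (fun z => w z) ∘ (fun z => z + ((0, h.2) : P.Pt)) =
      (fun z => w z) ∘ (· + ((0, h.2) : P.Pt)) from rfl, h1, two_mul]
    exact add_le_add h3 h3
  calc ∫⁻ z in K, ‖w (z + h) - w z‖ₑ
      ≤ ∫⁻ z in K, (‖f₁ (z + (0, h.2))‖ₑ + ‖f₂ z‖ₑ) := by
        refine lintegral_mono fun z => ?_
        have e : w (z + h) - w z = f₁ (z + (0, h.2)) + f₂ z := by
          have : z + (0, h.2) + (h.1, 0) = z + h := by ext <;> simp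
          simp only [hf₁, hf₂, this]; ring
        rw [e]
        exact enorm_add_le _ _
    _ = (∫⁻ z in K, ‖f₁ (z + (0, h.2))‖ₑ) +
        ((∫⁻ z in K ∩ S, ‖f₂ z‖ₑ) + ∫⁻ z in K \ S, ‖f₂ z‖ₑ) := by
        rw [lintegral_add_left (show Measurable fun z => ‖f₁ (z + (0, h.2))‖ₑ by fun_prop),
          lintegral_inter_add_sdiff _ K hSm]
    _ ≤ C₁ * β * V * ENNReal.ofReal r + (2 * (C₂ * β) * volume (K ∩ S) ^ σ +
        ENNReal.ofReal (ρ ^ (-P.γ)) * (C₁ * β * V) * ENNReal.ofReal r) := by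
        gcongr
    _ = A * ENNReal.ofReal r + 2 * (C₂ * β) * volume (K ∩ S) ^ σ := by rw [hA]; ring
    _ ≤ η / 2 + η / 2 := by gcongr
    _ = η := ENNReal.add_halves η

/-- Integrals over a set of finite measure are continuous linear functionals on `D_γ`. -/
lemma exists_integralFunctional {S : Set P.Pt} (hS : volume S ≠ ⊤) :
    ∃ l : P.D →L[ℝ] ℝ, ∀ u : P.D, l u = ∫ z in S, u z := by
  obtain ⟨C, hC⟩ := P.exists_eLpNorm_le_norm
  have hp2 := P.two_lt_critExp
  set σ : ℝ := 1 - 1 / P.critExp with hσ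
  have hσ0 : 0 ≤ σ := by
    rw [hσ, sub_nonneg, div_le_one (by linarith)]; linarith
  have hle : ∀ u : P.D, ∫⁻ z in S, ‖u z‖ₑ ≤ C * ‖u‖ₑ * volume S ^ σ := fun u =>
    (setLIntegral_enorm_le (p := P.critExp) (by linarith) (Lp.aestronglyMeasurable (D.toLp u)) S).trans
      (by gcongr; exact hC u)
  have hSσ : volume S ^ σ ≠ ⊤ := ENNReal.rpow_ne_top_of_nonneg hσ0 hS
  have hint : ∀ u : P.D, IntegrableOn u S volume := fun u =>
    ⟨(Lp.aestronglyMeasurable (D.toLp u)).restrict, (hle u).trans_lt (by finiteness)⟩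
  let l : P.D →ₗ[ℝ] ℝ :=
    { toFun := fun u => ∫ z in S, u z
      map_add' := fun u w => by
        rw [← integral_add (hint u) (hint w)]
        refine integral_congr_ae (ae_restrict_of_ae ?_)
        rw [map_add]
        exact Lp.coeFn_add _ _
      map_smul' := fun c u => by
        rw [RingHom.id_apply, smul_eq_mul, ← integral_const_mul]
        refine integral_congr_ae (ae_restrict_of_ae ?_)
        rw [map_smul]
        filter_upwards [Lp.coeFn_smul c (D.toLp u)] with z hz
        simp [hz] }
  refine ⟨l.mkContinuous (C * (volume S ^ σ).toReal) fun u => ?_, fun u => rfl⟩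
  have h1 : ‖∫ z in S, u z‖ₑ ≤ C * ‖u‖ₑ * volume S ^ σ :=
    (enorm_integral_le_lintegral_enorm _).trans (hle u)
  have h2 := ENNReal.toReal_mono (by finiteness) h1
  rw [toReal_enorm, ENNReal.toReal_mul, ENNReal.toReal_mul, toReal_enorm] at h2
  refine h2.trans (le_of_eq ?_)
  rw [ENNReal.coe_toReal]
  ring

/-- Weakly null bounded sequences in `D_γ` converge to `0` in `L¹` of balls. -/
lemma tendsto_setLIntegral_of_weakly_null {w : ℕ → P.D} {B : ℝ} (hB : ∀ n, ‖w n‖ ≤ B)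
    (hw : ∀ l : P.D →L[ℝ] ℝ, Tendsto (fun n => l (w n)) atTop (𝓝 0)) (R : ℝ) :
    Tendsto (fun n => ∫⁻ z in Metric.closedBall 0 R, ‖w n z‖ₑ) atTop (𝓝 0) := by
  obtain ⟨C, hC⟩ := P.exists_eLpNorm_le_norm
  have hp2 := P.two_lt_critExp
  set σ : ℝ := 1 - 1 / P.critExp with hσ
  have hσ0 : 0 ≤ σ := by
    rw [hσ, sub_nonneg, div_le_one (by linarith)]; linarith
  set K := Metric.closedBall (0 : P.Pt) R with hK
  have hKt : volume K ≠ ⊤ := (isCompact_closedBall (0 : P.Pt) R).measure_lt_top.ne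
  have hwm : ∀ n, Measurable fun z => w n z :=
    fun n => (Lp.stronglyMeasurable (D.toLp (w n))).measurable
  refine ENNReal.tendsto_nhds_zero.2 fun η hη => ?_
  by_cases hηt : η = ⊤
  · exact Eventually.of_forall fun n => hηt ▸ le_top
  obtain ⟨r, hr0, hr⟩ := P.exists_lintegral_translate_le B R (ENNReal.half_pos hη.ne')
  set U := Metric.ball (0 : P.Pt) r with hU
  have hU0 : volume U ≠ 0 := (Metric.measure_ball_pos volume 0 hr0).ne'
  have hUt : volume U ≠ ⊤ := measure_ball_lt_top.ne
  -- the averages tend to zero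
  have hcoe : ∀ (n : ℕ) (z : P.Pt), ∫ h in U, w n (z + h) = ∫ y in Metric.ball z r, w n y := by
    intro n z
    rw [← integral_indicator measurableSet_ball, ← integral_indicator measurableSet_ball,
      ← integral_add_left_eq_self ((Metric.ball z r).indicator fun y => w n y) z]
    congr 1
    ext h
    simp only [indicator, Metric.mem_ball, dist_zero_right, dist_self_add_left]
  have hle : ∀ (n : ℕ) (z : P.Pt), ‖∫ h in U, w n (z + h)‖ₑ ≤
      C * ENNReal.ofReal B * volume U ^ σ := by
    intro n z
    rw [hcoe]
    refine (enorm_integral_le_lintegral_enorm _).trans ?_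
    refine (setLIntegral_enorm_le (p := P.critExp) (by linarith)
      (Lp.aestronglyMeasurable (D.toLp (w n))) _).trans ?_
    have h1 : volume (Metric.ball z r) = volume U := Measure.addHaar_ball_center _ _ _
    rw [h1]
    gcongr
    refine (hC (w n)).trans ?_
    gcongr
    rw [← ofReal_norm]
    exact ENNReal.ofReal_le_ofReal (hB n)
  -- For fixed `z` the inner integral is a continuous linear functional of `w n`, so it tends to
  -- zero by weak convergence. The bound `hle`, uniform in `n` and `z`, allows dominated convergence
  -- on `K`.
  have hav : Tendsto (fun n => ∫⁻ z in K, ‖∫ h in U, w n (z + h)‖ₑ) atTop (𝓝 0) := by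
    have h := tendsto_lintegral_of_dominated_convergence (μ := volume.restrict K)
      (F := fun n z => ‖∫ h in U, w n (z + h)‖ₑ) (f := fun _ => 0)
      (fun _ => C * ENNReal.ofReal B * volume U ^ σ) (fun n => ?_)
      (fun n => ae_of_all _ (hle n)) ?_ (ae_of_all _ fun z => ?_)
    · simpa using h
    · have h1 : StronglyMeasurable (Function.uncurry fun z h : P.Pt => w n (z + h)) :=
        ((hwm n).comp (measurable_fst.add measurable_snd)).stronglyMeasurable
      exact h1.integral_prod_right.measurable.enorm
    · rw [lintegral_const, Measure.restrict_apply_univ]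
      have := ENNReal.rpow_ne_top_of_nonneg hσ0 hUt
      finiteness
    · obtain ⟨l, hl⟩ := P.exists_integralFunctional
        (measure_ball_lt_top (μ := (volume : Measure P.Pt)) (x := z) (r := r)).ne
      have h1 := (hw l).enorm
      rw [enorm_zero] at h1
      refine h1.congr fun n => ?_
      rw [hl, hcoe]
  have hev : ∀ᶠ n in atTop, ∫⁻ z in K, ‖∫ h in U, w n (z + h)‖ₑ < volume U * (η / 2) := by
    refine hav.eventually_lt_const ?_
    exact pos_iff_ne_zero.2 (mul_ne_zero hU0 (ENNReal.half_pos hη.ne').ne')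
  filter_upwards [hev] with n hn
  -- Compare `w n z` with its mean over the ball of radius `r` around `z`. After Fubini the error is
  -- the translation modulus, small for all `n` at once.
  have hpt : ∀ z, volume U * ‖w n z‖ₑ ≤
      (∫⁻ h in U, ‖w n (z + h) - w n z‖ₑ) + ‖∫ h in U, w n (z + h)‖ₑ := by
    intro z
    have hint : IntegrableOn (fun h => w n (z + h)) U volume := by
      have h2 := setLIntegral_enorm_le (p := P.critExp) (by linarith)
        ((hwm n).comp (measurable_const_add z)).aestronglyMeasurable U (μ := volume)
      refine ⟨((hwm n).comp (measurable_const_add z)).aestronglyMeasurable, h2.trans_lt ?_⟩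
      have h3 := eLpNorm_comp_measurePreserving (p := ENNReal.ofReal P.critExp)
        (hwm n).aestronglyMeasurable (measurePreserving_add_left (volume : Measure P.Pt) z)
      have h4 : eLpNorm ((fun z => w n z) ∘ fun h => z + h) (ENNReal.ofReal P.critExp) volume
          < ⊤ := h3.trans_lt (Lp.eLpNorm_lt_top (D.toLp (w n)))
      exact ENNReal.mul_lt_top h4 (ENNReal.rpow_lt_top_of_nonneg hσ0 hUt)
    have h1 : volume U * ‖w n z‖ₑ = ‖∫ _ in U, w n z‖ₑ := by
      rw [setIntegral_const, enorm_smul, ← ofReal_norm (volume.real U), Real.norm_of_nonneg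
        measureReal_nonneg, ofReal_measureReal hUt]
    have h2 : ∫ _ in U, w n z =
        (∫ h in U, w n (z + h)) - ∫ h in U, (w n (z + h) - w n z) := by
      rw [integral_sub hint (integrableOn_const hUt)]
      ring
    rw [h1, h2, add_comm]
    refine (enorm_sub_le).trans ?_
    gcongr
    exact enorm_integral_le_lintegral_enorm _
  have hjoint : Measurable fun q : P.Pt × P.Pt => ‖w n (q.1 + q.2) - w n q.1‖ₑ := by
    have := hwm n
    fun_prop
  have h1 : volume U * ∫⁻ z in K, ‖w n z‖ₑ ≤ volume U * η := by
    calc volume U * ∫⁻ z in K, ‖w n z‖ₑ = ∫⁻ z in K, volume U * ‖w n z‖ₑ :=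
          (lintegral_const_mul _ (hwm n).enorm).symm
      _ ≤ ∫⁻ z in K, ((∫⁻ h in U, ‖w n (z + h) - w n z‖ₑ) + ‖∫ h in U, w n (z + h)‖ₑ) :=
          lintegral_mono hpt
      _ = (∫⁻ z in K, ∫⁻ h in U, ‖w n (z + h) - w n z‖ₑ) +
            ∫⁻ z in K, ‖∫ h in U, w n (z + h)‖ₑ :=
          lintegral_add_left hjoint.lintegral_prod_right' _
      _ = (∫⁻ h in U, ∫⁻ z in K, ‖w n (z + h) - w n z‖ₑ) +
            ∫⁻ z in K, ‖∫ h in U, w n (z + h)‖ₑ := by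
          rw [lintegral_lintegral_swap]
          exact hjoint.aemeasurable
      _ ≤ (∫⁻ _ in U, η / 2) + volume U * (η / 2) := by
          refine add_le_add (setLIntegral_mono' measurableSet_ball fun h hh => ?_) hn.le
          exact hr h (mem_ball_zero_iff.1 hh).le (w n) (hB n)
      _ = volume U * η := by
          rw [setLIntegral_const, mul_comm (η / 2), ← mul_add, ENNReal.add_halves]
  exact (ENNReal.mul_le_mul_iff_right hU0 hUt).1 h1

/-- Weakly null bounded sequences in `D_γ` converge to `0` in `L^α` of any finite measure with
bounded density. -/
lemma tendsto_eLpNorm_of_weakly_null {ν : Measure P.Pt} [IsFiniteMeasure ν] {M : ℝ≥0∞}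
    (hM : M ≠ ⊤) (hν : ν ≤ M • volume) {α : ℝ} (hα : 1 ≤ α) (hα' : α < P.critExp)
    {w : ℕ → P.D} {B : ℝ} (hB : ∀ n, ‖w n‖ ≤ B)
    (hw : ∀ l : P.D →L[ℝ] ℝ, Tendsto (fun n => l (w n)) atTop (𝓝 0)) :
    Tendsto (fun n => eLpNorm (w n) (ENNReal.ofReal α) ν) atTop (𝓝 0) := by
  obtain ⟨C, hC⟩ := P.exists_eLpNorm_le_norm
  have hp2 := P.two_lt_critExp
  have hac : ν ≪ volume := Measure.absolutelyContinuous_of_le_smul hν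
  have hwm : ∀ n, Measurable fun z => w n z :=
    fun n => (Lp.stronglyMeasurable (D.toLp (w n))).measurable
  set σ : ℝ := 1 - 1 / P.critExp with hσ
  have hσ0 : 0 < σ := by
    rw [hσ, sub_pos, div_lt_one (by linarith)]; linarith
  obtain ⟨A, hAt, hA⟩ : ∃ A : ℝ≥0∞, A ≠ ⊤ ∧
      ∀ n, eLpNorm (w n) (ENNReal.ofReal P.critExp) ν ≤ A := by
    refine ⟨M ^ (1 / ENNReal.ofReal P.critExp).toReal * (C * ENNReal.ofReal B), ?_, fun n => ?_⟩
    · have := ENNReal.rpow_ne_top_of_nonneg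
        (ENNReal.toReal_nonneg (a := 1 / ENNReal.ofReal P.critExp)) hM
      finiteness
    · refine (eLpNorm_mono_measure _ hν).trans ?_
      rw [eLpNorm_smul_measure_of_ne_top (by simp), smul_eq_mul]
      gcongr
      refine (hC (w n)).trans ?_
      gcongr
      rw [← ofReal_norm]
      exact ENNReal.ofReal_le_ofReal (hB n)
  -- convergence in `L¹(ν)`
  have hL1 : Tendsto (fun n => ∫⁻ z, ‖w n z‖ₑ ∂ν) atTop (𝓝 0) := by
    refine ENNReal.tendsto_nhds_zero.2 fun η hη => ?_
    -- The finiteness of `ν` prevents loss of mass at infinity: the `L^{2*}(ν)` bound and Hölder's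
    -- inequality make the exterior contribution small uniformly in `n`.
    obtain ⟨k, hk⟩ : ∃ k : ℕ, A * ν (Metric.closedBall 0 k)ᶜ ^ σ < η / 2 := by
      have h0 : Tendsto (fun k : ℕ => ν (Metric.closedBall (0 : P.Pt) k)ᶜ) atTop (𝓝 0) := by
        have h := tendsto_measure_iInter_atTop (μ := ν)
          (s := fun k : ℕ => (Metric.closedBall (0 : P.Pt) k)ᶜ)
          (fun k => measurableSet_closedBall.compl.nullMeasurableSet)
          (fun j k hjk => compl_subset_compl.2 (Metric.closedBall_subset_closedBall
            (by exact_mod_cast hjk))) ⟨0, measure_ne_top _ _⟩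
        rwa [← compl_iUnion, Metric.iUnion_closedBall_nat, compl_univ, measure_empty] at h
      have h1 := ((ENNReal.continuous_rpow_const (y := σ)).tendsto 0).comp h0
      rw [ENNReal.zero_rpow_of_pos hσ0] at h1
      have h2 := ENNReal.Tendsto.const_mul (a := A) h1 (Or.inr hAt)
      rw [mul_zero] at h2
      exact (h2.eventually_lt_const (ENNReal.half_pos hη.ne')).exists
    have h3 : Tendsto (fun n => M * ∫⁻ z in Metric.closedBall 0 (k : ℝ), ‖w n z‖ₑ) atTop
        (𝓝 0) := by
      have := ENNReal.Tendsto.const_mul (a := M)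
        (P.tendsto_setLIntegral_of_weakly_null hB hw k) (Or.inr hM)
      rwa [mul_zero] at this
    filter_upwards [h3.eventually_lt_const (ENNReal.half_pos hη.ne')] with n hn
    rw [← lintegral_add_compl _ (measurableSet_closedBall (x := (0 : P.Pt)) (ε := (k : ℝ))),
      ← ENNReal.add_halves η]
    refine add_le_add ?_ ?_
    · refine le_trans ?_ hn.le
      refine (lintegral_mono' (Measure.restrict_mono le_rfl hν) le_rfl).trans (le_of_eq ?_)
      rw [Measure.restrict_smul, lintegral_smul_measure, smul_eq_mul]
    · refine le_trans ?_ hk.le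
      refine (setLIntegral_enorm_le (p := P.critExp) (by linarith)
        (hwm n).aestronglyMeasurable _).trans ?_
      gcongr
      exact hA n
  -- interpolation between `L¹` and `L^{2*}`
  set t : ℝ := (α - 1) / (P.critExp - 1) with ht
  have ht0 : 0 ≤ t := div_nonneg (by linarith) (by linarith)
  have ht1 : t < 1 := by rw [ht, div_lt_one (by linarith)]; linarith
  have hαt : (1 - t) + P.critExp * t = α := by
    have : P.critExp - 1 ≠ 0 := by linarith
    rw [ht]; field_simp; ring
  have hp0 : ENNReal.ofReal P.critExp ≠ 0 := by
    rw [Ne, ENNReal.ofReal_eq_zero]; linarith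
  have hα0 : ENNReal.ofReal α ≠ 0 := by
    rw [Ne, ENNReal.ofReal_eq_zero]; linarith
  have hb : ∀ n, ∫⁻ z, ‖w n z‖ₑ ^ α ∂ν ≤
      (∫⁻ z, ‖w n z‖ₑ ∂ν) ^ (1 - t) * (A ^ P.critExp) ^ t := by
    intro n
    have h1 := ENNReal.lintegral_mul_norm_pow_le (μ := ν) (f := fun z => ‖w n z‖ₑ)
      (g := fun z => ‖w n z‖ₑ ^ P.critExp) (hwm n).enorm.aemeasurable
      ((hwm n).enorm.pow_const _).aemeasurable (p := 1 - t) (q := t) (by linarith) ht0 (by ring)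
    calc ∫⁻ z, ‖w n z‖ₑ ^ α ∂ν = ∫⁻ z, ‖w n z‖ₑ ^ (1 - t) * (‖w n z‖ₑ ^ P.critExp) ^ t ∂ν := by
          refine lintegral_congr fun z => ?_
          rw [← ENNReal.rpow_mul, ← ENNReal.rpow_add_of_nonneg _ _ (by linarith)
            (mul_nonneg (by linarith) ht0), hαt]
      _ ≤ _ := h1
      _ ≤ _ := by
          gcongr
          have h2 := hA n
          rw [eLpNorm_eq_lintegral_rpow_enorm_toReal hp0 (by simp),
            ENNReal.toReal_ofReal (by linarith)] at h2
          calc ∫⁻ z, ‖w n z‖ₑ ^ P.critExp ∂ν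
              = ((∫⁻ z, ‖w n z‖ₑ ^ P.critExp ∂ν) ^ (1 / P.critExp)) ^ P.critExp := by
                rw [← ENNReal.rpow_mul, one_div_mul_cancel (by linarith), ENNReal.rpow_one]
            _ ≤ _ := by gcongr
  have hz : Tendsto (fun n => (∫⁻ z, ‖w n z‖ₑ ∂ν) ^ (1 - t) * (A ^ P.critExp) ^ t) atTop
      (𝓝 0) := by
    have h1 := ((ENNReal.continuous_rpow_const (y := 1 - t)).tendsto 0).comp hL1
    rw [ENNReal.zero_rpow_of_pos (by linarith)] at h1
    have h2 := ENNReal.Tendsto.mul_const (b := (A ^ P.critExp) ^ t) h1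
      (Or.inr (ENNReal.rpow_ne_top_of_nonneg ht0 (ENNReal.rpow_ne_top_of_nonneg
        (by linarith) hAt)))
    rwa [zero_mul] at h2
  have h3 := tendsto_of_tendsto_of_tendsto_of_le_of_le tendsto_const_nhds hz
    (fun _ => bot_le) hb
  have h4 := ((ENNReal.continuous_rpow_const (y := 1 / α)).tendsto 0).comp h3
  rw [ENNReal.zero_rpow_of_pos (by positivity)] at h4
  refine h4.congr fun n => ?_
  rw [eLpNorm_eq_lintegral_rpow_enorm_toReal hα0 (by simp), ENNReal.toReal_ofReal (by linarith)]
  rfl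

end Params

end Grushin

namespace Grushin

/-! ### Nemytskii operators and differentiability of integral functionals -/

section Nemytskii

variable {Ω : Type*} [MeasurableSpace Ω] {ν : Measure Ω}

/-- Continuity at `0` of a Nemytskii operator `L^α → L^q` under the natural growth condition. -/
lemma tendsto_eLpNorm_nemytskii {α q C : ℝ} (hC : 0 ≤ C) (hαq : α.HolderConjugate q) {b : Ω → ℝ}
    (hb : MemLp b (ENNReal.ofReal q) ν) {D : Ω → ℝ → ℝ}
    (hD : ∀ z t, |D z t| ≤ b z + C * |t| ^ (α - 1)) (hD0 : ∀ z, Tendsto (D z) (𝓝 0) (𝓝 0))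
    {h : ℕ → Ω → ℝ} (hm : ∀ n, AEStronglyMeasurable (h n) ν)
    (hDm : ∀ n, AEStronglyMeasurable (fun z => D z (h n z)) ν)
    (hh : Tendsto (fun n => eLpNorm (h n) (ENNReal.ofReal α) ν) atTop (𝓝 0)) :
    Tendsto (fun n => eLpNorm (fun z => D z (h n z)) (ENNReal.ofReal q) ν) atTop (𝓝 0) := by
  have hα1 := hαq.lt
  have hq1 := hαq.symm.lt
  have hα0 : ENNReal.ofReal α ≠ 0 := by rw [Ne, ENNReal.ofReal_eq_zero]; linarith
  have hq0 : ENNReal.ofReal q ≠ 0 := by rw [Ne, ENNReal.ofReal_eq_zero]; linarith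
  have hb0 : ∀ z, 0 ≤ b z := fun z => by
    have := hD z 0
    rw [abs_zero, Real.zero_rpow (by linarith), mul_zero, add_zero] at this
    exact (abs_nonneg _).trans this
  -- It is enough to find, in every subsequence, a further one that works, so `h` may be assumed to
  -- tend to zero almost everywhere.
  refine tendsto_of_subseq_tendsto fun ns hns => ?_
  have h1 : Tendsto (fun n => eLpNorm (h (ns n)) (ENNReal.ofReal α) ν) atTop (𝓝 0) :=
    hh.comp hns
  obtain ⟨ms, hms, hae⟩ := (tendstoInMeasure_of_tendsto_eLpNorm (f := fun n => h (ns n))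
    (g := 0) hα0 (fun n => hm _) aestronglyMeasurable_zero
    (by simpa using h1)).exists_seq_tendsto_ae
  refine ⟨ms, ?_⟩
  set w : ℕ → Ω → ℝ := fun n => h (ns (ms n)) with hw
  -- The growth bound gives `|D| ≤ min |D| b + C |w| ^ (α - 1)`. The first term is dominated by `b`
  -- and tends to zero pointwise; the `L^q` norm of the second is a power of the `L^α` norm of `w`,
  -- because `q * (α - 1) = α`.
  have hcut : Tendsto (fun n => eLpNorm (fun z => min |D z (w n z)| (b z))
      (ENNReal.ofReal q) ν) atTop (𝓝 0) := by
    have h2 := tendsto_lintegral_of_dominated_convergence' (μ := ν)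
      (F := fun n z => ‖min |D z (w n z)| (b z)‖ₑ ^ q) (f := fun _ => 0)
      (fun z => ‖b z‖ₑ ^ q) (fun n => ?_) (fun n => ae_of_all _ fun z => ?_) ?_ ?_
    · rw [lintegral_zero] at h2
      have h3 := ((ENNReal.continuous_rpow_const (y := 1 / q)).tendsto 0).comp h2
      rw [ENNReal.zero_rpow_of_pos (by positivity)] at h3
      refine h3.congr fun n => ?_
      rw [eLpNorm_eq_lintegral_rpow_enorm_toReal hq0 (by simp), ENNReal.toReal_ofReal (by linarith)]
      rfl
    · exact ((((hDm (ns (ms n))).norm.inf hb.1).aemeasurable).enorm.pow_const _)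
    · refine ENNReal.rpow_le_rpow (enorm_le_iff_norm_le.2 ?_) (by linarith)
      rw [Real.norm_of_nonneg (le_min (abs_nonneg _) (hb0 z)), Real.norm_of_nonneg (hb0 z)]
      exact min_le_right _ _
    · have h3 := (eLpNorm_lt_top_iff_lintegral_rpow_enorm_lt_top hq0 (by simp)).1 hb.2
      rw [ENNReal.toReal_ofReal (by linarith)] at h3
      exact h3.ne
    · filter_upwards [hae] with z hz
      have h3 : Tendsto (fun n => min |D z (w n z)| (b z)) atTop (𝓝 (min |0| (b z))) :=
        (((hD0 z).comp hz).abs).min tendsto_const_nhds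
      rw [abs_zero, min_eq_left (hb0 z)] at h3
      have h4 := h3.enorm
      rw [enorm_zero] at h4
      have h5 := ((ENNReal.continuous_rpow_const (y := q)).tendsto 0).comp h4
      rw [ENNReal.zero_rpow_of_pos (by linarith)] at h5
      exact h5
  have hpow : Tendsto (fun n => ‖C‖ₑ * eLpNorm (w n) (ENNReal.ofReal α) ν ^ (α - 1)) atTop
      (𝓝 0) := by
    have h2 : Tendsto (fun n => eLpNorm (w n) (ENNReal.ofReal α) ν) atTop (𝓝 0) :=
      h1.comp hms.tendsto_atTop
    have h3 := ((ENNReal.continuous_rpow_const (y := α - 1)).tendsto 0).comp h2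
    rw [ENNReal.zero_rpow_of_pos (by linarith)] at h3
    have h4 := ENNReal.Tendsto.const_mul (a := ‖C‖ₑ) h3 (Or.inr enorm_ne_top)
    rwa [mul_zero] at h4
  have hsum := hcut.add hpow
  rw [add_zero] at hsum
  refine tendsto_of_tendsto_of_tendsto_of_le_of_le tendsto_const_nhds hsum
    (fun _ => bot_le) fun n => ?_
  have hqα : ENNReal.ofReal q * ENNReal.ofReal (α - 1) = ENNReal.ofReal α := by
    rw [← ENNReal.ofReal_mul (by linarith)]
    congr 1
    have := hαq.mul_eq_add
    linarith
  have h2 : eLpNorm (fun z => C * ‖w n z‖ ^ (α - 1)) (ENNReal.ofReal q) ν =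
      ‖C‖ₑ * eLpNorm (w n) (ENNReal.ofReal α) ν ^ (α - 1) := by
    have h3 := eLpNorm_const_smul C (fun z => ‖w n z‖ ^ (α - 1)) (ENNReal.ofReal q) ν
    rw [eLpNorm_norm_rpow _ (by linarith), hqα] at h3
    exact h3
  rw [← h2]
  refine (eLpNorm_mono_real fun z => ?_).trans (eLpNorm_add_le ((hDm (ns (ms n))).norm.inf hb.1)
    (((hm (ns (ms n))).norm.aemeasurable.pow_const _).const_mul C).aestronglyMeasurable
    (ENNReal.one_le_ofReal.2 hq1.le))
  have h4 := hD z (w n z)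
  have h5 := hb0 z
  change |D z (w n z)| ≤ min |D z (w n z)| (b z) + C * |w n z| ^ (α - 1)
  rcases le_total |D z (w n z)| (b z) with h6 | h6
  · rw [min_eq_left h6]
    have : 0 ≤ C * |w n z| ^ (α - 1) := by positivity
    linarith
  · rw [min_eq_right h6]
    exact h4

variable {k K : ℝ → ℝ} {α C : ℝ}

lemma add_rpow_le_two_rpow_mul {s t β : ℝ} (hs : 0 ≤ s) (ht : 0 ≤ t) (hβ : 0 ≤ β) :
    (s + t) ^ β ≤ 2 ^ β * (s ^ β + t ^ β) := by
  rcases le_total s t with h | h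
  · calc (s + t) ^ β ≤ (2 * t) ^ β := Real.rpow_le_rpow (by positivity) (by linarith) hβ
      _ = 2 ^ β * t ^ β := Real.mul_rpow (by norm_num) ht
      _ ≤ _ := by gcongr; linarith [Real.rpow_nonneg hs β]
  · calc (s + t) ^ β ≤ (2 * s) ^ β := Real.rpow_le_rpow (by positivity) (by linarith) hβ
      _ = 2 ^ β * s ^ β := Real.mul_rpow (by norm_num) hs
      _ ≤ _ := by gcongr; linarith [Real.rpow_nonneg ht β]

lemma nonneg_of_growth (hα : 1 < α) (hk : ∀ t, |k t| ≤ C * (1 + |t| ^ (α - 1))) : 0 ≤ C := by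
  have := hk 0
  rw [abs_zero, Real.zero_rpow (by linarith), add_zero, mul_one] at this
  exact (abs_nonneg _).trans this

/-- The bound involves `t` and not `x`, so it is constant on the whole segment from `s` to `s + t`,
as the mean value inequality for the Taylor remainder needs. -/
lemma abs_sub_le_of_growth (hα : 1 < α) (hk : ∀ t, |k t| ≤ C * (1 + |t| ^ (α - 1))) {s t x : ℝ}
    (hx : |x| ≤ |t|) : |k (s + x) - k s| ≤
      (2 * C * 2 ^ (α - 1)) * (1 + |s| ^ (α - 1) + |t| ^ (α - 1)) := by
  have hC := nonneg_of_growth hα hk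
  have h2 : (1 : ℝ) ≤ 2 ^ (α - 1) := Real.one_le_rpow (by norm_num) (by linarith)
  have h3 : |s + x| ^ (α - 1) ≤ 2 ^ (α - 1) * (|s| ^ (α - 1) + |t| ^ (α - 1)) :=
    (Real.rpow_le_rpow (abs_nonneg _) ((abs_add_le s x).trans (by linarith))
      (by linarith)).trans
      (add_rpow_le_two_rpow_mul (abs_nonneg s) (abs_nonneg t) (by linarith))
  have h4 : |s| ^ (α - 1) ≤ 2 ^ (α - 1) * (|s| ^ (α - 1) + |t| ^ (α - 1)) := by
    nlinarith [Real.rpow_nonneg (abs_nonneg s) (α - 1), Real.rpow_nonneg (abs_nonneg t) (α - 1)]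
  calc |k (s + x) - k s| ≤ |k (s + x)| + |k s| := norm_sub_le (k (s + x)) (k s)
    _ ≤ C * (1 + |s + x| ^ (α - 1)) + C * (1 + |s| ^ (α - 1)) := add_le_add (hk _) (hk _)
    _ ≤ C * (2 ^ (α - 1) + 2 ^ (α - 1) * (|s| ^ (α - 1) + |t| ^ (α - 1))) +
        C * (2 ^ (α - 1) + 2 ^ (α - 1) * (|s| ^ (α - 1) + |t| ^ (α - 1))) := by gcongr
    _ = _ := by ring

lemma abs_taylor_remainder_le (hα : 1 < α) (hk : ∀ t, |k t| ≤ C * (1 + |t| ^ (α - 1)))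
    (hK : ∀ t, HasDerivAt K (k t) t) (s t : ℝ) :
    |K (s + t) - K s - k s * t| ≤
      (2 * C * 2 ^ (α - 1)) * (1 + |s| ^ (α - 1) + |t| ^ (α - 1)) * |t| := by
  have hd : ∀ x ∈ uIcc 0 t, HasDerivWithinAt (fun x => K (s + x) - k s * x) (k (s + x) - k s)
      (uIcc 0 t) x := fun x _ => by
    have h1 := (hK (s + x)).comp_const_add s x
    have h2 := (hasDerivAt_id x).const_mul (k s)
    rw [mul_one] at h2
    exact (h1.sub h2).hasDerivWithinAt
  have hb : ∀ x ∈ uIcc 0 t, ‖k (s + x) - k s‖ ≤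
      (2 * C * 2 ^ (α - 1)) * (1 + |s| ^ (α - 1) + |t| ^ (α - 1)) := fun x hx => by
    have hx' : |x| ≤ |t| := by
      have := abs_sub_left_of_mem_uIcc hx
      simpa using this
    exact abs_sub_le_of_growth hα hk hx'
  have := (convex_uIcc 0 t).norm_image_sub_le_of_norm_hasDerivWithin_le hd hb left_mem_uIcc
    right_mem_uIcc
  simp only [add_zero, mul_zero, sub_zero, Real.norm_eq_abs] at this
  refine le_trans (le_of_eq ?_) this
  congr 1; ring

variable [IsFiniteMeasure ν]

/-- Since `α / (α - 1) = q`, the power `|u| ^ (α - 1)` is in `L^q`; the constant is there because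
the measure is finite. -/
lemma memLp_one_add_rpow {q : ℝ} (hαq : α.HolderConjugate q) {u : Ω → ℝ}
    (hu : MemLp u (ENNReal.ofReal α) ν) (A : ℝ) :
    MemLp (fun z => A * (1 + |u z| ^ (α - 1))) (ENNReal.ofReal q) ν := by
  have h1 := hu.norm_rpow_div (ENNReal.ofReal (α - 1))
  have hα1 := hαq.lt
  rw [ENNReal.toReal_ofReal (by linarith), ← ENNReal.ofReal_div_of_pos (by linarith),
    show α / (α - 1) = q from hαq.conjugate_eq.symm] at h1
  have h2 : MemLp (fun z => 1 + |u z| ^ (α - 1)) (ENNReal.ofReal q) ν :=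
    (memLp_const (1 : ℝ)).add h1
  exact h2.const_mul A

lemma memLp_nemytskii {q : ℝ} (hαq : α.HolderConjugate q) (hkc : Continuous k)
    (hk : ∀ t, |k t| ≤ C * (1 + |t| ^ (α - 1))) {u : Ω → ℝ} (hu : MemLp u (ENNReal.ofReal α) ν) :
    MemLp (fun z => k (u z)) (ENNReal.ofReal q) ν :=
  (memLp_one_add_rpow hαq hu C).mono' (hkc.comp_aestronglyMeasurable hu.1)
    (ae_of_all _ fun z => hk (u z))

lemma integrable_nemytskii_mul (hα : 1 < α) (hkc : Continuous k)
    (hk : ∀ t, |k t| ≤ C * (1 + |t| ^ (α - 1))) {u v : Ω → ℝ}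
    (hu : MemLp u (ENNReal.ofReal α) ν) (hv : MemLp v (ENNReal.ofReal α) ν) :
    Integrable (fun z => k (u z) * v z) ν := by
  obtain ⟨q, hαq⟩ : ∃ q, α.HolderConjugate q := ⟨_, Real.HolderConjugate.conjExponent hα⟩
  have := hαq.symm.ennrealOfReal
  exact (memLp_nemytskii hαq hkc hk hu).integrable_mul hv

lemma integrable_primitive (hα : 1 < α)
    (hk : ∀ t, |k t| ≤ C * (1 + |t| ^ (α - 1))) (hK : ∀ t, HasDerivAt K (k t) t) {u : Ω → ℝ}
    (hu : MemLp u (ENNReal.ofReal α) ν) : Integrable (fun z => K (u z)) ν := by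
  obtain ⟨q, hαq⟩ : ∃ q, α.HolderConjugate q := ⟨_, Real.HolderConjugate.conjExponent hα⟩
  have := hαq.symm.ennrealOfReal
  have hKc : Continuous K := continuous_iff_continuousAt.2 fun t => (hK t).continuousAt
  have h1 : Integrable (fun z => (2 * C * 2 ^ (α - 1)) * (1 + |u z| ^ (α - 1)) * |u z|) ν :=
    (memLp_one_add_rpow hαq hu _).integrable_mul hu.norm
  have h2 : Integrable (fun z => k 0 * u z) ν :=
    (hu.integrable (ENNReal.one_le_ofReal.2 hα.le)).const_mul _
  have h3 : Integrable (fun z => K (u z) - K 0 - k 0 * u z) ν := by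
    refine h1.mono' ?_ (ae_of_all _ fun z => ?_)
    · exact ((hKc.comp_aestronglyMeasurable hu.1).sub aestronglyMeasurable_const).sub
        (hu.1.const_mul _)
    · have := abs_taylor_remainder_le hα hk hK 0 (u z)
      rw [zero_add, abs_zero, Real.zero_rpow (by linarith), add_zero] at this
      exact this
  have h4 := (h3.add h2).add (integrable_const (K 0))
  refine h4.congr (ae_of_all _ fun z => ?_)
  simp

lemma tendsto_eLpNorm_nemytskii_sub {q : ℝ} (hαq : α.HolderConjugate q) (hkc : Continuous k)
    (hk : ∀ t, |k t| ≤ C * (1 + |t| ^ (α - 1))) {u : Ω → ℝ} {h : ℕ → Ω → ℝ}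
    (hu : MemLp u (ENNReal.ofReal α) ν) (hm : ∀ n, AEStronglyMeasurable (h n) ν)
    (hh : Tendsto (fun n => eLpNorm (h n) (ENNReal.ofReal α) ν) atTop (𝓝 0)) :
    Tendsto (fun n => eLpNorm (fun z => k (u z + h n z) - k (u z)) (ENNReal.ofReal q) ν)
      atTop (𝓝 0) := by
  have hα := hαq.lt
  have hC := nonneg_of_growth hα hk
  have hA0 : 0 ≤ 2 * C * 2 ^ (α - 1) := by positivity
  refine tendsto_eLpNorm_nemytskii hA0 hαq (memLp_one_add_rpow hαq hu (2 * C * 2 ^ (α - 1)))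
    (D := fun z t => k (u z + t) - k (u z)) (fun z t => ?_) (fun z => ?_) hm (fun n => ?_) hh
  · rw [← mul_add]
    exact abs_sub_le_of_growth hα hk le_rfl
  · have h4 : Continuous fun t => k (u z + t) - k (u z) := by fun_prop
    simpa using h4.tendsto 0
  · exact (hkc.comp_aestronglyMeasurable (hu.1.add (hm n))).sub
      (hkc.comp_aestronglyMeasurable hu.1)

/-- Fréchet differentiability along sequences. Let `Φ (s, t)` be the difference quotient of `K`
minus the derivative, with value `0` at `t = 0`. The remainder is `∫ Φ (u, h) * h`, and Hölder's
inequality leaves `δ n = ‖Φ (u, h n)‖_q`, which tends to zero since `t ↦ Φ (s, t)` is a Nemytskii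
kernel vanishing at the origin. -/
lemma exists_remainder_le (hα : 1 < α) (hkc : Continuous k)
    (hk : ∀ t, |k t| ≤ C * (1 + |t| ^ (α - 1))) (hK : ∀ t, HasDerivAt K (k t) t)
    {u : Ω → ℝ} {h : ℕ → Ω → ℝ} (hu : MemLp u (ENNReal.ofReal α) ν)
    (hm : ∀ n, MemLp (h n) (ENNReal.ofReal α) ν)
    (hh : Tendsto (fun n => eLpNorm (h n) (ENNReal.ofReal α) ν) atTop (𝓝 0)) :
    ∃ δ : ℕ → ℝ≥0∞, Tendsto δ atTop (𝓝 0) ∧ ∀ n,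
      ‖(∫ z, K (u z + h n z) ∂ν) - (∫ z, K (u z) ∂ν) - ∫ z, k (u z) * h n z ∂ν‖ₑ ≤
        δ n * eLpNorm (h n) (ENNReal.ofReal α) ν := by
  obtain ⟨q, hαq⟩ : ∃ q, α.HolderConjugate q := ⟨_, Real.HolderConjugate.conjExponent hα⟩
  have := hαq.symm.ennrealOfReal
  have hC := nonneg_of_growth hα hk
  have hA0 : 0 ≤ 2 * C * 2 ^ (α - 1) := by positivity
  have hKc : Continuous K := continuous_iff_continuousAt.2 fun t => (hK t).continuousAt
  let Φ : ℝ × ℝ → ℝ := fun p => if p.2 = 0 then 0 else (K (p.1 + p.2) - K p.1) / p.2 - k p.1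
  have hΦ : ∀ s t, Φ (s, t) * t = K (s + t) - K s - k s * t := by
    intro s t
    simp only [Φ]
    split_ifs with ht
    · simp [ht]
    · field_simp
  have hΦm : Measurable Φ := by
    refine Measurable.ite (measurable_snd (measurableSet_singleton 0)) measurable_const ?_
    have := hKc.measurable
    have := hkc.measurable
    fun_prop
  have hΦa : ∀ n, AEStronglyMeasurable (fun z => Φ (u z, h n z)) ν := fun n =>
    (hΦm.comp_aemeasurable (hu.1.aemeasurable.prodMk
      (hm n).1.aemeasurable)).aestronglyMeasurable
  refine ⟨fun n => eLpNorm (fun z => Φ (u z, h n z)) (ENNReal.ofReal q) ν,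
    tendsto_eLpNorm_nemytskii hA0 hαq (memLp_one_add_rpow hαq hu (2 * C * 2 ^ (α - 1)))
      (D := fun z t => Φ (u z, t)) (fun z t => ?_) (fun z => ?_) (fun n => (hm n).1) hΦa hh,
    fun n => ?_⟩
  · rw [← mul_add]
    by_cases ht : t = 0
    · simp only [Φ, ht, if_true, abs_zero]
      positivity
    · have h1 := abs_taylor_remainder_le hα hk hK (u z) t
      rw [← hΦ, abs_mul] at h1
      exact le_of_mul_le_mul_right h1 (abs_pos.2 ht)
  · have h1 := hasDerivAt_iff_tendsto_slope_zero.1 (hK (u z))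
    have h2 : Tendsto (fun t => Φ (u z, t)) (𝓝[≠] 0) (𝓝 0) := by
      have h3 := h1.sub_const (k (u z))
      rw [sub_self] at h3
      refine h3.congr' ?_
      filter_upwards [self_mem_nhdsWithin] with t ht
      simp only [Φ, if_neg (show t ≠ 0 from ht), smul_eq_mul, inv_mul_eq_div]
    have h4 : Tendsto (fun t => Φ (u z, t)) (pure 0) (𝓝 0) := by
      rw [tendsto_pure_left]
      intro s hs
      simpa [Φ] using mem_of_mem_nhds hs
    have h5 := tendsto_sup.2 ⟨h2, h4⟩
    rwa [nhdsNE_sup_pure] at h5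
  · have i1 : Integrable (fun z => K (u z + h n z)) ν :=
      integrable_primitive hα hk hK (hu.add (hm n))
    have i2 : Integrable (fun z => K (u z)) ν := integrable_primitive hα hk hK hu
    have i3 : Integrable (fun z => K (u z + h n z) - K (u z)) ν := i1.sub i2
    have hR : (∫ z, K (u z + h n z) ∂ν) - (∫ z, K (u z) ∂ν) - ∫ z, k (u z) * h n z ∂ν =
        ∫ z, Φ (u z, h n z) * h n z ∂ν := by
      rw [← integral_sub i1 i2, ← integral_sub i3
        (integrable_nemytskii_mul hα hkc hk hu (hm n))]
      exact integral_congr_ae (ae_of_all _ fun z => (hΦ _ _).symm)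
    rw [hR]
    refine (enorm_integral_le_lintegral_enorm _).trans ?_
    rw [← eLpNorm_one_eq_lintegral_enorm]
    have h1 := eLpNorm_smul_le_mul_eLpNorm (p := ENNReal.ofReal q) (q := ENNReal.ofReal α)
      (r := 1) (hm n).1 (hΦa n)
    exact h1

variable {X : Type*} [NormedAddCommGroup X] [InnerProductSpace ℝ X] [CompleteSpace X]

/-- The functional `u ↦ ∫ K(Ju) dν` is continuously differentiable, and its gradient is a
continuous function of `Ju`. -/
lemma exists_gradient_integral_comp [Fact (1 ≤ ENNReal.ofReal α)] (hα : 1 < α)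
    (hkc : Continuous k) (hk : ∀ t, |k t| ≤ C * (1 + |t| ^ (α - 1)))
    (hK : ∀ t, HasDerivAt K (k t) t) (J : X →L[ℝ] Lp ℝ (ENNReal.ofReal α) ν) :
    ∃ Γ : Lp ℝ (ENNReal.ofReal α) ν → X, Continuous Γ ∧
      (∀ w φ, inner ℝ (Γ w) φ = ∫ z, k (w z) * J φ z ∂ν) ∧
      ∀ u, HasFDerivAt (fun u => ∫ z, K (J u z) ∂ν) (innerSL ℝ (Γ (J u))) u := by
  obtain ⟨q, hαq⟩ : ∃ q, α.HolderConjugate q := ⟨_, Real.HolderConjugate.conjExponent hα⟩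
  have := hαq.ennrealOfReal
  have := hαq.symm.ennrealOfReal
  have : Fact (1 ≤ ENNReal.ofReal q) := ⟨ENNReal.HolderConjugate.one_le _ (ENNReal.ofReal α)⟩
  have hmem : ∀ w : Lp ℝ (ENNReal.ofReal α) ν, MemLp (fun z => k (w z)) (ENNReal.ofReal q) ν :=
    fun w => memLp_nemytskii hαq hkc hk (Lp.memLp w)
  let N : Lp ℝ (ENNReal.ofReal α) ν → Lp ℝ (ENNReal.ofReal q) ν := fun w => (hmem w).toLp _
  -- `T` pulls the pairing with an `L^q` function back along `J`. The gradient is the Riesz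
  -- representative of `T (N (J u))`; keeping `Γ` as a function of `w ∈ L^α` lets the compactness of
  -- `J` act on it later.
  let T : Lp ℝ (ENNReal.ofReal q) ν →L[ℝ] X →L[ℝ] ℝ :=
    ((ContinuousLinearMap.compL ℝ X _ ℝ).flip J).comp
      ((ContinuousLinearMap.mul ℝ ℝ).lpPairing ν (ENNReal.ofReal q) (ENNReal.ofReal α))
  have hT : ∀ w φ, T (N w) φ = ∫ z, k (w z) * J φ z ∂ν := by
    intro w φ
    have h1 : T (N w) φ = (ContinuousLinearMap.mul ℝ ℝ).lpPairing ν (ENNReal.ofReal q)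
      (ENNReal.ofReal α) (N w) (J φ) := rfl
    rw [h1, ContinuousLinearMap.lpPairing_eq_integral]
    refine integral_congr_ae ?_
    filter_upwards [(hmem w).coeFn_toLp] with z hz
    simp only [N, hz, ContinuousLinearMap.mul_apply']
  have hnorm : ∀ w : ℕ → Lp ℝ (ENNReal.ofReal α) ν, Tendsto w atTop (𝓝 0) →
      Tendsto (fun n => eLpNorm (w n) (ENNReal.ofReal α) ν) atTop (𝓝 0) := by
    intro w hw
    have h2 := (ENNReal.continuous_ofReal.tendsto 0).comp (tendsto_zero_iff_norm_tendsto_zero.1 hw)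
    rw [ENNReal.ofReal_zero] at h2
    refine h2.congr fun n => ?_
    rw [Function.comp_apply, ofReal_norm, Lp.enorm_def]
  have hN : Continuous N := by
    rw [continuous_iff_seqContinuous]
    intro w w₀ hw
    have h3 := tendsto_eLpNorm_nemytskii_sub hαq hkc hk (Lp.memLp w₀)
      (h := fun n z => (w n - w₀ : Lp ℝ (ENNReal.ofReal α) ν) z)
      (fun n => Lp.aestronglyMeasurable _) (hnorm _ (tendsto_sub_nhds_zero_iff.2 hw))
    refine (Lp.tendsto_Lp_iff_tendsto_eLpNorm'' (fun n z => k (w n z)) (fun n => hmem _)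
      (fun z => k (w₀ z)) (hmem _)).2 (h3.congr fun n => eLpNorm_congr_ae ?_)
    filter_upwards [Lp.coeFn_sub (w n) w₀] with z hz
    change k (w₀ z + (w n - w₀ : Lp ℝ (ENNReal.ofReal α) ν) z) - k (w₀ z) =
      k (w n z) - k (w₀ z)
    rw [hz, Pi.sub_apply, add_sub_cancel]
  refine ⟨fun w => (InnerProductSpace.toDual ℝ X).symm (T (N w)),
    (InnerProductSpace.toDual ℝ X).symm.continuous.comp (T.continuous.comp hN),
    fun w φ => by rw [InnerProductSpace.toDual_symm_apply, hT], fun u => ?_⟩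
  have hL : innerSL ℝ ((InnerProductSpace.toDual ℝ X).symm (T (N (J u)))) = T (N (J u)) := by
    ext φ
    rw [innerSL_apply_apply, InnerProductSpace.toDual_symm_apply]
  rw [hL, hasFDerivAt_iff_tendsto]
  refine tendsto_of_seq_tendsto fun x hx => ?_
  have h0 : Tendsto (fun n => J (x n - u)) atTop (𝓝 0) := by
    have := (J.continuous.tendsto _).comp (hx.sub_const u)
    rwa [sub_self, map_zero] at this
  obtain ⟨δ, hδ, hle⟩ := exists_remainder_le hα hkc hk hK (Lp.memLp (J u))
    (h := fun n z => J (x n - u) z) (fun n => Lp.memLp _) (hnorm _ h0)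
  have hδr : Tendsto (fun n => (δ n).toReal * ‖J‖) atTop (𝓝 0) := by
    have := (ENNReal.tendsto_toReal ENNReal.zero_ne_top).comp hδ
    simpa using this.mul_const ‖J‖
  refine squeeze_zero' (Eventually.of_forall fun n => mul_nonneg (inv_nonneg.2 (norm_nonneg _))
    (norm_nonneg _)) ?_ hδr
  filter_upwards [hδ.eventually_lt_const ENNReal.zero_lt_top] with n hn
  have h1 : ∫ z, K (J (x n) z) ∂ν = ∫ z, K (J u z + J (x n - u) z) ∂ν := by
    refine integral_congr_ae ?_
    have h5 : J (x n) = J u + J (x n - u) := by rw [← map_add, add_sub_cancel]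
    rw [h5]
    filter_upwards [Lp.coeFn_add (J u) (J (x n - u))] with z hz
    rw [hz, Pi.add_apply]
  have hE := hle n
  rw [← Lp.enorm_def, ← h1, ← hT] at hE
  have hE' := ENNReal.toReal_mono (by finiteness) hE
  rw [toReal_enorm, ENNReal.toReal_mul, toReal_enorm] at hE'
  rw [Function.comp_apply, inv_mul_eq_div]
  refine div_le_of_le_mul₀ (norm_nonneg _) (by positivity) (hE'.trans ?_)
  rw [mul_assoc]
  gcongr
  exact J.le_opNorm _

end Nemytskii

end Grushin

namespace Grushin

/-! ### The semilinear mountain pass theorem and the compact embedding -/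

section SemilinearMountainPass

variable {Ω : Type*} [MeasurableSpace Ω] {ν : Measure Ω} [IsFiniteMeasure ν]
  {k K : ℝ → ℝ} {α C : ℝ} [Fact (1 ≤ ENNReal.ofReal α)]
  {X : Type*} [NormedAddCommGroup X] [InnerProductSpace ℝ X] [CompleteSpace X]

/-- The **mountain pass theorem** for `E(u) = ½‖u‖² - ∫ K(Ju)` with a compact operator
`J : X → L^α`, subcritical growth and the Ambrosetti–Rabinowitz condition. -/
theorem exists_critical_of_ambrosetti_rabinowitz (hα : 1 < α)
    (hkc : Continuous k) (hk : ∀ t, |k t| ≤ C * (1 + |t| ^ (α - 1)))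
    (hK : ∀ t, HasDerivAt K (k t) t) (J : X →L[ℝ] Lp ℝ (ENNReal.ofReal α) ν)
    (hJ : ∀ (u : ℕ → X) (B : ℝ), (∀ n, ‖u n‖ ≤ B) → ∃ (x : X) (s : ℕ → ℕ), StrictMono s ∧
      Tendsto (fun n => J (u (s n))) atTop (𝓝 (J x)))
    {θ M : ℝ} (hθ : 2 < θ) (hAR : ∀ t, θ * K t ≤ t * k t + M)
    {E : X → ℝ} (hE : ∀ u, E u = 1 / 2 * ‖u‖ ^ 2 - ∫ z, K (J u z) ∂ν)
    {v : X} {c : ℝ} (hc : IsMountainPassLevel E v c) (h0 : E 0 < c) (hv : E v < c) :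
    ∃ u, E u = c ∧ (∀ φ, inner ℝ u φ = ∫ z, k (J u z) * J φ z ∂ν) ∧
      HasFDerivAt E (0 : X →L[ℝ] ℝ) u ∧
      (1 / 2 - 1 / θ) * ‖u‖ ^ 2 ≤ c + M / θ * ν.real univ := by
  obtain ⟨Γ, hΓc, hΓ, hΓd⟩ := exists_gradient_integral_comp hα hkc hk hK J
  have hderiv : ∀ u, HasFDerivAt E (innerSL ℝ (u - Γ (J u))) u := by
    intro u
    have h1 : HasFDerivAt (fun u : X => 1 / 2 * ‖u‖ ^ 2) (innerSL ℝ u) u := by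
      have h2 := ((hasStrictFDerivAt_norm_sq u).hasFDerivAt).const_mul (1 / 2 : ℝ)
      refine h2.congr_fderiv ?_
      ext w
      simp
    have h3 := h1.sub (hΓd u)
    rw [← map_sub] at h3
    rw [funext hE]
    exact h3
  -- Subtracting `1 / θ` times the derivative in the direction `u` cancels the superquadratic part
  -- up to the constant `M`. This serves twice: for the boundedness of Palais–Smale sequences and
  -- for the final norm estimate.
  have hbound : ∀ u, (1 / 2 - 1 / θ) * ‖u‖ ^ 2 ≤
      E u - 1 / θ * inner ℝ (u - Γ (J u)) u + M / θ * ν.real univ := by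
    intro u
    have i1 : Integrable (fun z => K (J u z)) ν := integrable_primitive hα hk hK (Lp.memLp _)
    have i2 : Integrable (fun z => k (J u z) * J u z) ν :=
      integrable_nemytskii_mul hα hkc hk (Lp.memLp _) (Lp.memLp _)
    have h1 : θ * ∫ z, K (J u z) ∂ν ≤ (∫ z, k (J u z) * J u z ∂ν) + M * ν.real univ := by
      have h2 : M * ν.real univ = ∫ _, M ∂ν := by simp [mul_comm]
      rw [← integral_const_mul, h2, ← integral_add i2 (integrable_const M)]
      refine integral_mono (i1.const_mul θ) (i2.add (integrable_const M)) fun z => ?_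
      simpa [mul_comm] using hAR (J u z)
    rw [hE, inner_sub_left, hΓ, real_inner_self_eq_norm_sq]
    have h3 : ∫ z, K (J u z) ∂ν ≤
        1 / θ * (∫ z, k (J u z) * J u z ∂ν) + M / θ * ν.real univ := by
      have : 0 < θ := by linarith
      rw [div_mul_eq_mul_div, div_mul_eq_mul_div, one_mul, ← add_div, le_div_iff₀ this]
      linarith
    linarith
  have hGc : Continuous fun u => u - Γ (J u) := by fun_prop
  have hPS : ∀ u : ℕ → X, Tendsto (fun n => E (u n)) atTop (𝓝 c) →
      Tendsto (fun n => u n - Γ (J (u n))) atTop (𝓝 0) →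
      ∃ (x : X) (s : ℕ → ℕ), StrictMono s ∧ Tendsto (u ∘ s) atTop (𝓝 x) := by
    intro u hu hGu
    obtain ⟨B, hB⟩ : ∃ B, ∀ n, ‖u n‖ ≤ B := by
      obtain ⟨b₁, h1⟩ := hu.bddAbove_range
      obtain ⟨b₂, h2⟩ := hGu.norm.bddAbove_range
      have hκ : 0 < 1 / 2 - 1 / θ := by
        rw [sub_pos]
        exact one_div_lt_one_div_of_lt (by norm_num) hθ
      set κ := 1 / 2 - 1 / θ
      set A := |b₁| + |M / θ * ν.real univ| with hA
      have hb : ∀ n, κ * ‖u n‖ ^ 2 ≤ A + |b₂| * ‖u n‖ := by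
        intro n
        have h3 : E (u n) ≤ b₁ := h1 (mem_range_self n)
        have h4 : ‖u n - Γ (J (u n))‖ ≤ b₂ := h2 (mem_range_self n)
        have h5 := abs_real_inner_le_norm (u n - Γ (J (u n))) (u n)
        have h6 : - (1 / θ * inner ℝ (u n - Γ (J (u n))) (u n)) ≤ |b₂| * ‖u n‖ := by
          have h7 : 1 / θ ≤ 1 := by rw [div_le_one (by linarith)]; linarith
          have h8 : 0 < 1 / θ := by have : 0 < θ := by linarith
                                    positivity
          have h9 : |inner ℝ (u n - Γ (J (u n))) (u n)| ≤ |b₂| * ‖u n‖ :=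
            h5.trans (mul_le_mul_of_nonneg_right (h4.trans (le_abs_self _)) (norm_nonneg _))
          have h10 := neg_abs_le (inner ℝ (u n - Γ (J (u n))) (u n))
          nlinarith [abs_nonneg (inner ℝ (u n - Γ (J (u n))) (u n))]
        have := hbound (u n)
        linarith [le_abs_self b₁, le_abs_self (M / θ * ν.real univ)]
      -- A larger norm would be at least `1` and satisfy `κ * ‖u n‖ > A + |b₂|`, so `κ * ‖u n‖ ^ 2`
      -- would exceed `A + |b₂| * ‖u n‖`.
      refine ⟨(A + |b₂|) / κ + 1, fun n => ?_⟩
      by_contra! hn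
      have h3 := hb n
      have hA0 : 0 ≤ A := by positivity
      have h4 : 1 ≤ ‖u n‖ := by
        have : 0 ≤ (A + |b₂|) / κ := by positivity
        linarith
      have h5 : (A + |b₂|) < κ * ‖u n‖ := by
        have : (A + |b₂|) / κ < ‖u n‖ := by linarith
        rw [div_lt_iff₀ hκ] at this
        linarith
      nlinarith
    obtain ⟨x, s, hs, hx⟩ := hJ u B hB
    -- The sequence is its vanishing gradient plus `Γ (J (u n))`, so convergence of `J (u n)` forces
    -- strong convergence, with `Γ (J x)` as the limit.
    refine ⟨Γ (J x), s, hs, ?_⟩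
    have h1 := (hGu.comp hs.tendsto_atTop).add ((hΓc.tendsto _).comp hx)
    rw [zero_add] at h1
    refine h1.congr fun n => ?_
    simp
  obtain ⟨u, hu, huc⟩ := exists_critical_of_isMountainPassLevel hderiv hGc hc h0 hv hPS
  have hu' := hderiv u
  rw [hu, map_zero] at hu'
  refine ⟨u, huc, fun φ => ?_, hu', ?_⟩
  · rw [← hΓ, ← sub_eq_zero, ← inner_sub_left, hu, inner_zero_left]
  · have := hbound u
    rw [hu, inner_zero_left, huc] at this
    linarith

end SemilinearMountainPass

namespace Params

variable (P : Params)

/-- The embedding of `D_γ` into `L^α` of a finite measure with bounded density is compact. -/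
lemma exists_compact_embedding {ν : Measure P.Pt} [IsFiniteMeasure ν] {M : ℝ≥0∞}
    (hM : M ≠ ⊤) (hν : ν ≤ M • volume) {α : ℝ} [Fact (1 ≤ ENNReal.ofReal α)]
    (hα : 1 ≤ α) (hα' : α < P.critExp) :
    ∃ J : P.D →L[ℝ] Lp ℝ (ENNReal.ofReal α) ν, (∀ u : P.D, J u =ᵐ[ν] u) ∧
      ∀ (u : ℕ → P.D) (B : ℝ), (∀ n, ‖u n‖ ≤ B) → ∃ (x : P.D) (s : ℕ → ℕ), StrictMono s ∧
        Tendsto (fun n => J (u (s n))) atTop (𝓝 (J x)) := by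
  obtain ⟨C, hC0, hC⟩ := P.exists_norm_toLp_le
  have hac : ν ≪ volume := Measure.absolutelyContinuous_of_le_smul hν
  have hmem' : ∀ u : P.D, MemLp u (ENNReal.ofReal P.critExp) ν := fun u =>
    ((Lp.memLp (D.toLp u)).smul_measure hM).mono_measure hν
  have hmem : ∀ u : P.D, MemLp u (ENNReal.ofReal α) ν := fun u =>
    (hmem' u).mono_exponent (ENNReal.ofReal_le_ofReal hα'.le)
  let J₀ : P.D →ₗ[ℝ] Lp ℝ (ENNReal.ofReal α) ν :=
    { toFun := fun u => (hmem u).toLp _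
      map_add' := fun u w => by
        rw [← MemLp.toLp_add, MemLp.toLp_eq_toLp_iff]
        rw [map_add]
        exact hac.ae_le (Lp.coeFn_add _ _)
      map_smul' := fun c u => by
        rw [RingHom.id_apply, ← MemLp.toLp_const_smul, MemLp.toLp_eq_toLp_iff, map_smul]
        exact hac.ae_le (Lp.coeFn_smul _ _) }
  set A : ℝ≥0∞ := M ^ (1 / ENNReal.ofReal P.critExp).toReal with hA
  set V : ℝ≥0∞ := ν univ ^ (1 / α - 1 / P.critExp) with hV
  have hAt : A ≠ ⊤ := ENNReal.rpow_ne_top_of_nonneg ENNReal.toReal_nonneg hM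
  have hVt : V ≠ ⊤ := ENNReal.rpow_ne_top_of_nonneg
    (sub_nonneg.2 (one_div_le_one_div_of_le (by linarith) hα'.le)) (measure_ne_top _ _)
  have hbd : ∀ u : P.D, ‖J₀ u‖ ≤ A.toReal * C * V.toReal * ‖u‖ := by
    intro u
    have h1 : ‖J₀ u‖ₑ ≤ A * ‖D.toLp u‖ₑ * V := by
      have h2 : ‖J₀ u‖ₑ = eLpNorm u (ENNReal.ofReal α) ν := Lp.enorm_toLp (hmem u)
      rw [h2]
      refine (eLpNorm_le_eLpNorm_mul_rpow_measure_univ (ENNReal.ofReal_le_ofReal hα'.le)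
        (hmem u).1).trans ?_
      rw [ENNReal.toReal_ofReal (by linarith), ENNReal.toReal_ofReal (by linarith)]
      gcongr
      refine (eLpNorm_mono_measure _ hν).trans ?_
      rw [eLpNorm_smul_measure_of_ne_top (by simp), smul_eq_mul, Lp.enorm_def]
    have h3 := ENNReal.toReal_mono (by finiteness) h1
    rw [toReal_enorm, ENNReal.toReal_mul, ENNReal.toReal_mul, toReal_enorm] at h3
    calc _ ≤ _ := h3
      _ ≤ A.toReal * (C * ‖u‖) * V.toReal := by gcongr; exact hC u
      _ = _ := by ring
  refine ⟨J₀.mkContinuous _ hbd, fun u => (hmem u).coeFn_toLp, fun u B hB => ?_⟩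
  obtain ⟨x, s, hs, hw⟩ := exists_weakly_convergent_subseq hB
  refine ⟨x, s, hs, ?_⟩
  have h1 := P.tendsto_eLpNorm_of_weakly_null hM hν hα hα' (w := fun n => u (s n) - x)
    (B := B + ‖x‖) (fun n => (norm_sub_le _ _).trans (by gcongr; exact hB _)) hw
  rw [tendsto_iff_norm_sub_tendsto_zero]
  have h2 := (ENNReal.tendsto_toReal ENNReal.zero_ne_top).comp h1
  refine h2.congr fun n => ?_
  rw [Function.comp_apply, ← map_sub, LinearMap.mkContinuous_apply, ← toReal_enorm]
  congr 1
  exact (Lp.enorm_toLp (hmem _)).symm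

end Params

end Grushin

namespace Grushin

/-! ### The truncated nonlinearity -/

variable {f : ℝ → ℝ} {a : ℝ}

/-- A formula without case distinctions: the ramp on `(-1, 0)` is a difference of two positive
parts. Continuity is then immediate, and `Fa` becomes a combination of primitives of continuous
functions. -/
lemma fa_eq (h0 : f 0 = 0) (a t : ℝ) :
    fa f a t = f (max t 0) - a * (max (t + 1) 0 - max t 0) := by
  unfold fa
  split_ifs with h1 h2
  · rw [max_eq_left h1, max_eq_left (by linarith)]; ring
  · rw [max_eq_right (by linarith), max_eq_left (by linarith), h0]; ring
  · rw [max_eq_right (by linarith), max_eq_right (by linarith), h0]; ring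

lemma Fa_eq (h0 : f 0 = 0) (a t : ℝ) :
    Fa f a t = (∫ s in (0 : ℝ)..t, f (max s 0)) -
      a * (max (t + 1) 0 ^ 2 / 2 - max t 0 ^ 2 / 2 - 1 / 2) := by
  have hneg : t ≤ 0 → ∫ s in (0 : ℝ)..t, f (max s 0) = 0 := fun ht => by
    rw [intervalIntegral.integral_congr (g := fun _ => 0) fun s hs => ?_]
    · simp
    · rw [uIcc_of_ge ht] at hs
      simp only [max_eq_right hs.2, h0]
  unfold Fa
  split_ifs with h1 h2
  · rw [intervalIntegral.integral_congr (g := fun s => f (max s 0)) fun s hs => ?_,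
      max_eq_left h1, max_eq_left (by linarith)]
    · ring
    · rw [uIcc_of_le h1] at hs
      simp only [max_eq_left hs.1]
  · rw [hneg (by linarith), max_eq_left (show 0 ≤ t + 1 by linarith),
      max_eq_right (show t ≤ 0 by linarith)]
    ring
  · rw [hneg (by linarith), max_eq_right (by linarith), max_eq_right (by linarith)]; ring

lemma continuous_comp_max (hf : ContinuousOn f (Ici 0)) : Continuous fun t => f (max t 0) :=
  hf.comp_continuous (by fun_prop) fun t => le_max_right t 0

lemma continuous_fa (hf : ContinuousOn f (Ici 0)) (h0 : f 0 = 0) (a : ℝ) :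
    Continuous (fa f a) := by
  rw [funext (fa_eq h0 a)]
  exact (continuous_comp_max hf).sub (by fun_prop)

lemma hasDerivAt_max_sq (t : ℝ) : HasDerivAt (fun t : ℝ => max t 0 ^ 2 / 2) (max t 0) t := by
  rcases lt_trichotomy t 0 with ht | rfl | ht
  · rw [max_eq_right ht.le]
    refine (hasDerivAt_const t (0 : ℝ)).congr_of_eventuallyEq ?_
    filter_upwards [gt_mem_nhds ht] with s hs
    simp [max_eq_right (show s ≤ 0 from le_of_lt hs)]
  · rw [max_self, hasDerivAt_iff_isLittleO_nhds_zero]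
    have h1 : (fun h : ℝ => h ^ 2) =o[𝓝 0] fun h => h := by
      simpa using (Asymptotics.isLittleO_pow_pow (𝕜 := ℝ) (m := 1) (n := 2) one_lt_two)
    refine Asymptotics.IsBigO.trans_isLittleO (Asymptotics.IsBigO.of_bound 1
      (Eventually.of_forall fun h => ?_)) h1
    have h2 : |max h 0| ≤ |h| := by
      rw [abs_of_nonneg (le_max_right h 0)]
      exact max_le (le_abs_self h) (abs_nonneg h)
    have h3 := sq_le_sq.2 h2
    simp only [zero_add, max_self, smul_zero, sub_zero, one_mul, Real.norm_eq_abs, abs_pow, sq_abs,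
      ne_eq, OfNat.ofNat_ne_zero, not_false_eq_true, zero_pow, zero_div, abs_div, Nat.abs_ofNat]
    linarith [sq_nonneg (max h 0)]
  · rw [max_eq_left ht.le]
    have h1 : HasDerivAt (fun t : ℝ => t ^ 2 / 2) t t := by
      have := (hasDerivAt_pow 2 t).div_const 2
      simpa using this
    refine h1.congr_of_eventuallyEq ?_
    filter_upwards [lt_mem_nhds ht] with s hs
    simp [max_eq_left (show 0 ≤ s from le_of_lt hs)]

lemma hasDerivAt_Fa (hf : ContinuousOn f (Ici 0)) (h0 : f 0 = 0) (a t : ℝ) :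
    HasDerivAt (Fa f a) (fa f a t) t := by
  rw [funext (Fa_eq h0 a), fa_eq h0]
  have h1 := intervalIntegral.integral_hasDerivAt_right
    ((continuous_comp_max hf).intervalIntegrable 0 t)
    ((continuous_comp_max hf).stronglyMeasurableAtFilter volume (𝓝 t))
    (continuous_comp_max hf).continuousAt
  have h2 := (hasDerivAt_max_sq (t + 1)).comp_add_const t 1
  exact h1.sub (((h2.sub (hasDerivAt_max_sq t)).sub_const (1 / 2)).const_mul a)

lemma Fa_of_nonneg {t : ℝ} (ht : 0 ≤ t) : Fa f a t = (∫ s in (0 : ℝ)..t, f s) - a * t := if_pos ht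

lemma Fa_zero : Fa f a 0 = 0 := by simp [Fa]

/-- On `(-1, 0)` completing the square gives `a / 2 - a * (t + 1) ^ 2 / 2`. The truncation thus
costs at most `a / 2` per unit of `ν`-mass, which is small with `a`. -/
lemma Fa_le_of_neg (ha : 0 ≤ a) {t : ℝ} (ht : t < 0) : Fa f a t ≤ a / 2 := by
  unfold Fa
  rw [if_neg (by linarith)]
  split_ifs
  · nlinarith [mul_nonneg ha (sq_nonneg (t + 1))]
  · exact le_rfl

lemma mul_fa_nonneg_of_neg (ha : 0 ≤ a) {t : ℝ} (ht : t < 0) : 0 ≤ t * fa f a t := by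
  unfold fa
  rw [if_neg (by linarith)]
  split_ifs with h
  · exact mul_nonneg_of_nonpos_of_nonpos ht.le
      (mul_nonpos_of_nonpos_of_nonneg (by linarith) (by linarith))
  · simp

/-- Bounds on `[0, T]` from continuity. -/
lemma exists_abs_le_of_continuousOn (hf : ContinuousOn f (Ici 0)) (T : ℝ) :
    ∃ B : ℝ, 0 ≤ B ∧ ∀ t, 0 ≤ t → t ≤ T → |f t| ≤ B := by
  obtain ⟨B, hB⟩ := isCompact_Icc.exists_bound_of_continuousOn
    (hf.mono (Icc_subset_Ici_self : Icc 0 T ⊆ Ici 0))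
  exact ⟨|B|, abs_nonneg B, fun t h0 hT => (hB t ⟨h0, hT⟩).trans (le_abs_self B)⟩

lemma abs_integral_le_of_abs_le {t B : ℝ} (ht : 0 ≤ t) (h : ∀ s, 0 < s → s ≤ t → |f s| ≤ B) :
    |∫ s in (0 : ℝ)..t, f s| ≤ B * t := by
  have := intervalIntegral.norm_integral_le_of_norm_le_const (a := 0) (b := t) (f := f) (C := B)
    fun s hs => by
      rw [uIoc_of_le ht] at hs
      exact h s hs.1 hs.2
  rwa [sub_zero, abs_of_nonneg ht] at this

lemma exists_growth (hf : ContinuousOn f (Ici 0)) {α L : ℝ}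
    (hL : Tendsto (fun t => f t / t ^ (α - 1)) atTop (𝓝 L)) :
    ∃ C : ℝ, 0 ≤ C ∧ ∀ t, 0 ≤ t → |f t| ≤ C * (1 + t ^ (α - 1)) := by
  have h1 := hL.abs.eventually_le_const (lt_add_one |L|)
  obtain ⟨T, hT⟩ := eventually_atTop.1 (h1.and (eventually_gt_atTop 0))
  obtain ⟨B, hB0, hB⟩ := exists_abs_le_of_continuousOn hf T
  refine ⟨B + (|L| + 1), by positivity, fun t ht => ?_⟩
  have hp : 0 ≤ t ^ (α - 1) := Real.rpow_nonneg ht _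
  rcases le_total t T with h | h
  · have := hB t ht h
    nlinarith [abs_nonneg L]
  · obtain ⟨h2, h3⟩ := hT t h
    have h4 : 0 < t ^ (α - 1) := Real.rpow_pos_of_pos h3 _
    rw [abs_div, abs_of_pos h4, div_le_iff₀ h4] at h2
    nlinarith [abs_nonneg L]

lemma abs_fa_le (h0 : f 0 = 0) {α C : ℝ} (hα : 1 < α) (hC : 0 ≤ C)
    (hg : ∀ t, 0 ≤ t → |f t| ≤ C * (1 + t ^ (α - 1))) (ha : 0 ≤ a) (t : ℝ) :
    |fa f a t| ≤ (C + a) * (1 + |t| ^ (α - 1)) := by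
  have hp : 0 ≤ |t| ^ (α - 1) := Real.rpow_nonneg (abs_nonneg t) _
  have h1 : |f (max t 0)| ≤ C * (1 + |t| ^ (α - 1)) := by
    refine (hg _ (le_max_right t 0)).trans ?_
    gcongr
    exact max_le (le_abs_self t) (abs_nonneg t)
  have h2 : |max (t + 1) 0 - max t 0| ≤ 1 := by
    have := abs_max_sub_max_le_abs (t + 1) t 0
    simpa using this
  rw [fa_eq h0]
  calc |f (max t 0) - a * (max (t + 1) 0 - max t 0)|
      ≤ |f (max t 0)| + |a * (max (t + 1) 0 - max t 0)| := by
        simpa only [Real.norm_eq_abs] using norm_sub_le (f (max t 0)) _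
    _ ≤ C * (1 + |t| ^ (α - 1)) + a * 1 := by
        rw [abs_mul, abs_of_nonneg ha]; gcongr
    _ ≤ _ := by nlinarith

/-- Behaviour of the primitive at the origin. -/
lemma exists_Fa_le (hf : ContinuousOn f (Ici 0))
    (hlim : Tendsto (fun t => f t / t) (𝓝[>] 0) (𝓝 0)) {α L : ℝ} (hα : 2 < α)
    (hL : Tendsto (fun t => f t / t ^ (α - 1)) atTop (𝓝 L)) {ε : ℝ} (hε : 0 < ε) :
    ∃ C : ℝ, 0 ≤ C ∧ ∀ a, 0 ≤ a → ∀ t, Fa f a t ≤ a / 2 + ε * |t| ^ (2 : ℝ) + C * |t| ^ α := by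
  obtain ⟨C, hC0, hC⟩ := exists_growth hf hL
  have h1 := hlim.abs.eventually_le_const (by rwa [abs_zero] : |(0 : ℝ)| < ε)
  obtain ⟨τ, hτ0, hτ⟩ := mem_nhdsGT_iff_exists_Ioc_subset.1 h1
  have hτ0' : 0 < τ := hτ0
  -- For `t ≥ τ` the constant in the growth bound is absorbed, as `1 ≤ (τ ^ (α - 1))⁻¹ * t ^ (α -
  -- 1)`.
  set A : ℝ := C * ((τ ^ (α - 1))⁻¹ + 1) with hA
  have hA0 : 0 ≤ A := by positivity
  have hf' : ∀ t, 0 < t → |f t| ≤ ε * t + A * t ^ (α - 1) := by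
    intro t ht
    have hp : 0 < t ^ (α - 1) := Real.rpow_pos_of_pos ht _
    rcases le_total t τ with h | h
    · have h2 : |f t / t| ≤ ε := hτ ⟨ht, h⟩
      rw [abs_div, abs_of_pos ht, div_le_iff₀ ht] at h2
      have : 0 ≤ A * t ^ (α - 1) := by positivity
      linarith
    · have h2 : 1 ≤ (τ ^ (α - 1))⁻¹ * t ^ (α - 1) := by
        rw [inv_mul_eq_div, one_le_div (by positivity)]
        exact Real.rpow_le_rpow hτ0'.le h (by linarith)
      have h3 : C * (1 + t ^ (α - 1)) ≤ A * t ^ (α - 1) := by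
        rw [hA, mul_assoc, add_mul, one_mul]
        gcongr
      have : 0 ≤ ε * t := by positivity
      linarith [hC t ht.le]
  refine ⟨A, hA0, fun a ha t => ?_⟩
  have hp1 : 0 ≤ ε * |t| ^ (2 : ℝ) := by positivity
  have hp2 : 0 ≤ A * |t| ^ α := by positivity
  rcases lt_or_ge t 0 with ht | ht
  · have := Fa_le_of_neg (f := f) ha ht
    linarith
  · rw [Fa_of_nonneg ht]
    have h2 : |∫ s in (0 : ℝ)..t, f s| ≤ (ε * t + A * t ^ (α - 1)) * t := by
      refine abs_integral_le_of_abs_le ht fun s hs hst => (hf' s hs).trans ?_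
      gcongr
      linarith
    have h3 : (ε * t + A * t ^ (α - 1)) * t = ε * |t| ^ (2 : ℝ) + A * |t| ^ α := by
      have h4 : t ^ (α - 1) * t = t ^ α := by
        rcases ht.eq_or_lt with rfl | h
        · rw [mul_zero, Real.zero_rpow (by linarith)]
        · rw [← Real.rpow_add_one h.ne', sub_add_cancel]
      rw [abs_of_nonneg ht, Real.rpow_two, ← h4]
      ring
    have h4 := le_abs_self (∫ s in (0 : ℝ)..t, f s)
    have h5 : 0 ≤ a * t := by positivity
    linarith

/-- The Ambrosetti–Rabinowitz condition for the truncations, uniformly in bounded `a`. -/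
lemma exists_ambrosetti_rabinowitz_fa (hf : ContinuousOn f (Ici 0)) {θ t₀ : ℝ} (hθ : 2 < θ)
    (ht₀ : 0 < t₀) (hAR : ∀ t, t₀ < t → θ * (∫ s in (0 : ℝ)..t, f s) ≤ t * f t) (a₁ : ℝ) :
    ∃ M : ℝ, ∀ a, 0 ≤ a → a ≤ a₁ → ∀ t, θ * Fa f a t ≤ t * fa f a t + M := by
  obtain ⟨B, hB0, hB⟩ := exists_abs_le_of_continuousOn hf t₀
  -- The first term covers `[0, t₀]`, where the hypothesis says nothing; the second covers `t < 0`,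
  -- where `F_a ≤ a / 2`. For `t ≥ 0` the terms linear in `a` have the right sign because `θ > 1`.
  refine ⟨(θ + 1) * (B * t₀) + θ * (|a₁| / 2), fun a ha ha₁ t => ?_⟩
  have ha₁' : a ≤ |a₁| := ha₁.trans (le_abs_self a₁)
  have hBt : 0 ≤ B * t₀ := by positivity
  rcases lt_or_ge t 0 with ht | ht
  · have h1 := Fa_le_of_neg (f := f) ha ht
    have h2 := mul_fa_nonneg_of_neg (f := f) ha ht
    nlinarith
  · have hfa : fa f a t = f t - a := if_pos ht
    rw [Fa_of_nonneg ht, hfa]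
    have h3 : θ * (∫ s in (0 : ℝ)..t, f s) ≤ t * f t + (θ + 1) * (B * t₀) := by
      rcases lt_or_ge t₀ t with h | h
      · nlinarith [hAR t h]
      · have h4 : |∫ s in (0 : ℝ)..t, f s| ≤ B * t :=
          abs_integral_le_of_abs_le ht fun s hs hst => hB s hs.le (hst.trans h)
        have h5 := (abs_le.1 (hB t ht h)).1
        have h6 : B * t ≤ B * t₀ := by gcongr
        have h7 := le_abs_self (∫ s in (0 : ℝ)..t, f s)
        have h8 : -(B * t₀) ≤ t * f t := by nlinarith
        nlinarith
    have h4 : 0 ≤ a * t := by positivity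
    have h5 : 0 ≤ θ * (|a₁| / 2) := by positivity
    nlinarith

/-- Superquadratic growth of the primitive. -/
lemma exists_rpow_le_integral (hf : ContinuousOn f (Ici 0)) {θ t₀ : ℝ} (hθ : 2 < θ)
    (ht₀ : 0 < t₀) (hpos : ∀ t, t₀ < t → 0 < θ * (∫ s in (0 : ℝ)..t, f s))
    (hAR : ∀ t, t₀ < t → θ * (∫ s in (0 : ℝ)..t, f s) ≤ t * f t) :
    ∃ c B : ℝ, 0 < c ∧ ∀ t, 0 ≤ t → c * t ^ θ - B ≤ ∫ s in (0 : ℝ)..t, f s := by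
  -- The hypotheses hold only for `t > t₀`, so the base point at which the primitive is positive is
  -- taken strictly beyond `t₀`.
  set t₁ := t₀ + 1 with ht₁
  have ht₁0 : 0 < t₁ := by linarith
  set F : ℝ → ℝ := fun t => ∫ s in (0 : ℝ)..t, f s with hF
  have hFd : ∀ t, 0 < t → HasDerivAt F (f t) t := by
    intro t ht
    have hc : ContinuousAt f t := hf.continuousAt (Ici_mem_nhds ht)
    refine intervalIntegral.integral_hasDerivAt_right ?_ ?_ hc
    · refine (hf.mono ?_).intervalIntegrable
      rw [uIcc_of_le ht.le]
      exact Icc_subset_Ici_self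
    · exact (hf.mono Ioi_subset_Ici_self).stronglyMeasurableAtFilter isOpen_Ioi t ht
  -- The derivative is `t ^ (-θ - 1) * (t * f t - θ * F t)`, whose sign is the Ambrosetti–Rabinowitz
  -- inequality.
  have hmono : MonotoneOn (fun t => F t * t ^ (-θ)) (Ici t₁) := by
    have hd : ∀ t, t₀ < t → HasDerivAt (fun t => F t * t ^ (-θ))
        (f t * t ^ (-θ) + F t * (-θ * t ^ (-θ - 1))) t := fun t ht =>
      (hFd t (by linarith)).mul (Real.hasDerivAt_rpow_const (Or.inl (by linarith)))
    refine monotoneOn_of_deriv_nonneg (convex_Ici t₁)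
      (fun t ht => (hd t (by rw [mem_Ici] at ht; linarith)).continuousAt.continuousWithinAt)
      (fun t ht => ?_) (fun t ht => ?_)
    · rw [interior_Ici, mem_Ioi] at ht
      exact (hd t (by linarith)).differentiableAt.differentiableWithinAt
    · rw [interior_Ici, mem_Ioi] at ht
      rw [(hd t (by linarith)).deriv]
      have ht0 : 0 < t := by linarith
      have h1 : t ^ (-θ) = t ^ (-θ - 1) * t := by
        rw [← Real.rpow_add_one ht0.ne', sub_add_cancel]
      rw [h1]
      have h2 := hAR t (by linarith)
      have h3 : 0 < t ^ (-θ - 1) := Real.rpow_pos_of_pos ht0 _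
      have h4 : 0 ≤ t ^ (-θ - 1) * (t * f t - θ * F t) := mul_nonneg h3.le (by linarith)
      linarith
  obtain ⟨B, hB0, hB⟩ := exists_abs_le_of_continuousOn hf t₁
  have hF₁ : 0 < F t₁ := by
    have := hpos t₁ (by linarith)
    exact pos_of_mul_pos_right this (by linarith)
  set c := F t₁ * t₁ ^ (-θ) with hc
  have hc0 : 0 < c := mul_pos hF₁ (Real.rpow_pos_of_pos ht₁0 _)
  refine ⟨c, B * t₁ + c * t₁ ^ θ, hc0, fun t ht => ?_⟩
  have hBt : 0 ≤ B * t₁ := by positivity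
  have hct : 0 ≤ c * t₁ ^ θ := by positivity
  rcases le_total t₁ t with h | h
  · have h1 := hmono self_mem_Ici (mem_Ici.2 h) h
    have ht0 : 0 < t := by linarith
    have h2 : c * t ^ θ ≤ F t := by
      calc c * t ^ θ ≤ F t * t ^ (-θ) * t ^ θ := by gcongr
        _ = F t := by rw [mul_assoc, ← Real.rpow_add ht0]; simp
    change _ ≤ F t
    linarith
  · have h1 : |F t| ≤ B * t :=
      abs_integral_le_of_abs_le ht fun s hs hst => hB s hs.le (hst.trans h)
    have h2 : c * t ^ θ ≤ c * t₁ ^ θ := by gcongr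
    have h3 : B * t ≤ B * t₁ := by gcongr
    have h4 := neg_abs_le (F t)
    change _ ≤ F t
    linarith

end Grushin

/-! ### Test functions in `D_γ` and the measure with density `g` -/

namespace Grushin

namespace Params

variable (P : Params)

/-- Integration by parts: the classical Grushin gradient of a test function is its weak one. -/
lemma isWeakGrad_gradSmooth {φ : P.Pt → ℝ} (hφ : ContDiff ℝ ∞ φ) (hφc : HasCompactSupport φ) :
    P.IsWeakGrad φ (P.gradSmooth φ) := by
  intro ψ hψ hψc i
  have hline : ∀ {χ : P.Pt → ℝ}, ContDiff ℝ ∞ χ → ∀ z e : P.Pt,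
      HasLineDerivAt ℝ χ (fderiv ℝ χ z e) z e := fun hχ z e =>
    (hχ.differentiable (by simp) z).hasFDerivAt.hasLineDerivAt e
  have key : ∀ (W : P.Pt → ℝ) (e : P.Pt), Continuous W → (∀ z (t : ℝ), W (z + t • e) = W z) →
      ∫ z, φ z * (W z * fderiv ℝ ψ z e) = - ∫ z, W z * fderiv ℝ φ z e * ψ z := by
    intro W e hW hWe
    have hφ' : Continuous fun z => fderiv ℝ φ z e :=
      (hφ.continuous_fderiv (by simp)).clm_apply continuous_const
    have hψ' : Continuous fun z => fderiv ℝ ψ z e :=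
      (hψ.continuous_fderiv (by simp)).clm_apply continuous_const
    have h := integral_bilinear_hasLineDerivAt_right_eq_neg_left_of_integrable
      (μ := (volume : Measure P.Pt)) (B := ContinuousLinearMap.mul ℝ ℝ) (v := e)
      (f := fun z => W z * φ z) (f' := fun z => W z * fderiv ℝ φ z e) (g := ψ)
      (g' := fun z => fderiv ℝ ψ z e) ?_ ?_ ?_ (fun z _ => ?_) (fun z _ => hline hψ z e)
    · simp only [ContinuousLinearMap.mul_apply'] at h
      rw [← h]
      congr 1; ext z; ring
    · exact ((hW.mul hφ').mul hψ.continuous).integrable_of_hasCompactSupport hψc.mul_left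
    · exact ((hW.mul hφ.continuous).mul hψ').integrable_of_hasCompactSupport
        (hφc.mul_left.mul_right)
    · exact ((hW.mul hφ.continuous).mul hψ.continuous).integrable_of_hasCompactSupport
        hψc.mul_left
    · have h1 : HasDerivAt (fun t : ℝ => φ (z + t • e)) (fderiv ℝ φ z e) 0 := hline hφ z e
      have h3 : HasDerivAt (fun t : ℝ => W (z + t • e) * φ (z + t • e))
          (W z * fderiv ℝ φ z e) 0 := by
        simp only [hWe]
        exact h1.const_mul (W z)
      exact h3
  rcases i with i | j
  · simpa only [gradSmooth_inl, one_mul] using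
      key (fun _ => 1) (EuclideanSpace.single i 1, 0) continuous_const fun _ _ => rfl
  · simpa only [gradSmooth_inr] using
      key (fun z => ‖z.1‖ ^ P.γ) (0, EuclideanSpace.single j 1)
        (continuous_fst.norm.rpow_const fun _ => Or.inr P.γ_nonneg) fun z t => by simp

/-- Test functions belong to `D_γ`. -/
lemma exists_eq_of_contDiff {φ : P.Pt → ℝ} (hφ : ContDiff ℝ ∞ φ) (hφc : HasCompactSupport φ) :
    ∃ w : P.D, w =ᵐ[volume] φ := by
  have h1 : MemLp φ (ENNReal.ofReal P.critExp) volume :=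
    hφ.continuous.memLp_of_hasCompactSupport hφc
  have h2 : MemLp (P.gradSmooth φ) 2 volume :=
    (P.continuous_gradSmooth (hφ.of_le (by exact_mod_cast le_top))).memLp_of_hasCompactSupport
      (P.hasCompactSupport_gradSmooth hφc)
  have hmem : (h1.toLp φ, h2.toLp _) ∈ P.graph := by
    intro ψ hψ hψc i
    refine Eq.trans (integral_congr_ae ?_)
      ((P.isWeakGrad_gradSmooth hφ hφc ψ hψ hψc i).trans (congrArg _ (integral_congr_ae ?_)))
    · filter_upwards [h1.coeFn_toLp] with z hz
      rw [hz]
    · filter_upwards [h2.coeFn_toLp] with z hz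
      rw [hz]
  exact ⟨D.mk _ hmem, h1.coeFn_toLp⟩

/-- There is a nonnegative element of `D_γ` which is not zero. -/
lemma exists_nonneg_ne_zero : ∃ w : P.D, (∀ᵐ z, 0 ≤ w z) ∧ ¬ (∀ᵐ z, w z = 0) := by
  let χ : ContDiffBump (0 : P.Pt) := ⟨1, 2, one_pos, one_lt_two⟩
  obtain ⟨w, hw⟩ := P.exists_eq_of_contDiff χ.contDiff χ.hasCompactSupport
  refine ⟨w, ?_, fun h => ?_⟩
  · filter_upwards [hw] with z hz
    rw [hz]
    exact χ.nonneg
  · have h1 : (χ : P.Pt → ℝ) =ᵐ[volume] fun _ => 0 := by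
      filter_upwards [hw, h] with z hz hz'
      rw [← hz, hz']
    have h2 := Measure.eq_of_ae_eq h1 χ.continuous continuous_const
    have h3 := χ.pos_of_mem_ball (x := 0) (Metric.mem_ball_self two_pos)
    rw [h2] at h3
    exact lt_irrefl _ h3

/-- The measure with density `g`. -/
lemma exists_density_measure {g : P.Pt → ℝ} (hg_one : MemLp g 1 volume)
    (hg_top : MemLp g ⊤ volume) (hg_pos : ∀ᵐ z, 0 < g z) :
    ∃ ν : Measure P.Pt, IsFiniteMeasure ν ∧ (∃ M : ℝ≥0∞, M ≠ ⊤ ∧ ν ≤ M • volume) ∧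
      volume ≪ ν ∧ ∀ H : P.Pt → ℝ, (Integrable H ν ↔ Integrable fun z => g z * H z) ∧
        ∫ z, H z ∂ν = ∫ z, g z * H z := by
  have hgm := hg_one.1.aemeasurable
  -- A measurable finite density equal to `g` almost everywhere. Integrability of `g` makes the
  -- measure finite, boundedness makes it dominated by Lebesgue measure, and positivity gives the
  -- reverse absolute continuity.
  set G : P.Pt → NNReal := fun z => (hgm.mk g z).toNNReal with hG
  have hGm : Measurable G := hgm.measurable_mk.real_toNNReal
  have hGg : ∀ᵐ z, (G z : ℝ) = g z ∧ (G z : ℝ≥0∞) = ‖g z‖ₑ := by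
    filter_upwards [hgm.ae_eq_mk, hg_pos] with z h1 h2
    simp only [hG, ← h1]
    refine ⟨Real.coe_toNNReal _ h2.le, ?_⟩
    rw [← ofReal_norm, Real.norm_of_nonneg h2.le]
    rfl
  refine ⟨volume.withDensity fun z => G z, ?_, ⟨eLpNorm g ⊤ volume, hg_top.2.ne, ?_⟩, ?_,
    fun H => ⟨?_, ?_⟩⟩
  · refine isFiniteMeasure_withDensity ?_
    rw [lintegral_congr_ae (hGg.mono fun z hz => hz.2), ← eLpNorm_one_eq_lintegral_enorm]
    exact hg_one.2.ne
  · rw [← withDensity_const]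
    refine withDensity_mono ?_
    filter_upwards [hGg, ae_le_eLpNormEssSup (f := g) (μ := volume)] with z h1 h2
    rw [h1.2, eLpNorm_exponent_top]
    exact h2
  · refine withDensity_absolutelyContinuous' hGm.coe_nnreal_ennreal.aemeasurable ?_
    filter_upwards [hGg, hg_pos] with z h1 h2
    rw [h1.2, Ne, enorm_eq_zero]
    exact h2.ne'
  · rw [integrable_withDensity_iff_integrable_smul hGm]
    refine integrable_congr ?_
    filter_upwards [hGg] with z hz
    rw [NNReal.smul_def, hz.1, smul_eq_mul]
  · rw [integral_withDensity_eq_integral_smul hGm]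
    refine integral_congr_ae ?_
    filter_upwards [hGg] with z hz
    rw [NNReal.smul_def, hz.1, smul_eq_mul]

end Params

/-- The `α`-th power of the norm of a linear image in `L^α`. -/
lemma integral_abs_rpow_le {Ω X : Type*} [MeasurableSpace Ω] {ν : Measure Ω} {α : ℝ}
    [Fact (1 ≤ ENNReal.ofReal α)] [NormedAddCommGroup X] [NormedSpace ℝ X] (hα : 1 ≤ α)
    (J : X →L[ℝ] Lp ℝ (ENNReal.ofReal α) ν) (u : X) :
    Integrable (fun z => |J u z| ^ α) ν ∧ ∫ z, |J u z| ^ α ∂ν ≤ ‖J‖ ^ α * ‖u‖ ^ α := by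
  have hα0 : ENNReal.ofReal α ≠ 0 := by rw [Ne, ENNReal.ofReal_eq_zero]; linarith
  have hm := Lp.memLp (J u)
  have h1 := hm.integrable_norm_rpow hα0 (by simp)
  have h2 := hm.eLpNorm_eq_integral_rpow_norm hα0 (by simp)
  rw [ENNReal.toReal_ofReal (by linarith)] at h1 h2
  refine ⟨h1, ?_⟩
  have h0 : 0 ≤ ∫ z, ‖J u z‖ ^ α ∂ν := integral_nonneg fun z => by positivity
  have h3 : ‖J u‖ = (∫ z, ‖J u z‖ ^ α ∂ν) ^ α⁻¹ := by
    rw [Lp.norm_def, h2, ENNReal.toReal_ofReal (by positivity)]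
  calc ∫ z, |J u z| ^ α ∂ν = ‖J u‖ ^ α := by
        rw [h3, ← Real.rpow_mul h0, inv_mul_cancel₀ (by linarith), Real.rpow_one]
        rfl
    _ ≤ (‖J‖ * ‖u‖) ^ α := by gcongr; exact J.le_opNorm u
    _ = _ := Real.mul_rpow (norm_nonneg _) (norm_nonneg _)

end Grushin

/-! ### The mountain pass geometry -/

namespace Grushin

/-- The primitive dominates every quadratic. -/
lemma exists_quadratic_le_integral {f : ℝ → ℝ} (hf : ContinuousOn f (Ici 0)) {θ t₀ : ℝ}
    (hθ : 2 < θ) (ht₀ : 0 < t₀) (hpos : ∀ t, t₀ < t → 0 < θ * (∫ s in (0 : ℝ)..t, f s))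
    (hAR : ∀ t, t₀ < t → θ * (∫ s in (0 : ℝ)..t, f s) ≤ t * f t) (A : ℝ) :
    ∃ B : ℝ, ∀ t, 0 ≤ t → A * t ^ 2 - B ≤ ∫ s in (0 : ℝ)..t, f s := by
  obtain ⟨c, B, hc, hB⟩ := exists_rpow_le_integral hf hθ ht₀ hpos hAR
  have h1 := (tendsto_rpow_atTop (show 0 < θ - 2 by linarith)).eventually_ge_atTop (|A| / c)
  obtain ⟨τ, hτ⟩ := eventually_atTop.1 (h1.and (eventually_gt_atTop 0))
  refine ⟨B + |A| * τ ^ 2, fun t ht => ?_⟩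
  have hA2 : A * t ^ 2 ≤ |A| * t ^ 2 := by gcongr; exact le_abs_self A
  have hA3 : 0 ≤ |A| * τ ^ 2 := by positivity
  have h2 := hB t ht
  rcases le_total τ t with h | h
  · obtain ⟨h3, h4⟩ := hτ t h
    rw [div_le_iff₀ hc] at h3
    have h5 : t ^ θ = t ^ (θ - 2) * t ^ 2 := by
      rw [← Real.rpow_two, ← Real.rpow_add h4, sub_add_cancel]
    have h6 : |A| * t ^ 2 ≤ c * t ^ θ := by
      rw [h5, ← mul_assoc, mul_comm c]
      gcongr
    linarith
  · have h3 : |A| * t ^ 2 ≤ |A| * τ ^ 2 := by gcongr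
    have h4 : 0 ≤ c * t ^ θ := mul_nonneg hc.le (Real.rpow_nonneg ht θ)
    linarith

section Geometry

variable {Ω X : Type*} [MeasurableSpace Ω] {ν : Measure Ω} [IsFiniteMeasure ν]
  [NormedAddCommGroup X] [InnerProductSpace ℝ X] {f : ℝ → ℝ} {α : ℝ}

lemma integrable_Fa (hf : ContinuousOn f (Ici 0)) (h0 : f 0 = 0) {C a : ℝ} (hα : 1 < α)
    (hC : 0 ≤ C) (hg : ∀ t, 0 ≤ t → |f t| ≤ C * (1 + t ^ (α - 1))) (ha : 0 ≤ a)
    (u : Lp ℝ (ENNReal.ofReal α) ν) : Integrable (fun z => Fa f a (u z)) ν :=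
  integrable_primitive hα (abs_fa_le h0 hα hC hg ha) (hasDerivAt_Fa hf h0 a) (Lp.memLp u)

variable [Fact (1 ≤ ENNReal.ofReal α)]

/-- The energy is bounded below on small spheres, uniformly in small `a`. -/
lemma exists_le_energy_on_sphere (hf : ContinuousOn f (Ici 0)) (h0 : f 0 = 0)
    (hlim : Tendsto (fun t => f t / t) (𝓝[>] 0) (𝓝 0)) {L : ℝ} (hα : 2 < α)
    (hL : Tendsto (fun t => f t / t ^ (α - 1)) atTop (𝓝 L))
    [Fact (1 ≤ ENNReal.ofReal 2)]
    (J : X →L[ℝ] Lp ℝ (ENNReal.ofReal α) ν) (J₂ : X →L[ℝ] Lp ℝ (ENNReal.ofReal 2) ν)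
    (hJ : ∀ u, J₂ u =ᵐ[ν] J u) :
    ∃ r : ℝ, 0 < r ∧ ∀ ρ ∈ Ioo 0 r, ∃ a₁ : ℝ, 0 < a₁ ∧ a₁ ≤ 1 ∧ ∀ a ∈ Ioo 0 a₁, ∀ u : X, ‖u‖ = ρ →
      ρ ^ 2 / 8 ≤ 1 / 2 * ‖u‖ ^ 2 - ∫ z, Fa f a (J u z) ∂ν := by
  obtain ⟨C, hC0, hC⟩ := exists_growth hf hL
  -- The three terms bounding `∫ F_a` each get `ρ ^ 2 / 8`, leaving `ρ ^ 2 / 8` out of `ρ ^ 2 / 2`.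
  -- Here `ε` handles the quadratic term; the radius `r` handles the power `α > 2`.
  set ε : ℝ := 1 / (8 * (‖J₂‖ ^ (2 : ℝ) + 1)) with hε
  have hε0 : 0 < ε := by positivity
  obtain ⟨A, hA0, hA⟩ := exists_Fa_le hf hlim hα hL hε0
  have hAJ : 0 ≤ A * ‖J‖ ^ α := by positivity
  have h1 : Tendsto (fun ρ : ℝ => A * ‖J‖ ^ α * ρ ^ (α - 2)) (𝓝[>] 0) (𝓝 0) := by
    have h2 : Continuous fun ρ : ℝ => A * ‖J‖ ^ α * ρ ^ (α - 2) :=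
      continuous_const.mul (continuous_id.rpow_const fun _ => Or.inr (by linarith))
    have h3 := (h2.tendsto 0).mono_left (nhdsWithin_le_nhds (s := Ioi 0))
    rwa [Real.zero_rpow (by linarith), mul_zero] at h3
  obtain ⟨r, hr0, hr⟩ := mem_nhdsGT_iff_exists_Ioo_subset.1
    (h1.eventually_le_const (show (0 : ℝ) < 1 / 8 by norm_num))
  refine ⟨r, hr0, fun ρ hρ => ?_⟩
  have hρ0 : 0 < ρ := hρ.1
  set V := ν.real univ with hV
  have hV0 : 0 ≤ V := measureReal_nonneg
  -- The second entry makes the constant term `a / 2 * V` at most `ρ ^ 2 / 8`. The cap at `1`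
  -- matches the range of `a` for which a far point with negative energy is produced.
  refine ⟨min 1 (ρ ^ 2 / (4 * (V + 1))), by positivity, min_le_left _ _, fun a ha u hu => ?_⟩
  have haV : a * V ≤ ρ ^ 2 / 4 := by
    have h2 : a ≤ ρ ^ 2 / (4 * (V + 1)) := ha.2.le.trans (min_le_right _ _)
    rw [le_div_iff₀ (by positivity)] at h2
    nlinarith [ha.1]
  obtain ⟨i1, b1⟩ := integral_abs_rpow_le (by linarith) J u
  obtain ⟨i2, b2⟩ := integral_abs_rpow_le (by norm_num) J₂ u
  have i2' : Integrable (fun z => |J u z| ^ (2 : ℝ)) ν := by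
    refine i2.congr ?_
    filter_upwards [hJ u] with z hz
    rw [hz]
  have b2' : ∫ z, |J u z| ^ (2 : ℝ) ∂ν ≤ ‖J₂‖ ^ (2 : ℝ) * ρ ^ 2 := by
    rw [← hu, ← Real.rpow_two ‖u‖]
    refine le_trans (le_of_eq (integral_congr_ae ?_)) b2
    filter_upwards [hJ u] with z hz
    rw [hz]
  have h2 : ∫ z, Fa f a (J u z) ∂ν ≤
      ∫ z, (a / 2 + ε * |J u z| ^ (2 : ℝ) + A * |J u z| ^ α) ∂ν :=
    integral_mono (integrable_Fa hf h0 (by linarith) hC0 hC ha.1.le (J u))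
      (((integrable_const _).add (i2'.const_mul ε)).add (i1.const_mul A))
      fun z => hA a ha.1.le (J u z)
  have i3 : Integrable (fun z => a / 2 + ε * |J u z| ^ (2 : ℝ)) ν :=
    (integrable_const _).add (i2'.const_mul ε)
  rw [integral_add i3 (i1.const_mul A), integral_add (integrable_const _) (i2'.const_mul ε),
    integral_const_mul, integral_const_mul, integral_const, smul_eq_mul] at h2
  have h3 : ε * (∫ z, |J u z| ^ (2 : ℝ) ∂ν) ≤ ρ ^ 2 / 8 := by
    calc _ ≤ ε * (‖J₂‖ ^ (2 : ℝ) * ρ ^ 2) := by gcongr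
      _ ≤ ε * ((‖J₂‖ ^ (2 : ℝ) + 1) * ρ ^ 2) := by gcongr; linarith
      _ = _ := by rw [hε]; field_simp
  have h4 : A * (∫ z, |J u z| ^ α ∂ν) ≤ ρ ^ 2 / 8 := by
    have h5 : ρ ^ α = ρ ^ (α - 2) * ρ ^ 2 := by
      rw [← Real.rpow_two, ← Real.rpow_add hρ0, sub_add_cancel]
    have h6 : A * ‖J‖ ^ α * ρ ^ (α - 2) ≤ 1 / 8 := hr hρ
    calc _ ≤ A * (‖J‖ ^ α * ρ ^ α) := by rw [← hu]; gcongr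
      _ = A * ‖J‖ ^ α * ρ ^ (α - 2) * ρ ^ 2 := by rw [h5]; ring
      _ ≤ 1 / 8 * ρ ^ 2 := by gcongr
      _ = _ := by ring
  rw [hu]
  linarith

/-- The energy is negative far out on rays through nonnegative directions. -/
lemma exists_energy_neg (hf : ContinuousOn f (Ici 0)) (h0 : f 0 = 0) {C : ℝ} (hα : 1 < α)
    (hC : 0 ≤ C) (hg : ∀ t, 0 ≤ t → |f t| ≤ C * (1 + t ^ (α - 1)))
    (hquad : ∀ A : ℝ, ∃ B : ℝ, ∀ t, 0 ≤ t → A * t ^ 2 - B ≤ ∫ s in (0 : ℝ)..t, f s)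
    [Fact (1 ≤ ENNReal.ofReal 2)]
    (J : X →L[ℝ] Lp ℝ (ENNReal.ofReal α) ν) (J₂ : X →L[ℝ] Lp ℝ (ENNReal.ofReal 2) ν)
    (hJ : ∀ u, J₂ u =ᵐ[ν] J u) {w : X} (hw : ∀ᵐ z ∂ν, 0 ≤ J w z) (hw0 : ¬ ∀ᵐ z ∂ν, J w z = 0)
    (ρ : ℝ) : ∃ v : X, ρ < ‖v‖ ∧ ∀ a ∈ Ioo (0 : ℝ) 1,
      1 / 2 * ‖v‖ ^ 2 - ∫ z, Fa f a (J v z) ∂ν < 0 := by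
  have i1 : Integrable (J w) ν :=
    (Lp.memLp (J w)).integrable (ENNReal.one_le_ofReal.2 hα.le)
  have i2 : Integrable (fun z => (J w z) ^ 2) ν := by
    refine (integral_abs_rpow_le (by norm_num) J₂ w).1.congr ?_
    filter_upwards [hJ w] with z hz
    rw [hz, Real.rpow_two, sq_abs]
  have hS : 0 < ∫ z, (J w z) ^ 2 ∂ν := by
    refine lt_of_le_of_ne (integral_nonneg fun z => sq_nonneg _) fun h => hw0 ?_
    have := (integral_eq_zero_iff_of_nonneg (fun z => sq_nonneg _) i2).1 h.symm
    filter_upwards [this] with z hz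
    simpa using hz
  have hn : 0 < ‖w‖ := by
    rw [norm_pos_iff]
    rintro rfl
    refine hw0 ?_
    rw [map_zero]
    exact Lp.coeFn_zero _ _ _
  set S := ∫ z, (J w z) ^ 2 ∂ν
  set m := ∫ z, J w z ∂ν
  have hm : 0 ≤ m := integral_nonneg_of_ae hw
  -- With this coefficient the potential term at `T • w` is at least `T ^ 2 * ‖w‖ ^ 2` up to lower
  -- order, twice the kinetic energy.
  obtain ⟨B, hB⟩ := hquad (‖w‖ ^ 2 / S)
  set b := |B * ν.real univ| with hb
  have hb0 : 0 ≤ b := abs_nonneg _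
  -- The summands ensure in turn `T ≥ 1`, `‖T • w‖ > ρ`, and that `T ^ 2 * ‖w‖ ^ 2 / 2` beats the
  -- lower order terms `b + T * m`. The last uses `a < 1` only to replace `a * m` by `m`.
  set T : ℝ := 1 + |ρ| / ‖w‖ + 2 * (b + m) / ‖w‖ ^ 2 with hT
  have hρ1 : 0 ≤ |ρ| / ‖w‖ := by positivity
  have hbm : 0 ≤ 2 * (b + m) / ‖w‖ ^ 2 := by positivity
  have hT1 : 1 ≤ T := by linarith
  have hT0 : 0 ≤ T := by linarith
  have hnorm : ‖T • w‖ = T * ‖w‖ := by rw [norm_smul, Real.norm_of_nonneg hT0]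
  refine ⟨T • w, ?_, fun a ha => ?_⟩
  · rw [hnorm]
    have : |ρ| / ‖w‖ < T := by linarith
    rw [div_lt_iff₀ hn] at this
    exact (le_abs_self ρ).trans_lt this
  · have h1 : ‖w‖ ^ 2 / S * T ^ 2 * S - B * ν.real univ - T * m ≤
        ∫ z, Fa f a (J (T • w) z) ∂ν := by
      have i3 : Integrable (fun z => ‖w‖ ^ 2 / S * T ^ 2 * (J w z) ^ 2 - B) ν :=
        (i2.const_mul _).sub (integrable_const B)
      have h2 : ‖w‖ ^ 2 / S * T ^ 2 * S - B * ν.real univ - T * m =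
          ∫ z, (‖w‖ ^ 2 / S * T ^ 2 * (J w z) ^ 2 - B - T * J w z) ∂ν := by
        rw [integral_sub i3 (i1.const_mul T), integral_sub (i2.const_mul _) (integrable_const B),
          integral_const_mul, integral_const_mul, integral_const, smul_eq_mul, mul_comm B]
      rw [h2]
      refine integral_mono_ae (i3.sub (i1.const_mul T))
        (integrable_Fa hf h0 hα hC hg ha.1.le _) ?_
      rw [map_smul]
      filter_upwards [Lp.coeFn_smul T (J w), hw] with z hz hz0
      rw [hz, Pi.smul_apply, smul_eq_mul]
      have hTz : 0 ≤ T * J w z := mul_nonneg hT0 hz0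
      rw [Fa_of_nonneg hTz]
      have h3 := hB _ hTz
      have h4 : a * (T * J w z) ≤ T * J w z := mul_le_of_le_one_left hTz ha.2.le
      have h5 : ‖w‖ ^ 2 / S * T ^ 2 * J w z ^ 2 = ‖w‖ ^ 2 / S * (T * J w z) ^ 2 := by ring
      linarith
    have h2 : ‖w‖ ^ 2 / S * T ^ 2 * S = ‖w‖ ^ 2 * T ^ 2 := by field_simp
    have h3 : b + m < ‖w‖ ^ 2 / 2 * T := by
      have : 2 * (b + m) / ‖w‖ ^ 2 < T := by linarith
      rw [div_lt_iff₀ (by positivity)] at this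
      linarith
    have h4 : B * ν.real univ ≤ b := le_abs_self _
    have h5 : T * (b + m) < T * (‖w‖ ^ 2 / 2 * T) := by gcongr
    have h6 : b ≤ T * b := le_mul_of_one_le_left hb0 hT1
    rw [hnorm, mul_pow]
    nlinarith

/-- On a segment from the origin the energy is bounded, uniformly in bounded `a`. -/
lemma exists_energy_smul_le (hf : ContinuousOn f (Ici 0)) (h0 : f 0 = 0) {C : ℝ} (hα : 1 < α)
    (hC : 0 ≤ C) (hg : ∀ t, 0 ≤ t → |f t| ≤ C * (1 + t ^ (α - 1)))
    (J : X →L[ℝ] Lp ℝ (ENNReal.ofReal α) ν) (v : X) (a₁ : ℝ) :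
    ∃ A : ℝ, ∀ a, 0 ≤ a → a ≤ a₁ → ∀ t : unitInterval,
      1 / 2 * ‖(t : ℝ) • v‖ ^ 2 - ∫ z, Fa f a (J ((t : ℝ) • v) z) ∂ν ≤ A := by
  obtain ⟨q, hαq⟩ : ∃ q, α.HolderConjugate q := ⟨_, Real.HolderConjugate.conjExponent hα⟩
  have := hαq.symm.ennrealOfReal
  -- The first part bounds the Taylor remainder of `F_a` at `0`, the second its linear term. The
  -- resulting bound is increasing in `|s|`, so its value at `v` serves the whole segment.
  set c : ℝ := 2 * (C + |a₁|) * 2 ^ (α - 1) + (C + |a₁|) with hc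
  have hc0 : 0 ≤ c := by positivity
  have i1 : Integrable (fun z => c * (1 + |J v z| ^ (α - 1)) * |J v z|) ν :=
    (memLp_one_add_rpow hαq (Lp.memLp (J v)) c).integrable_mul (Lp.memLp (J v)).norm
  refine ⟨1 / 2 * ‖v‖ ^ 2 + ∫ z, c * (1 + |J v z| ^ (α - 1)) * |J v z| ∂ν,
    fun a ha ha₁ t => ?_⟩
  have hbound : ∀ s, |Fa f a s| ≤ c * (1 + |s| ^ (α - 1)) * |s| := by
    intro s
    have ha' : a ≤ |a₁| := ha₁.trans (le_abs_self _)
    have hk := abs_fa_le h0 hα hC hg ha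
    have h1 := abs_taylor_remainder_le hα hk (hasDerivAt_Fa hf h0 a) 0 s
    rw [zero_add, Fa_zero, sub_zero, abs_zero, Real.zero_rpow (by linarith), add_zero] at h1
    have h2 := hk 0
    rw [abs_zero, Real.zero_rpow (by linarith), add_zero, mul_one] at h2
    have hp : 0 ≤ |s| ^ (α - 1) := by positivity
    calc |Fa f a s| = |(Fa f a s - fa f a 0 * s) + fa f a 0 * s| := by rw [sub_add_cancel]
      _ ≤ |Fa f a s - fa f a 0 * s| + |fa f a 0| * |s| := by
          rw [← abs_mul]; exact abs_add_le _ _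
      _ ≤ 2 * (C + a) * 2 ^ (α - 1) * (1 + |s| ^ (α - 1)) * |s| + (C + a) * |s| := by gcongr
      _ ≤ 2 * (C + |a₁|) * 2 ^ (α - 1) * (1 + |s| ^ (α - 1)) * |s| +
          (C + |a₁|) * (1 + |s| ^ (α - 1)) * |s| := by
          gcongr ?_ + ?_ * _
          · gcongr
          · nlinarith [abs_nonneg a₁]
      _ = _ := by rw [hc]; ring
  have h1 : ‖(t : ℝ) • v‖ ≤ ‖v‖ := by
    rw [norm_smul, Real.norm_of_nonneg t.2.1]
    exact mul_le_of_le_one_left (norm_nonneg _) t.2.2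
  have h2 : - ∫ z, Fa f a (J ((t : ℝ) • v) z) ∂ν ≤
      ∫ z, c * (1 + |J v z| ^ (α - 1)) * |J v z| ∂ν := by
    rw [← integral_neg]
    refine integral_mono_ae (integrable_Fa hf h0 hα hC hg ha _).neg i1 ?_
    rw [map_smul]
    filter_upwards [Lp.coeFn_smul (t : ℝ) (J v)] with z hz
    rw [hz, Pi.smul_apply, smul_eq_mul]
    have h3 : |(t : ℝ) * J v z| ≤ |J v z| := by
      rw [abs_mul, abs_of_nonneg t.2.1]
      exact mul_le_of_le_one_left (abs_nonneg _) t.2.2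
    calc -Fa f a (t * J v z) ≤ |Fa f a (t * J v z)| := neg_le_abs _
      _ ≤ _ := hbound _
      _ ≤ _ := by gcongr
  have h3 : ‖(t : ℝ) • v‖ ^ 2 ≤ ‖v‖ ^ 2 := by gcongr
  linarith

end Geometry

end Grushin

/-! ### The main theorem -/

theorem theorem4p2 (P : Grushin.Params) (f : ℝ → ℝ) (hf : Grushin.Admissible P f)
    (g : P.Pt → ℝ) (hg_one : MemLp g 1 volume) (hg_top : MemLp g ⊤ volume)
    (hg_pos : ∀ᵐ z, 0 < g z) :
    -- the energies are well defined
    (∀ a : ℝ, 0 < a → ∀ u : P.D, Integrable (fun z => g z * Grushin.Fa f a (u z))) ∧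
    -- admissible `a₁` exist
    (∃ r : ℝ, 0 < r ∧ ∀ ρ ∈ Ioo 0 r, ∃ (δ a₁ : ℝ) (v : P.D),
      Grushin.MountainPassGeometry P f g ρ δ a₁ v) ∧
    -- for each of them there are uniformly bounded mountain pass solutions
    ∀ (ρ δ a₁ : ℝ) (v : P.D), Grushin.MountainPassGeometry P f g ρ δ a₁ v →
      ∃ C : ℝ, 0 < C ∧ ∀ a ∈ Ioo 0 a₁, ∃ u : P.D,
        u ≠ 0 ∧
        Grushin.IsWeakSolution P f g a u ∧
        HasFDerivAt (Grushin.energy P f g a) (0 : P.D →L[ℝ] ℝ) u ∧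
        Grushin.IsMountainPassLevel (Grushin.energy P f g a) v (Grushin.energy P f g a u) ∧
        δ ≤ Grushin.energy P f g a u ∧
        ‖u‖ ≤ C := by
  obtain ⟨hfc, hf0, hlim, ⟨α, hα2, hαc, L, hL⟩, θ, hθ, t₀, ht₀, hARf⟩ := hf
  have hα1 : 1 < α := by linarith
  obtain ⟨A, hA0, hA⟩ := Grushin.exists_growth hfc hL
  obtain ⟨ν, hνfin, ⟨M, hM, hνM⟩, hνac, hν⟩ := P.exists_density_measure hg_one hg_top hg_pos
  have : Fact (1 ≤ ENNReal.ofReal α) := ⟨ENNReal.one_le_ofReal.2 hα1.le⟩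
  have : Fact (1 ≤ ENNReal.ofReal 2) := ⟨ENNReal.one_le_ofReal.2 one_le_two⟩
  obtain ⟨J, hJ, hJc⟩ := P.exists_compact_embedding hM hνM hα1.le hαc
  obtain ⟨J₂, hJ₂, -⟩ := P.exists_compact_embedding hM hνM (α := 2) one_le_two
    P.two_lt_critExp
  have hJJ : ∀ u, J₂ u =ᵐ[ν] J u := fun u => (hJ₂ u).trans (hJ u).symm
  have hE : ∀ a u, Grushin.energy P f g a u =
      1 / 2 * ‖u‖ ^ 2 - ∫ z, Grushin.Fa f a (J u z) ∂ν := fun a u => by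
    rw [Grushin.energy, ← (hν _).2]
    congr 1
    refine integral_congr_ae ?_
    filter_upwards [hJ u] with z hz
    rw [hz]
  refine ⟨fun a ha u => ?_, ?_, ?_⟩
  · refine (hν _).1.1 ((Grushin.integrable_Fa hfc hf0 hα1 hA0 hA ha.le (J u)).congr ?_)
    filter_upwards [hJ u] with z hz
    rw [hz]
  · obtain ⟨r, hr0, hr⟩ := Grushin.exists_le_energy_on_sphere hfc hf0 hlim hα2 hL J J₂ hJJ
    obtain ⟨w, hw, hw0⟩ := P.exists_nonneg_ne_zero
    have hνle : ν ≪ volume := Measure.absolutelyContinuous_of_le_smul hνM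
    refine ⟨r, hr0, fun ρ hρ => ?_⟩
    obtain ⟨a₁, ha₁0, ha₁1, ha₁⟩ := hr ρ hρ
    obtain ⟨v, hv, hneg⟩ := Grushin.exists_energy_neg hfc hf0 hα1 hA0 hA
      (Grushin.exists_quadratic_le_integral hfc hθ ht₀ (fun t ht => (hARf t ht).1)
        fun t ht => (hARf t ht).2) J J₂ hJJ (w := w)
      (by filter_upwards [hνle.ae_le hw, hJ w] with z h1 h2; rwa [h2])
      (fun h => hw0 (hνac.ae_le (by filter_upwards [h, hJ w] with z h1 h2; rwa [← h2]))) ρ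
    have hρ0 : 0 < ρ := hρ.1
    refine ⟨ρ ^ 2 / 8, a₁, v, hρ0, by positivity, ha₁0, fun a ha u hu => ?_, hv, fun a ha => ?_⟩
    · rw [hE]
      exact ha₁ a ha u hu
    · rw [hE]
      exact hneg a ⟨ha.1, ha.2.trans_le ha₁1⟩
  · intro ρ δ a₁ v hmp
    obtain ⟨B, hB⟩ := Grushin.exists_energy_smul_le hfc hf0 hα1 hA0 hA J v a₁
    obtain ⟨m, hm⟩ := Grushin.exists_ambrosetti_rabinowitz_fa hfc hθ ht₀
      (fun t ht => (hARf t ht).2) a₁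
    set κ : ℝ := 1 / 2 - 1 / θ with hκ
    have hκ0 : 0 < κ := by
      rw [hκ, sub_pos]
      exact one_div_lt_one_div_of_lt (by norm_num) hθ
    set R : ℝ := |B + m / θ * ν.real univ| / κ with hR
    have hR0 : 0 ≤ R := by positivity
    -- `R` bounds `‖u‖ ^ 2` and is built from constants independent of `a`; `R + 1` then bounds
    -- `‖u‖` because `2 * ‖u‖ ≤ ‖u‖ ^ 2 + 1`.
    refine ⟨R + 1, by positivity, fun a ha => ?_⟩
    have hk := Grushin.abs_fa_le hf0 hα1 hA0 hA ha.1.le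
    have hkc := Grushin.continuous_fa hfc hf0 a
    have hK := Grushin.hasDerivAt_Fa hfc hf0 a
    obtain ⟨Γ, -, -, hΓd⟩ := Grushin.exists_gradient_integral_comp hα1 hkc hk hK J
    have hEc : Continuous (Grushin.energy P f g a) := by
      rw [funext (hE a)]
      have h1 : Continuous fun u => ∫ z, Grushin.Fa f a (J u z) ∂ν :=
        continuous_iff_continuousAt.2 fun u => (hΓd u).continuousAt
      fun_prop
    obtain ⟨c, hc, hδc, hcM⟩ := Grushin.exists_isMountainPassLevel hEc hmp.ρ_pos.le hmp.far.le
      (hmp.sphere a ha)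
    have hc0 : 0 < c := hmp.δ_pos.trans_le hδc
    have hE0 : Grushin.energy P f g a 0 = 0 := by
      rw [hE, map_zero, norm_zero]
      have : ∫ z, Grushin.Fa f a ((0 : Lp ℝ (ENNReal.ofReal α) ν) z) ∂ν = 0 := by
        refine integral_eq_zero_of_ae ?_
        filter_upwards [Lp.coeFn_zero ℝ (ENNReal.ofReal α) ν] with z hz
        rw [hz, Pi.zero_apply, Grushin.Fa_zero]
      rw [this]
      norm_num
    obtain ⟨u, huc, hsol, hder, hbd⟩ := Grushin.exists_critical_of_ambrosetti_rabinowitz hα1 hkc hk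
      hK J hJc hθ (hm a ha.1.le ha.2.le) (hE a) hc (by rwa [hE0]) ((hmp.neg a ha).trans hc0)
    refine ⟨u, ?_, fun φ => ?_, hder, by rwa [huc], by rwa [huc], ?_⟩
    -- The energy vanishes at the origin, whereas the critical level is positive.
    · rintro rfl
      linarith
    · have e1 : (fun z => Grushin.fa f a (J u z) * J φ z) =ᵐ[ν]
          fun z => Grushin.fa f a (u z) * φ z := by
        filter_upwards [hJ u, hJ φ] with z h1 h2
        rw [h1, h2]
      have i1 := (Grushin.integrable_nemytskii_mul hα1 hkc hk (Lp.memLp (J u))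
        (Lp.memLp (J φ))).congr e1
      have i2 := (hν _).1.1 i1
      have e2 := (hν fun z => Grushin.fa f a (u z) * φ z).2
      simp only [← mul_assoc] at i2 e2
      refine ⟨i2, ?_⟩
      rw [← e2, ← Grushin.Params.D.inner_def, hsol φ]
      exact integral_congr_ae e1
    -- Testing the level with the straight segment to `v`, which does not depend on `a`, makes the
    -- bound uniform.
    · have h1 : c ≤ B := hcM B fun t => by
        rw [hE]
        exact hB a ha.1.le ha.2.le t
      have h2 : ‖u‖ ^ 2 ≤ R := by
        rw [hR, le_div_iff₀ hκ0]
        have := le_abs_self (B + m / θ * ν.real univ)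
        rw [← hκ] at hbd
        linarith
      nlinarith [norm_nonneg u, sq_nonneg (‖u‖ - 1)]
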